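/- **Setting.** Let $E=\mathbb C^d$ with the inner product $p^*z=\sum_i\overline{p_i}z_i$, let $p\in\mathbb R^d\subset E$, let $K_0\subset E$ be a compact absolutely convex neighbourhood of $0$ (that is, $ax+by\in K_0$ for $x,y\in K_0$, $a,b\in\mathbb C$, $|a|+|b|\le1$), $|x|_{K_0}=\inf\{r>0:x\in rK_0\}$, and $K=p+K_0$. Let $V$ be a holomorphic $E$-valued map on an open set $U\supset K$ with $V(p)=0$, such that all eigenvalues of the Jacobian matrix of $V$ at $p$ are real. Let $T>0$ be such that for every $w\in K$ the equation $\dot z=V(z)$, $z(0)=w$, has a solution $t\mapsto\phi^t(w)$ in $U$ on $[0,T]$, and put $f=\phi^T$. For multi-indices $\alpha$ put $u_{p,\alpha}(z)=\frac{e^{-\|p\|^2/2}}{\sqrt{\alpha!}}(z-p)^\alpha e^{p^*z}$ and let $\mathbf u_{p,n}(z)$ be the row vector $(u_{p,\alpha}(z))_{|\alpha|\le n}$. Let $\mathfrak D_{p,n}$ be the span of the functionals $\delta_p^\alpha(h)=(\partial^\alpha h)(p)$, $|\alpha|\le n$, on functions $h$ holomorphic near $p$; let $f_*\ell(h)=\ell(h\circ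 f)$, and let $\overline{\mathbf{FB}}(\ell)(\zeta)=\overline{\ell(e^{\zeta^*\cdot})}$. Since $f(p)=p$, $f_*$ maps $\mathfrak D_{p,m}$ to itself; let $\mathbf C_m=\mathbf C_m^{(T)}$ be the matrix of $\overline{\mathbf{FB}}\circ f_*\circ\overline{\mathbf{FB}}^{-1}$ on $\overline{\mathbf{FB}}(\mathfrak D_{p,m})$ in the basis $(u_{p,\alpha})_{|\alpha|\le m}$. Put $B_m=\sup_{t\in[0,1]}\|(\mathbf I+t(\mathbf C_m-\mathbf I))^{-1}\|_{\rm op}$. For points $z_0^1,\dots,z_0^N\in K_0$ put $z^k=p+z_0^k$, $Z_N=(z^1,\dots,z^N)$ and $\widehat\mu_N=N^{-1}\sum_k\delta_{z_0^k}$. For $m\le n$ let $\mathbf U$ be the matrix with rows $\mathbf u_{p,n}(z^k)$ and $\mathbf V$ the matrix with rows $\mathbf u_{f(p),m}(f(z^k))$, and let $\widehat{\mathbf C}=\widehat{\mathbf C}_{m,n,Z_N}$ consist of the columns with $|\alpha|\le m$ of $\mathbf V^*(\mathbf U^*)^\dagger$ (Moore–Penrose pseudo-inverse). If $\widehat{\mathbf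 C}$ has no eigenvalue in $(-\infty,0]$, put $\widehat{\mathbf A}=\frac1T\log\widehat{\mathbf C}$, where $\log\mathbf A=(\mathbf A-\mathbf I)\int_0^1(\mathbf I+t(\mathbf A-\mathbf I))^{-1}dt$, and let $\widehat V_{m,n,Z_N}=(\widehat V_1,\dots,\widehat V_d)$ with $$\widehat V_i(z)=\mathbf u_{p,m}(z)\,\widehat{\mathbf A}^*\,(\partial_{z_i}\mathbf u_{p,m}(0))^*.$$ For a finite Borel measure $\mu$ on $K_0$ let $\mathbf D_n(\mu)=\big(\int\overline{x^\alpha}x^\beta\,d\mu(x)\big)_{|\alpha|,|\beta|\le n}$ (for $\mu$ carried by $\mathbb R^d$ this is the Hankel matrix $\int x^{\alpha+\beta}d\mu$), let $\Lambda_n(\mu)$ be its smallest eigenvalue, and $R_S=\sup_{x\in S}|x|_{K_0}$ for $S\subset K_0$, $R_\mu=R_{\operatorname{supp}\mu}$. Read $(-1)!$ as $1$. **(a)** Let $\mu$ be a finite Borel measure with $\operatorname{supp}\mu\subset\operatorname{int}K_0$ and let $K_1\subset\operatorname{int}K_0$ be compact. There is a constant $C'>0$, depending only on $V$, $T$, $p$,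 $K_0$, $K_1$, $\mu$, such that for all $m\le n$, all $N\ge1$, all $z_0^1,\dots,z_0^N\in\operatorname{supp}\mu$ and all $\gamma_1,\gamma_2\in(0,1)$: if $\mathbf D_n(\mu)$ is invertible, $$\big\|\mathbf I-\mathbf D_n(\mu)^{-1/2}\mathbf D_n(\widehat\mu_N)\mathbf D_n(\mu)^{-1/2}\big\|_{\rm op}\le1-\gamma_1\quad\text{and}\quad\big\|\mathbf C_m-\widehat{\mathbf C}_{m,n,Z_N}\big\|_{\rm op}<(1-\gamma_2)B_m^{-1},$$ then $\widehat{\mathbf C}_{m,n,Z_N}$ has no eigenvalue in $(-\infty,0]$ and $$\sup_{z\in p+K_1}\|\widehat V_{m,n,Z_N}(z)-V(z)\|\le C'\left(\frac{\|p\|^m}{\sqrt{(m-1)!}}+\frac{B_m^2}{\gamma_2}\sqrt{\frac{m!}{\gamma_1}}\,\frac{R_\mu^n}{\Lambda_n(\mu)^{1/2}}+R_{K_1}^m\right).$$ **(b)** Let $\mu$ be a Borel probability measure on $K_0\cap\mathbb R^d$, absolutely continuous with respect to Lebesgue measure on $\mathbb R^d$. There is a sequence $(C_m)_{m\ge0}$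 of positive numbers such that for every compact $K_1\subset\operatorname{int}K_0$ there is $C'>0$, both depending only on $V$, $T$, $p$, $K_0$, $\mu$ (and $C'$ on $K_1$), with the following property. Let $\rho\in(0,1)$ satisfy $R_\mu<\rho\,\liminf_n\Lambda_n(\mu)^{1/(2n)}$, and let $(z_0^k)_{k\ge1}\subset K_0$ be such that $N^{-1}\sum_{k\le N}\delta_{z_0^k}$ converges weakly to $\mu$. Then for every $m$ and all sufficiently large $n$, $\widehat{\mathbf C}_{m,n,Z_N}$ has no eigenvalue in $(-\infty,0]$ for all large $N$, and $$\limsup_{N\to\infty}\sup_{z\in p+K_1}\|\widehat V_{m,n,Z_N}(z)-V(z)\|\le C'\left(\frac{\|p\|^m}{\sqrt{(m-1)!}}+C_m\rho^n+\frac{R_{K_1}^m}{1-R_{K_1}}\right).$$ -/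

import Mathlib

open MeasureTheory Filter Topology Matrix
open scoped ComplexConjugate BoundedContinuousFunction

namespace FockPushforward

/-- The Hermitian space `ℂ^d`.  With Mathlib's convention `inner ℂ p z = ∑ i, conj (p i) * z i`,
i.e. `inner ℂ p z` is `p^* z`. -/
abbrev CSpace (d : ℕ) := EuclideanSpace ℂ (Fin d)

/-! ### Multi-indices and the functions `u_{p,α}` -/

/-- Multi-indices of length at most `n`.  They index the rows and columns of all matrices below
(this is the set `{α^{(1)}, …, α^{(r_n)}}` for any numbering of the multi-indices by
non-decreasing length). -/
abbrev MultiIdx (d n : ℕ) := {α : Fin d → ℕ // ∑ i, α i ≤ n}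

noncomputable instance instFintypeMultiIdx (d n : ℕ) : Fintype (MultiIdx d n) :=
  Fintype.ofInjective
    (fun α : MultiIdx d n => fun i : Fin d =>
      (⟨α.1 i, Nat.lt_succ_of_le
        ((Finset.single_le_sum (fun j _ => Nat.zero_le (α.1 j)) (Finset.mem_univ i)).trans
          α.2)⟩ : Fin (n + 1)))
    (fun α β h => by
      apply Subtype.ext
      funext i
      exact congrArg (fun g : Fin d → Fin (n + 1) => (g i : ℕ)) h)

/-- The inclusion of multi-indices of length `≤ m` into those of length `≤ n`. -/
def MultiIdx.incl {d m n : ℕ} (hmn : m ≤ n) (α : MultiIdx d m) : MultiIdx d n :=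
  ⟨α.1, α.2.trans hmn⟩

/-- `z^α = ∏ z_i^{α_i}`. -/
noncomputable def mono {d : ℕ} (z : CSpace d) (α : Fin d → ℕ) : ℂ := ∏ i, z i ^ α i

/-- `α! = ∏ α_i!`. -/
def multiFactorial {d : ℕ} (α : Fin d → ℕ) : ℕ := ∏ i, (α i).factorial

/-- `u_{p,α}(z) = e^{-‖p‖²/2} / √(α!) * (z - p)^α * e^{p^* z}`. -/
noncomputable def u {d : ℕ} (p : CSpace d) (α : Fin d → ℕ) (z : CSpace d) : ℂ :=
  ((Real.exp (-‖p‖ ^ 2 / 2) / √(multiFactorial α : ℝ) : ℝ) : ℂ) * mono (z - p) α *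
    Complex.exp (inner ℂ p z)

/-! ### Analytic functionals supported at a point, Fourier–Borel transform, push-forward -/

/-- Functions on `ℂ^d` which are holomorphic in a neighbourhood of `S`. -/
def Hol {d : ℕ} (S : Set (CSpace d)) : Submodule ℂ (CSpace d → ℂ) where
  carrier := {h | AnalyticOnNhd ℂ h S}
  add_mem' hg hh := hg.add hh
  zero_mem' := fun _ _ => analyticAt_const
  smul_mem' _ _ hh := fun z hz => analyticAt_const.smul (hh z hz)

/-- The exponential `𝐞_ζ(z) = e^{ζ^* z}`. -/
noncomputable def expFun {d : ℕ} (ζ : CSpace d) (z : CSpace d) : ℂ := Complex.exp (inner ℂ ζ z)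

theorem analyticAt_expFun {d : ℕ} (ζ z : CSpace d) : AnalyticAt ℂ (expFun ζ) z :=
  ((innerSL ℂ ζ).analyticAt z).cexp

/-- `𝐞_ζ` as an element of the space of functions holomorphic near `S`. -/
noncomputable def expHol {d : ℕ} (S : Set (CSpace d)) (ζ : CSpace d) : Hol S :=
  ⟨expFun ζ, fun z _ => analyticAt_expFun ζ z⟩

/-- The partial derivative `∂_{z_i}`. -/
noncomputable def pderiv {d : ℕ} (i : Fin d) (h : CSpace d → ℂ) : CSpace d → ℂ :=
  fun z => fderiv ℂ h z (EuclideanSpace.single i 1)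

/-- `∂^α = ∂_{z_1}^{α_1} ⋯ ∂_{z_d}^{α_d}`. -/
noncomputable def multiDeriv {d : ℕ} (α : Fin d → ℕ) (h : CSpace d → ℂ) : CSpace d → ℂ :=
  (List.finRange d).foldr (fun i g => (pderiv i)^[α i] g) h

theorem analyticAt_pderiv {d : ℕ} (i : Fin d) {h : CSpace d → ℂ} {z : CSpace d}
    (hh : AnalyticAt ℂ h z) : AnalyticAt ℂ (pderiv i h) z :=
  ((ContinuousLinearMap.apply ℂ ℂ (EuclideanSpace.single i (1 : ℂ))).analyticAt _).comp hh.fderiv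

/-- An operator on functions that acts linearly on germs at `p` of holomorphic functions. -/
structure GermLinear {d : ℕ} (p : CSpace d) (D : (CSpace d → ℂ) → (CSpace d → ℂ)) : Prop where
  an : ∀ g, AnalyticAt ℂ g p → AnalyticAt ℂ (D g) p
  add : ∀ g h, AnalyticAt ℂ g p → AnalyticAt ℂ h p → D (g + h) =ᶠ[𝓝 p] D g + D h
  smul : ∀ (c : ℂ) g, AnalyticAt ℂ g p → D (c • g) =ᶠ[𝓝 p] c • D g
  congr : ∀ g h, g =ᶠ[𝓝 p] h → D g =ᶠ[𝓝 p] D h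

theorem germLinear_pderiv {d : ℕ} (p : CSpace d) (i : Fin d) : GermLinear p (pderiv i) where
  an _ hg := analyticAt_pderiv i hg
  add g h hg hh := by
    filter_upwards [hg.eventually_analyticAt, hh.eventually_analyticAt] with z h1 h2
    simp [pderiv, fderiv_add h1.differentiableAt h2.differentiableAt]
  smul c g hg := by
    filter_upwards [hg.eventually_analyticAt] with z h1
    simp [pderiv, fderiv_const_smul h1.differentiableAt]
  congr g h hgh := by
    filter_upwards [hgh.fderiv (𝕜 := ℂ)] with z hz
    simp [pderiv, hz]

theorem GermLinear.comp {d : ℕ} {p : CSpace d} {D D' : (CSpace d → ℂ) → (CSpace d → ℂ)}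
    (hD : GermLinear p D) (hD' : GermLinear p D') : GermLinear p (fun g => D (D' g)) where
  an g hg := hD.an _ (hD'.an g hg)
  add g h hg hh := (hD.congr _ _ (hD'.add g h hg hh)).trans (hD.add _ _ (hD'.an g hg) (hD'.an h hh))
  smul c g hg := (hD.congr _ _ (hD'.smul c g hg)).trans (hD.smul c _ (hD'.an g hg))
  congr g h hgh := hD.congr _ _ (hD'.congr g h hgh)

theorem germLinear_id {d : ℕ} (p : CSpace d) : GermLinear p (fun g => g) where
  an _ hg := hg
  add _ _ _ _ := EventuallyEq.rfl
  smul _ _ _ := EventuallyEq.rfl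
  congr _ _ h := h

theorem germLinear_iterate {d : ℕ} (p : CSpace d) (i : Fin d) (k : ℕ) :
    GermLinear p ((pderiv i)^[k]) := by
  induction k with
  | zero => exact germLinear_id p
  | succ k ih =>
    have := (germLinear_pderiv p i).comp ih
    simpa only [Function.iterate_succ', Function.comp_def] using this

theorem germLinear_multiDeriv {d : ℕ} (p : CSpace d) (α : Fin d → ℕ) :
    GermLinear p (multiDeriv α) := by
  have hl : ∀ l : List (Fin d),
      GermLinear p (fun h => l.foldr (fun i g => (pderiv i)^[α i] g) h) := by
    intro l
    induction l with
    | nil => exact germLinear_id p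
    | cons i l ih => exact (germLinear_iterate p i (α i)).comp ih
  exact hl _

/-- The functional `δ_p^α(h) = (∂^α h)(p)` on functions holomorphic near `p`. -/
noncomputable def delta {d : ℕ} (p : CSpace d) (α : Fin d → ℕ) : Module.Dual ℂ (Hol {p}) where
  toFun h := multiDeriv α h.1 p
  map_add' g h := by
    simpa using ((germLinear_multiDeriv p α).add g.1 h.1 (g.2 p rfl) (h.2 p rfl)).eq_of_nhds
  map_smul' c g := by
    simpa using ((germLinear_multiDeriv p α).smul c g.1 (g.2 p rfl)).eq_of_nhds

/-- `𝔇_{p,n}`, the span of the functionals `δ_p^α`, `|α| ≤ n`. -/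
noncomputable def jetFunctionals {d : ℕ} (p : CSpace d) (n : ℕ) :
    Submodule ℂ (Module.Dual ℂ (Hol {p})) :=
  Submodule.span ℂ (Set.range fun α : MultiIdx d n => delta p α.1)

/-- The (conjugated) Fourier–Borel transform `ℓ ↦ (ζ ↦ conj (ℓ(𝐞_ζ)))`. -/
noncomputable def fourierBorel {d : ℕ} {S : Set (CSpace d)} (ℓ : Module.Dual ℂ (Hol S)) :
    CSpace d → ℂ :=
  fun ζ => conj (ℓ (expHol S ζ))

/-- The pull-back `f^* h = h ∘ f`, from functions holomorphic near `f(p)` to functions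
holomorphic near `p`. -/
noncomputable def pullback {d r : ℕ} {p : CSpace d} {f : CSpace d → CSpace r}
    (hf : AnalyticAt ℂ f p) : Hol {f p} →ₗ[ℂ] Hol {p} where
  toFun h := ⟨h.1 ∘ f, by
    intro z hz
    obtain rfl : z = p := hz
    exact (h.2 (f z) rfl).comp hf⟩
  map_add' _ _ := rfl
  map_smul' _ _ := rfl

/-- The push-forward `f_*`, the transpose of the pull-back, on functionals supported at `p`. -/
noncomputable def pushforward {d r : ℕ} {p : CSpace d} {f : CSpace d → CSpace r}
    (hf : AnalyticAt ℂ f p) : Module.Dual ℂ (Hol {p}) →ₗ[ℂ] Module.Dual ℂ (Hol {f p}) :=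
  (pullback hf).dualMap

/-- `C` is the representation matrix of `f_* : 𝔇_{p,n} → 𝔇_{f(p),n}`, read through the
Fourier–Borel transform, with respect to the bases `(u_{p,α})` and `(u_{f(p),β})`: column `α`
of `C` holds the coordinates of the image of `u_{p,α}`. -/
def IsPushforwardMatrix {d r : ℕ} (p : CSpace d) (f : CSpace d → CSpace r) (n : ℕ)
    (C : Matrix (MultiIdx r n) (MultiIdx d n) ℂ) : Prop :=
  ∃ hf : AnalyticAt ℂ f p, ∀ α : MultiIdx d n, ∀ ℓ ∈ jetFunctionals p n,
    fourierBorel ℓ = u p α.1 →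
      fourierBorel (pushforward hf ℓ) = ∑ β, C β α • u (f p) β.1

/-! ### Existence and uniqueness of the push-forward matrix -/

/-- Span of shifted monomials. -/
noncomputable def polySpan {r : ℕ} (q : CSpace r) (k : ℕ) : Submodule ℂ (CSpace r → ℂ) :=
  Submodule.span ℂ (Set.range fun β : MultiIdx r k => fun ζ => mono (ζ - q) β.1)

theorem polySpan_mono {r : ℕ} (q : CSpace r) {k k' : ℕ} (h : k ≤ k') :
    polySpan q k ≤ polySpan q k' := by
  refine Submodule.span_mono ?_
  rintro _ ⟨β, rfl⟩
  exact ⟨β.incl h, rfl⟩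

theorem mono_add_single {r : ℕ} (z : CSpace r) (β : Fin r → ℕ) (j : Fin r) :
    mono z (β + Pi.single j 1) = z j * mono z β := by
  simp only [mono, Pi.add_apply, pow_add, Finset.prod_mul_distrib, mul_comm (z j)]
  congr 1
  rw [Finset.prod_eq_single j] <;> simp +contextual

theorem sum_add_single {r : ℕ} (β : Fin r → ℕ) (j : Fin r) :
    ∑ i, (β + Pi.single j 1 : Fin r → ℕ) i = ∑ i, β i + 1 := by
  simp [Finset.sum_add_distrib]

theorem coord_mul_mem {r : ℕ} {q : CSpace r} {k : ℕ} (j : Fin r) {g : CSpace r → ℂ}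
    (hg : g ∈ polySpan q k) : (fun ζ => ζ j * g ζ) ∈ polySpan q (k + 1) := by
  induction hg using Submodule.span_induction with
  | mem x hx =>
    obtain ⟨β, rfl⟩ := hx
    have h1 : (fun ζ => mono (ζ - q) (β.1 + Pi.single j 1)) ∈ polySpan q (k + 1) :=
      Submodule.subset_span ⟨⟨β.1 + Pi.single j 1, by
        rw [sum_add_single]; exact Nat.succ_le_succ β.2⟩, rfl⟩
    have h2 : (fun ζ => mono (ζ - q) β.1) ∈ polySpan q (k + 1) :=
      polySpan_mono q (Nat.le_succ k) (Submodule.subset_span ⟨β, rfl⟩)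
    convert Submodule.add_mem _ h1 (Submodule.smul_mem _ (q j) h2) using 1
    funext ζ
    simp only [mono_add_single, Pi.add_apply, Pi.smul_apply, smul_eq_mul, PiLp.sub_apply]
    ring
  | zero => simp only [Pi.zero_apply, mul_zero]; exact Submodule.zero_mem _
  | add x y _ _ hx hy =>
    convert Submodule.add_mem _ hx hy using 1
    funext ζ; simp [mul_add]
  | smul c x _ hx =>
    convert Submodule.smul_mem _ c hx using 1
    funext ζ; simp [mul_left_comm]

theorem const_mem {r : ℕ} (q : CSpace r) (k : ℕ) (c : ℂ) : (fun _ => c) ∈ polySpan q k := by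
  have : (fun ζ => mono (ζ - q) (0 : Fin r → ℕ)) ∈ polySpan q k :=
    Submodule.subset_span ⟨⟨0, by simp⟩, rfl⟩
  convert Submodule.smul_mem _ c this using 1
  funext ζ; simp [mono]

theorem exists_add_single {r : ℕ} {k : ℕ} (β : Fin r → ℕ) (hβ : ∑ i, β i = k + 1) :
    ∃ (γ : Fin r → ℕ) (j : Fin r), β = γ + Pi.single j 1 ∧ ∑ i, γ i = k := by
  obtain ⟨j, -, hj⟩ : ∃ j ∈ Finset.univ, β j ≠ 0 := by
    by_contra! h
    rw [Finset.sum_eq_zero h] at hβ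
    omega
  have : β = (β - Pi.single j 1) + Pi.single j 1 := by
    funext i
    by_cases h : i = j
    · subst h; simp; omega
    · simp [h]
  refine ⟨β - Pi.single j 1, j, this, ?_⟩
  have h2 := sum_add_single (β - Pi.single j 1) j
  rw [← this] at h2
  omega

theorem mono_shift_mem {r : ℕ} (q p : CSpace r) (k : ℕ) : ∀ β : Fin r → ℕ, ∑ i, β i ≤ k →
    (fun ζ => mono (ζ - p) β) ∈ polySpan q k := by
  induction k with
  | zero =>
    intro β hβ
    have : β = 0 := by
      funext i
      have := Finset.single_le_sum (fun j _ => Nat.zero_le (β j)) (Finset.mem_univ i)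
      simp; omega
    subst this
    simpa [mono] using const_mem q 0 1
  | succ k ih =>
    intro β hβ
    rcases Nat.lt_or_ge (∑ i, β i) (k + 1) with h | h
    · exact polySpan_mono q (Nat.le_succ k) (ih β (Nat.lt_succ_iff.mp h))
    · obtain ⟨γ, j, rfl, hγ⟩ := exists_add_single β (le_antisymm hβ h)
      have h1 := ih γ hγ.le
      convert Submodule.add_mem _ (coord_mul_mem j h1) (Submodule.smul_mem _ (-p j)
        (polySpan_mono q (Nat.le_succ k) h1)) using 1
      funext ζ
      simp only [mono_add_single, Pi.add_apply, Pi.smul_apply, smul_eq_mul, PiLp.sub_apply]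
      ring

/-- Families `A ζ z`, polynomial of degree `≤ k` in `conj ζ` with coefficients holomorphic at `p`. -/
inductive PolyFam {d r : ℕ} (p : CSpace d) : ℕ → (CSpace r → CSpace d → ℂ) → Prop
  | coef (c : CSpace d → ℂ) (hc : AnalyticAt ℂ c p) : PolyFam p 0 (fun _ z => c z)
  | mulConj (k : ℕ) (A : CSpace r → CSpace d → ℂ) (j : Fin r) (hA : PolyFam p k A) :
      PolyFam p (k + 1) (fun ζ z => conj (ζ j) * A ζ z)
  | add (k : ℕ) (A B : CSpace r → CSpace d → ℂ) (hA : PolyFam p k A) (hB : PolyFam p k B) :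
      PolyFam p k (fun ζ z => A ζ z + B ζ z)
  | mono (k : ℕ) (A : CSpace r → CSpace d → ℂ) (hA : PolyFam p k A) : PolyFam p (k + 1) A

theorem PolyFam.le {d r : ℕ} {p : CSpace d} {k k' : ℕ} {A : CSpace r → CSpace d → ℂ}
    (hA : PolyFam p k A) (h : k ≤ k') : PolyFam p k' A := by
  induction h with
  | refl => exact hA
  | step _ ih => exact .mono _ _ ih

theorem PolyFam.an {d r : ℕ} {p : CSpace d} {k : ℕ} {A : CSpace r → CSpace d → ℂ}
    (hA : PolyFam p k A) (ζ : CSpace r) : AnalyticAt ℂ (A ζ) p := by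
  induction hA with
  | coef c hc => exact hc
  | mulConj k A j hA ih => exact analyticAt_const.mul ih
  | add k A B _ _ ih1 ih2 => exact ih1.add ih2
  | mono k A _ ih => exact ih

theorem PolyFam.coefMul {d r : ℕ} {p : CSpace d} {k : ℕ} {A : CSpace r → CSpace d → ℂ}
    (hA : PolyFam p k A) {c : CSpace d → ℂ} (hc : AnalyticAt ℂ c p) :
    PolyFam p k (fun ζ z => A ζ z * c z) := by
  induction hA with
  | coef c' hc' => exact .coef _ (hc'.mul hc)
  | mulConj k A j hA ih => simpa only [mul_assoc] using PolyFam.mulConj _ _ j ih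
  | add k A B _ _ ih1 ih2 => simpa only [add_mul] using PolyFam.add _ _ _ ih1 ih2
  | mono k A _ ih => exact .mono _ _ ih

theorem PolyFam.deriv {d r : ℕ} {p : CSpace d} {k : ℕ} {A : CSpace r → CSpace d → ℂ}
    (hA : PolyFam p k A) (i : Fin d) :
    ∃ A' : CSpace r → CSpace d → ℂ, PolyFam p k A' ∧ ∀ ζ, pderiv i (A ζ) =ᶠ[𝓝 p] A' ζ := by
  induction hA with
  | coef c hc => exact ⟨fun _ z => pderiv i c z, .coef _ (analyticAt_pderiv i hc), fun _ => .rfl⟩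
  | mulConj k A j hA ih =>
    obtain ⟨A', h1, h2⟩ := ih
    refine ⟨_, .mulConj _ _ j h1, fun ζ => ?_⟩
    refine ((germLinear_pderiv p i).smul (conj (ζ j)) (A ζ) (hA.an ζ)).trans ?_
    filter_upwards [h2 ζ] with z hz
    simp [hz]
  | add k A B hA hB ih1 ih2 =>
    obtain ⟨A', h1, h2⟩ := ih1
    obtain ⟨B', h3, h4⟩ := ih2
    refine ⟨_, .add _ _ _ h1 h3, fun ζ => ?_⟩
    refine ((germLinear_pderiv p i).add (A ζ) (B ζ) (hA.an ζ) (hB.an ζ)).trans ?_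
    filter_upwards [h2 ζ, h4 ζ] with z hz hz'
    simp [hz, hz']
  | mono k A _ ih =>
    obtain ⟨A', h1, h2⟩ := ih
    exact ⟨A', .mono _ _ h1, h2⟩

theorem PolyFam.eval_mem {d r : ℕ} {p : CSpace d} {k : ℕ} {A : CSpace r → CSpace d → ℂ}
    (hA : PolyFam p k A) (q : CSpace r) : (fun ζ => conj (A ζ p)) ∈ polySpan q k := by
  induction hA with
  | coef c hc => exact const_mem _ _ _
  | mulConj k A j hA ih => simpa using coord_mul_mem j ih
  | add k A B _ _ ih1 ih2 =>
    simp only [map_add]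
    exact Submodule.add_mem _ ih1 ih2
  | mono k A _ ih => exact polySpan_mono q (Nat.le_succ k) ih

theorem polyFam_sum {d r : ℕ} {p : CSpace d} {k : ℕ} (s : Finset (Fin r))
    {A : Fin r → CSpace r → CSpace d → ℂ} (hA : ∀ j, PolyFam p k (A j)) :
    PolyFam p k (fun ζ z => ∑ j ∈ s, A j ζ z) := by
  induction s using Finset.induction_on with
  | empty => simpa using (PolyFam.coef (p := p) (r := r) (fun _ => 0) analyticAt_const).le k.zero_le
  | insert j s hj ih => simpa only [Finset.sum_insert hj] using PolyFam.add _ _ _ (hA j) ih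

theorem pderiv_exp_comp {d r : ℕ} {p : CSpace d} {f : CSpace d → CSpace r}
    (hf : AnalyticAt ℂ f p) {k : ℕ} {A : CSpace r → CSpace d → ℂ} (hA : PolyFam p k A)
    (i : Fin d) :
    ∃ A' : CSpace r → CSpace d → ℂ, PolyFam p (k + 1) A' ∧
      ∀ ζ, pderiv i (fun z => A ζ z * expFun ζ (f z)) =ᶠ[𝓝 p]
        fun z => A' ζ z * expFun ζ (f z) := by
  obtain ⟨A₁, h1, h2⟩ := hA.deriv i
  have hfj : ∀ j, AnalyticAt ℂ (fun z => fderiv ℂ f z (EuclideanSpace.single i 1) j) p := fun j =>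
    ((EuclideanSpace.proj (𝕜 := ℂ) j).analyticAt _).comp
      (((ContinuousLinearMap.apply ℂ (CSpace r) (EuclideanSpace.single i (1 : ℂ))).analyticAt
        _).comp hf.fderiv)
  refine ⟨_, .add _ _ _ (.mono _ _ h1)
    (polyFam_sum Finset.univ fun j => (PolyFam.mulConj _ _ j (hA.coefMul (hfj j)))), fun ζ => ?_⟩
  filter_upwards [h2 ζ, hf.eventually_analyticAt, (hA.an ζ).eventually_analyticAt] with z hz hfz hAz
  have e1 : HasFDerivAt (fun z => expFun ζ (f z))
      (expFun ζ (f z) • (innerSL ℂ ζ).comp (fderiv ℂ f z)) z :=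
    (((innerSL ℂ ζ).hasFDerivAt).comp z hfz.differentiableAt.hasFDerivAt).cexp
  have e2 := hAz.differentiableAt.hasFDerivAt.mul e1
  have e3 : fderiv ℂ (fun z => A ζ z * expFun ζ (f z)) z = _ := e2.fderiv
  rw [← hz]
  simp only [pderiv, e3]
  simp only [_root_.add_apply, _root_.smul_apply, smul_eq_mul,
    ContinuousLinearMap.comp_apply, innerSL_apply_apply]
  rw [PiLp.inner_apply]
  simp only [RCLike.inner_apply, add_mul, Finset.mul_sum, Finset.sum_mul]
  rw [add_comm]
  congr 1
  · ring
  · refine Finset.sum_congr rfl fun j _ => ?_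
    ring

theorem multiDeriv_exp_comp {d r : ℕ} {p : CSpace d} {f : CSpace d → CSpace r}
    (hf : AnalyticAt ℂ f p) (α : Fin d → ℕ) :
    ∃ A : CSpace r → CSpace d → ℂ, PolyFam p (∑ i, α i) A ∧
      ∀ ζ, multiDeriv α (expFun ζ ∘ f) =ᶠ[𝓝 p] fun z => A ζ z * expFun ζ (f z) := by
  have hit : ∀ (i : Fin d) (n k : ℕ) (A : CSpace r → CSpace d → ℂ), PolyFam p k A →
      ∃ A' : CSpace r → CSpace d → ℂ, PolyFam p (n + k) A' ∧
        ∀ ζ, (pderiv i)^[n] (fun z => A ζ z * expFun ζ (f z)) =ᶠ[𝓝 p]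
          fun z => A' ζ z * expFun ζ (f z) := by
    intro i n k A hA
    induction n with
    | zero => exact ⟨A, by simpa using hA, fun _ => .rfl⟩
    | succ n ih =>
      obtain ⟨A', h1, h2⟩ := ih
      obtain ⟨A'', h3, h4⟩ := pderiv_exp_comp hf h1 i
      refine ⟨A'', h3.le (by omega), fun ζ => ?_⟩
      rw [Function.iterate_succ', Function.comp_apply]
      exact ((germLinear_pderiv p i).congr _ _ (h2 ζ)).trans (h4 ζ)
  have hl : ∀ l : List (Fin d), ∃ A : CSpace r → CSpace d → ℂ,
      PolyFam p (l.map α).sum A ∧ ∀ ζ,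
        l.foldr (fun i g => (pderiv i)^[α i] g) (expFun ζ ∘ f) =ᶠ[𝓝 p]
          fun z => A ζ z * expFun ζ (f z) := by
    intro l
    induction l with
    | nil =>
      exact ⟨fun _ _ => 1, .coef _ analyticAt_const, fun ζ => by
        simp only [List.foldr_nil, one_mul]; exact .rfl⟩
    | cons i l ih =>
      obtain ⟨A, h1, h2⟩ := ih
      obtain ⟨A', h3, h4⟩ := hit i (α i) _ A h1
      refine ⟨A', by simpa using h3, fun ζ => ?_⟩
      exact ((germLinear_iterate p i (α i)).congr _ _ (h2 ζ)).trans (h4 ζ)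
  obtain ⟨A, h1, h2⟩ := hl (List.finRange d)
  refine ⟨A, ?_, h2⟩
  have : ((List.finRange d).map α).sum = ∑ i, α i := by
    rw [← List.ofFn_eq_map, List.sum_ofFn]
  rwa [this] at h1

theorem multiDeriv_expFun {d : ℕ} (ζ : CSpace d) (α : Fin d → ℕ) :
    multiDeriv α (expFun ζ) = conj (mono ζ α) • expFun ζ := by
  have h0 : ∀ (i : Fin d) (c : ℂ), pderiv i (c • expFun ζ) = (conj (ζ i) * c) • expFun ζ := by
    intro i c
    funext z
    have e1 : HasFDerivAt (expFun ζ) (expFun ζ z • innerSL ℂ ζ) z :=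
      ((innerSL ℂ ζ).hasFDerivAt).cexp
    have e2 : fderiv ℂ (c • expFun ζ) z = _ := (e1.const_smul c).fderiv
    simp only [pderiv, e2]
    simp [EuclideanSpace.inner_single_right]
    ring
  have h1 : ∀ (i : Fin d) (n : ℕ) (c : ℂ),
      (pderiv i)^[n] (c • expFun ζ) = (conj (ζ i) ^ n * c) • expFun ζ := by
    intro i n c
    induction n with
    | zero => simp
    | succ n ih => rw [Function.iterate_succ', Function.comp_apply, ih, h0]; ring_nf
  have hl : ∀ l : List (Fin d), l.foldr (fun i g => (pderiv i)^[α i] g) (expFun ζ)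
      = (l.map fun i => conj (ζ i) ^ α i).prod • expFun ζ := by
    intro l
    induction l with
    | nil => simp
    | cons i l ih => rw [List.foldr_cons, ih, h1]; simp
  rw [multiDeriv, hl, ← List.ofFn_eq_map, List.prod_ofFn]
  simp [mono]

theorem conj_expFun {d : ℕ} (ζ z : CSpace d) : conj (expFun ζ z) = expFun z ζ := by
  rw [expFun, expFun, ← Complex.exp_conj, inner_conj_symm]

theorem expFun_ne_zero {d : ℕ} (ζ z : CSpace d) : expFun ζ z ≠ 0 := Complex.exp_ne_zero _

theorem fourierBorel_delta {d : ℕ} (p : CSpace d) (α : Fin d → ℕ) :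
    fourierBorel (delta p α) = fun ζ => mono ζ α * expFun p ζ := by
  funext ζ
  have : delta p α (expHol {p} ζ) = multiDeriv α (expFun ζ) p := rfl
  rw [fourierBorel, this, multiDeriv_expFun]
  simp [conj_expFun]

theorem fourierBorel_add {d : ℕ} {S : Set (CSpace d)} (ℓ ℓ' : Module.Dual ℂ (Hol S)) :
    fourierBorel (ℓ + ℓ') = fourierBorel ℓ + fourierBorel ℓ' := by
  funext ζ; simp [fourierBorel]

theorem fourierBorel_smul {d : ℕ} {S : Set (CSpace d)} (c : ℂ) (ℓ : Module.Dual ℂ (Hol S)) :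
    fourierBorel (c • ℓ) = conj c • fourierBorel ℓ := by
  funext ζ; simp [fourierBorel]

theorem fourierBorel_zero {d : ℕ} {S : Set (CSpace d)} :
    fourierBorel (0 : Module.Dual ℂ (Hol S)) = 0 := by
  funext ζ; simp [fourierBorel]

theorem fourierBorel_sum {d : ℕ} {S : Set (CSpace d)} {ι : Type*} (s : Finset ι)
    (ℓ : ι → Module.Dual ℂ (Hol S)) :
    fourierBorel (∑ i ∈ s, ℓ i) = ∑ i ∈ s, fourierBorel (ℓ i) := by
  classical
  induction s using Finset.induction_on with
  | empty => simp [fourierBorel_zero]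
  | insert i s hi ih => rw [Finset.sum_insert hi, Finset.sum_insert hi, fourierBorel_add, ih]

theorem mono_independent {d n : ℕ} (q : CSpace d) (c : MultiIdx d n → ℂ)
    (h : ∀ ζ, ∑ β, c β * mono (ζ - q) β.1 = 0) : c = 0 := by
  let P : MvPolynomial (Fin d) ℂ :=
    ∑ β : MultiIdx d n, MvPolynomial.monomial (Finsupp.equivFunOnFinite.symm β.1) (c β)
  have hP : P = 0 := by
    apply MvPolynomial.funext
    intro x
    have := h (q + WithLp.toLp 2 x)
    simp only [add_sub_cancel_left, mono] at this
    simp only [P, map_sum, MvPolynomial.eval_monomial, map_zero]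
    rw [← this]
    refine Finset.sum_congr rfl fun β _ => ?_
    rw [Finsupp.prod_fintype _ _ (by simp)]
    simp
  funext α
  have h2 := congrArg (MvPolynomial.coeff (Finsupp.equivFunOnFinite.symm α.1)) hP
  simp only [P, MvPolynomial.coeff_sum, MvPolynomial.coeff_monomial, MvPolynomial.coeff_zero] at h2
  rw [Finset.sum_eq_single α] at h2
  · simpa using h2
  · intro β _ hβ
    rw [if_neg]
    intro he
    exact hβ (Subtype.ext (Finsupp.equivFunOnFinite.symm.injective he))
  · simp

theorem exists_u_coords {d n : ℕ} (p : CSpace d) {g : CSpace d → ℂ} (hg : g ∈ polySpan p n) :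
    ∃ c : MultiIdx d n → ℂ, (fun ζ => g ζ * expFun p ζ) = ∑ β, c β • u p β.1 := by
  obtain ⟨c, rfl⟩ := (Submodule.mem_span_range_iff_exists_fun ℂ).1 hg
  refine ⟨fun β => c β * (((Real.exp (-‖p‖ ^ 2 / 2) / √(multiFactorial β.1 : ℝ) : ℝ) : ℂ))⁻¹, ?_⟩
  funext ζ
  simp only [Finset.sum_apply, Pi.smul_apply, smul_eq_mul, Finset.sum_mul, u, expFun]
  refine Finset.sum_congr rfl fun β _ => ?_
  have : ((Real.exp (-‖p‖ ^ 2 / 2) / √(multiFactorial β.1 : ℝ) : ℝ) : ℂ) ≠ 0 := by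
    have h1 : 0 < multiFactorial β.1 := Finset.prod_pos fun i _ => Nat.factorial_pos _
    have : 0 < Real.exp (-‖p‖ ^ 2 / 2) / √(multiFactorial β.1 : ℝ) := by positivity
    exact_mod_cast this.ne'
  generalize ((Real.exp (-‖p‖ ^ 2 / 2) / √(multiFactorial β.1 : ℝ) : ℝ) : ℂ) = a at this ⊢
  field_simp

theorem u_independent {d n : ℕ} (p : CSpace d) (c : MultiIdx d n → ℂ)
    (h : ∑ β, c β • u p β.1 = 0) : c = 0 := by
  have key := mono_independent p
    (fun β => c β * (((Real.exp (-‖p‖ ^ 2 / 2) / √(multiFactorial β.1 : ℝ) : ℝ) : ℂ))) (by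
      intro ζ
      have := congrFun h ζ
      simp only [Finset.sum_apply, Pi.smul_apply, smul_eq_mul, u, Pi.zero_apply] at this
      simp only [← mul_assoc, ← Finset.sum_mul] at this
      exact (mul_eq_zero.1 this).resolve_right (Complex.exp_ne_zero _))
  funext β
  have h1 : 0 < multiFactorial β.1 := Finset.prod_pos fun i _ => Nat.factorial_pos _
  have h2 : 0 < Real.exp (-‖p‖ ^ 2 / 2) / √(multiFactorial β.1 : ℝ) := by positivity
  exact (mul_eq_zero.1 (congrFun key β)).resolve_right (by exact_mod_cast h2.ne')

theorem fourierBorel_pushforward {d r : ℕ} {p : CSpace d} {f : CSpace d → CSpace r}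
    (hf : AnalyticAt ℂ f p) {n : ℕ} {ℓ : Module.Dual ℂ (Hol {p})} (hℓ : ℓ ∈ jetFunctionals p n) :
    ∃ c : MultiIdx r n → ℂ, fourierBorel (pushforward hf ℓ) = ∑ β, c β • u (f p) β.1 := by
  have : ∃ g ∈ polySpan (f p) n, fourierBorel (pushforward hf ℓ) =
      fun ζ => g ζ * expFun (f p) ζ := by
    induction hℓ using Submodule.span_induction with
    | mem x hx =>
      obtain ⟨α, rfl⟩ := hx
      obtain ⟨A, h1, h2⟩ := multiDeriv_exp_comp hf α.1
      refine ⟨_, polySpan_mono _ α.2 (h1.eval_mem (f p)), ?_⟩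
      funext ζ
      have e : pushforward hf (delta p α.1) (expHol {f p} ζ)
        = multiDeriv α.1 (expFun ζ ∘ f) p := rfl
      rw [fourierBorel, e, (h2 ζ).eq_of_nhds, map_mul, conj_expFun]
    | zero => exact ⟨0, Submodule.zero_mem _, by rw [map_zero, fourierBorel_zero]; ext; simp⟩
    | add x y _ _ hx hy =>
      obtain ⟨g, h1, h2⟩ := hx
      obtain ⟨g', h3, h4⟩ := hy
      refine ⟨g + g', Submodule.add_mem _ h1 h3, ?_⟩
      rw [map_add, fourierBorel_add, h2, h4]
      ext; simp [add_mul]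
    | smul c x _ hx =>
      obtain ⟨g, h1, h2⟩ := hx
      refine ⟨conj c • g, Submodule.smul_mem _ _ h1, ?_⟩
      rw [map_smul, fourierBorel_smul, h2]
      ext; simp [mul_assoc]
  obtain ⟨g, hg, h⟩ := this
  rw [h]
  exact exists_u_coords _ hg

theorem fourierBorel_injOn {d n : ℕ} {p : CSpace d} {ℓ ℓ' : Module.Dual ℂ (Hol {p})}
    (hℓ : ℓ ∈ jetFunctionals p n) (hℓ' : ℓ' ∈ jetFunctionals p n)
    (h : fourierBorel ℓ = fourierBorel ℓ') : ℓ = ℓ' := by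
  obtain ⟨c, rfl⟩ := (Submodule.mem_span_range_iff_exists_fun ℂ).1 hℓ
  obtain ⟨c', rfl⟩ := (Submodule.mem_span_range_iff_exists_fun ℂ).1 hℓ'
  have key := mono_independent (0 : CSpace d) (fun β : MultiIdx d n => conj (c β) - conj (c' β)) (by
    intro ζ
    have := congrFun h ζ
    simp only [fourierBorel_sum, fourierBorel_smul, fourierBorel_delta, Finset.sum_apply,
      Pi.smul_apply, smul_eq_mul] at this
    simp only [← mul_assoc, ← Finset.sum_mul] at this
    have := mul_right_cancel₀ (expFun_ne_zero p ζ) this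
    simp only [sub_zero, sub_mul, Finset.sum_sub_distrib, this, sub_self])
  refine Finset.sum_congr rfl fun β _ => ?_
  have := congrFun key β
  have h2 : conj (c β) = conj (c' β) := sub_eq_zero.1 this
  rw [(starRingEnd ℂ).injective h2]

theorem exists_functional {d n : ℕ} (p : CSpace d) (α : MultiIdx d n) :
    ∃ ℓ ∈ jetFunctionals p n, fourierBorel ℓ = u p α.1 := by
  obtain ⟨c, hc⟩ := (Submodule.mem_span_range_iff_exists_fun ℂ).1
    (mono_shift_mem (0 : CSpace d) p n α.1 α.2)
  let a : ℂ := ((Real.exp (-‖p‖ ^ 2 / 2) / √(multiFactorial α.1 : ℝ) : ℝ) : ℂ)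
  refine ⟨∑ β, conj (a * c β) • delta p β.1, Submodule.sum_mem _ fun β _ =>
    Submodule.smul_mem _ _ (Submodule.subset_span ⟨β, rfl⟩), ?_⟩
  funext ζ
  have h := congrFun hc ζ
  simp only [Finset.sum_apply, Pi.smul_apply, smul_eq_mul, sub_zero] at h
  simp only [fourierBorel_sum, fourierBorel_smul, fourierBorel_delta, Finset.sum_apply,
    Pi.smul_apply, smul_eq_mul, Complex.conj_conj, u, ← h, a, expFun]
  rw [Finset.mul_sum, Finset.sum_mul]
  refine Finset.sum_congr rfl fun β _ => ?_
  ring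

/-- Every map `f` holomorphic near `p` has exactly one push-forward matrix of order `n`. -/
theorem existsUnique_pushforwardMatrix {d r : ℕ} {p : CSpace d} {f : CSpace d → CSpace r}
    (hf : AnalyticAt ℂ f p) (n : ℕ) : ∃! C, IsPushforwardMatrix p f n C := by
  choose L hL hLu using fun α : MultiIdx d n => exists_functional p α
  choose c hc using fun α : MultiIdx d n => fourierBorel_pushforward hf (hL α)
  refine ⟨Matrix.of fun β α => c α β, ⟨hf, fun α ℓ hℓ h => ?_⟩, ?_⟩
  · obtain rfl : ℓ = L α := fourierBorel_injOn hℓ (hL α) (h.trans (hLu α).symm)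
    simpa using hc α
  · rintro C' ⟨_, hC'⟩
    ext β α
    have h1 := (hC' α (L α) (hL α) (hLu α)).symm.trans (hc α)
    have h2 := u_independent (f p) (fun β => C' β α - c α β) (by
      simp only [sub_smul, Finset.sum_sub_distrib, h1, sub_self])
    exact sub_eq_zero.1 (congrFun h2 β)

open Classical in
/-- The representation matrix `𝐂_n` of `f_* : 𝔇_{p,n} → 𝔇_{f(p),n}` (the unique matrix with
`IsPushforwardMatrix`, see `existsUnique_pushforwardMatrix`). -/
noncomputable def pushforwardMatrix {d r : ℕ} (p : CSpace d) (f : CSpace d → CSpace r) (n : ℕ) :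
    Matrix (MultiIdx r n) (MultiIdx d n) ℂ :=
  if h : ∃ C, IsPushforwardMatrix p f n C then h.choose else 0

theorem isPushforwardMatrix_pushforwardMatrix {d r : ℕ} {p : CSpace d}
    {f : CSpace d → CSpace r} (hf : AnalyticAt ℂ f p) (n : ℕ) :
    IsPushforwardMatrix p f n (pushforwardMatrix p f n) := by
  have h := (existsUnique_pushforwardMatrix hf n).exists
  rw [pushforwardMatrix, dif_pos h]
  exact h.choose_spec

/-! ### Matrix notions -/

/-- Operator norm of a square matrix for the Euclidean norms. -/
noncomputable def opNorm {ι : Type*} [Fintype ι] [DecidableEq ι] (A : Matrix ι ι ℂ) : ℝ :=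
  ‖Matrix.toEuclideanCLM (𝕜 := ℂ) A‖

/-- `A^{-1/2}` for a positive definite matrix `A`, by functional calculus. -/
noncomputable def invSqrt {ι : Type*} [Fintype ι] [DecidableEq ι] (A : Matrix ι ι ℂ) :
    Matrix ι ι ℂ :=
  cfc (fun x : ℝ => (√x)⁻¹) A

/-- The smallest eigenvalue of a Hermitian matrix. -/
noncomputable def minEigenvalue {ι : Type*} [Fintype ι] [DecidableEq ι] (A : Matrix ι ι ℂ) : ℝ :=
  sInf (spectrum ℝ A)

/-- The Moore–Penrose pseudo-inverse `A^† = (A^* A)^† A^*`, where `(A^* A)^†` inverts the non-zero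
eigenvalues of the Hermitian matrix `A^* A` (recall `0⁻¹ = 0`). -/
noncomputable def pinv {κ ι : Type*} [Fintype κ] [Fintype ι] [DecidableEq ι]
    (A : Matrix κ ι ℂ) : Matrix ι κ ℂ :=
  cfc (fun x : ℝ => x⁻¹) (Aᴴ * A) * Aᴴ

open scoped ComplexOrder in
/-- `pinv` satisfies the four Penrose equations, which characterise the pseudo-inverse. -/
theorem pinv_penrose {κ ι : Type*} [Fintype κ] [Fintype ι] [DecidableEq ι]
    (A : Matrix κ ι ℂ) :
    A * pinv A * A = A ∧ pinv A * A * pinv A = pinv A ∧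
      (A * pinv A).IsHermitian ∧ (pinv A * A).IsHermitian := by
  have hH : IsSelfAdjoint (Aᴴ * A) := Matrix.isHermitian_conjTranspose_mul_self A
  have hcont : ∀ g : ℝ → ℝ, ContinuousOn g (spectrum ℝ (Aᴴ * A)) := fun g =>
    (Matrix.finite_real_spectrum).continuousOn g
  set H := Aᴴ * A with hHdef
  set G := cfc (fun x : ℝ => x⁻¹) H with hG
  have hGs : Gᴴ = G := (cfc_predicate (fun x : ℝ => x⁻¹) H : IsSelfAdjoint G)
  have e1 : H * G = cfc (fun x : ℝ => x * x⁻¹) H := by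
    rw [cfc_mul _ _ H (hcont _) (hcont _), cfc_id' ℝ H]
  have e2 : G * H = cfc (fun x : ℝ => x * x⁻¹) H := by
    have : (fun x : ℝ => x * x⁻¹) = fun x => x⁻¹ * x := by funext x; ring
    rw [this, cfc_mul _ _ H (hcont _) (hcont _), cfc_id' ℝ H]
  have e3 : H * G * H = H := by
    have : H * G * H = cfc (fun x : ℝ => x * x⁻¹ * x) H := by
      rw [e1, cfc_mul (fun x : ℝ => x * x⁻¹) (fun x => x) H (hcont _) (hcont _), cfc_id' ℝ H]
    rw [this]
    simp only [mul_inv_mul_cancel]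
    exact cfc_id' ℝ H
  have e4 : G * H * G = G := by
    rw [e2, hG, ← cfc_mul (fun x : ℝ => x * x⁻¹) (fun x => x⁻¹) H (hcont _) (hcont _)]
    congr 1
    funext x
    by_cases hx : x = 0 <;> simp [hx]
  have hPs : (G * H)ᴴ = G * H := by
    rw [e2]
    exact (cfc_predicate (fun x : ℝ => x * x⁻¹) H : IsSelfAdjoint _)
  have hp : pinv A = G * Aᴴ := rfl
  have hpA : pinv A * A = G * H := by rw [hp, Matrix.mul_assoc]
  refine ⟨?_, ?_, ?_, ?_⟩
  · have h0 : A * (G * H - 1) = 0 := by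
      apply Matrix.conjTranspose_mul_self_eq_zero.1
      rw [Matrix.conjTranspose_mul, Matrix.mul_assoc, ← Matrix.mul_assoc Aᴴ, ← hHdef,
        Matrix.mul_sub, Matrix.mul_one, ← Matrix.mul_assoc H, e3, sub_self, Matrix.mul_zero]
    rw [Matrix.mul_assoc, hpA]
    rwa [Matrix.mul_sub, Matrix.mul_one, sub_eq_zero] at h0
  · rw [hpA, hp, ← Matrix.mul_assoc, e4]
  · rw [hp, Matrix.IsHermitian]
    simp only [Matrix.conjTranspose_mul, Matrix.conjTranspose_conjTranspose, hGs, Matrix.mul_assoc]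
  · rw [hpA]; exact hPs

/-- The matrix logarithm `log A = (A - I) ∫_0^1 (I + t (A - I))⁻¹ dt` (entrywise integral), for `A`
without non-positive real eigenvalues. -/
noncomputable def matLog {ι : Type*} [Fintype ι] [DecidableEq ι] (A : Matrix ι ι ℂ) :
    Matrix ι ι ℂ :=
  (A - 1) * Matrix.of fun i j => ∫ t in (0 : ℝ)..1, (1 + (t : ℂ) • (A - 1))⁻¹ i j

/-- `A` has no eigenvalue in `(-∞, 0]`. -/
def NoNonposEigenvalue {ι : Type*} [Fintype ι] [DecidableEq ι] (A : Matrix ι ι ℂ) : Prop :=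
  ∀ x : ℝ, x ≤ 0 → (x : ℂ) ∉ spectrum ℂ A

/-- `B(C) = sup_{t ∈ [0,1]} ‖(I + t (C - I))⁻¹‖_op`. -/
noncomputable def resolventBound {ι : Type*} [Fintype ι] [DecidableEq ι] (C : Matrix ι ι ℂ) : ℝ :=
  ⨆ t : Set.Icc (0 : ℝ) 1, opNorm ((1 + ((t : ℝ) : ℂ) • (C - 1))⁻¹)

/-! ### Sampling -/

/-- The moment matrix `𝐃_n(μ) = (∫ conj(x^α) x^β dμ(x))_{|α|,|β| ≤ n}`.  For a measure carried by
`ℝ^d` this is the Hankel matrix `(∫ x^{α+β} dμ(x))`, see `momentMatrix_eq_hankel`. -/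
noncomputable def momentMatrix {d : ℕ} (n : ℕ) (μ : Measure (CSpace d)) :
    Matrix (MultiIdx d n) (MultiIdx d n) ℂ :=
  Matrix.of fun α β => ∫ x, conj (mono x α.1) * mono x β.1 ∂μ

theorem momentMatrix_eq_hankel {d : ℕ} (n : ℕ) (μ : Measure (CSpace d))
    (hμ : ∀ᵐ x ∂μ, ∀ i, (x i).im = 0) (α β : MultiIdx d n) :
    momentMatrix n μ α β = ∫ x, mono x (α.1 + β.1) ∂μ := by
  refine integral_congr_ae ?_
  filter_upwards [hμ] with x hx
  have : ∀ i, conj (x i) = x i := fun i => Complex.conj_eq_iff_im.2 (hx i)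
  simp [mono, map_prod, this, pow_add, Finset.prod_mul_distrib]

/-- The empirical measure `N⁻¹ ∑ δ_{z^k}`. -/
noncomputable def empirical {d N : ℕ} (z : Fin N → CSpace d) : Measure (CSpace d) :=
  (N : ENNReal)⁻¹ • ∑ k, Measure.dirac (z k)

/-- The matrix `𝐔_{p,n,Z}` with rows `𝐮_{p,n}(z^k)`. -/
noncomputable def sampleMatrix {d N : ℕ} (p : CSpace d) (n : ℕ) (Z : Fin N → CSpace d) :
    Matrix (Fin N) (MultiIdx d n) ℂ :=
  Matrix.of fun k α => u p α.1 (Z k)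

/-- `𝐂̂_{m,n,Z}`: the columns of index `|α| ≤ m` of `𝐕_{f(p),m,f(Z)}^* (𝐔_{p,n,Z}^*)^†`. -/
noncomputable def approxMatrix {d r N : ℕ} (p : CSpace d) (f : CSpace d → CSpace r) {m n : ℕ}
    (hmn : m ≤ n) (Z : Fin N → CSpace d) : Matrix (MultiIdx r m) (MultiIdx d m) ℂ :=
  ((sampleMatrix (f p) m (f ∘ Z))ᴴ * pinv (sampleMatrix p n Z)ᴴ).submatrix id
    (MultiIdx.incl hmn)

/-- The reconstructed vector field
`V̂_i(z) = 𝐮_{p,m}(z) 𝐀̂^* (∂_{z_i} 𝐮_{p,m}(0))^*`, where `𝐀̂ = T⁻¹ log 𝐂̂` and `𝐂̂ = C`. -/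
noncomputable def reconstructedField {d m : ℕ} (p : CSpace d) (T : ℝ)
    (C : Matrix (MultiIdx d m) (MultiIdx d m) ℂ) (z : CSpace d) : CSpace d :=
  WithLp.toLp 2 fun i =>
    (fun α : MultiIdx d m => u p α.1 z) ⬝ᵥ
      (((T : ℂ)⁻¹ • matLog C)ᴴ *ᵥ fun β : MultiIdx d m => conj (pderiv i (u p β.1) 0))

/-! ### Geometry and dynamics -/

/-- Absolutely convex subsets of `ℂ^d`. -/
def IsAbsConvex {d : ℕ} (K : Set (CSpace d)) : Prop :=
  ∀ x ∈ K, ∀ y ∈ K, ∀ a b : ℂ, ‖a‖ + ‖b‖ ≤ 1 → a • x + b • y ∈ K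

/-- `sup_{x ∈ S} |x|_K`, where `|x|_K = inf {r > 0 : x ∈ r K}` is the Minkowski functional. -/
noncomputable def supGauge {d : ℕ} (K S : Set (CSpace d)) : ℝ := sSup (gauge K '' S)

/-- For every `w ∈ K`, the curve `t ↦ φ t w` solves `ż = V(z)`, `z(0) = w` on `[0, T]` and stays in
the domain `U` of `V`. -/
def IsFlowOn {d : ℕ} (V : CSpace d → CSpace d) (U K : Set (CSpace d)) (T : ℝ)
    (φ : ℝ → CSpace d → CSpace d) : Prop :=
  ∀ w ∈ K, φ 0 w = w ∧ ∀ t ∈ Set.Icc (0 : ℝ) T, φ t w ∈ U ∧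
    HasDerivWithinAt (fun s => φ s w) (V (φ t w)) (Set.Icc 0 T) t

/-- The inclusion `ℝ^d ⊆ ℂ^d`. -/
noncomputable def realIncl {d : ℕ} (x : EuclideanSpace ℝ (Fin d)) : CSpace d :=
  WithLp.toLp 2 fun i => (x i : ℂ)

end FockPushforward

namespace FockPushforward

/-! ### Holomorphic functions of several variables -/

section Osgood

variable {E F : Type} [NormedAddCommGroup E] [NormedSpace ℂ E]
  [NormedAddCommGroup F] [NormedSpace ℂ F]

/-! Write $f=\phi^T$ and let $A$ be the matrix, in the basis $u_{p,\alpha}$, of $h\mapsto dh(V)$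
acting on $m$-jets at $p$; it exists because $V(p)=0$ (`lieMatrix`, `coef_lieDeriv`). The theorem
compares an exact identity, $\log\mathbf C_m=TA^*$, with its sampled version.

The exact identity. Since $e^{\zeta^*z}$ expands as
$\sum_\beta\overline{u_{p,\beta}(\zeta)}\,u_{p,\beta}(z)$, the functional with Fourier–Borel
transform $u_{p,\alpha}$ reads off the $u_{p,\alpha}$-coordinate of a germ. Hence $\mathbf C_m^*$ is
the matrix of $h\mapsto h\circ f$ on $m$-jets (`conjTranspose_pushforwardMatrix`). Compositions with
$\phi^t$ form a semigroup generated by $A$, so $\mathbf C_m^*=e^{TA}$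
(`IsFlowOn.compMatrix_eq_exp`). Looking at the lowest-order part of an eigenjet shows that
eigenvalues of $A$ are sums of eigenvalues of $DV(p)$, hence real
(`im_eq_zero_of_lieMatrix_mulVec`). The integral logarithm therefore inverts the exponential
(`matLog_exp`, `IsFlowOn.matLog_pushforwardMatrix`). The coordinate function $z_i$ has coordinates
$\overline{\partial_iu_{p,\beta}(0)}$, and its derivative along $V$ is $V_i$; so exact data
reproduce precisely the $m$-jet of $V_i$ (`lieMatrix_mulVec_conj_pderiv`).

Three errors remain. Truncation: on complex lines through $p$, after removal of the factor
$e^{p^*z}$, the jet expansion is a Taylor polynomial in one variable, and Cauchy's estimates give a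
remainder of size $R^{m+1}/(1-R)$ (`norm_sub_sum_coef_le`). Least squares: the sampled functions
$u_{p,\beta}\circ f$ are their $n$-jets plus such a remainder; the pseudo-inverse recovers the jet
coefficients exactly and amplifies the remainder by at most a constant times $\sqrt{m!/\lambda}$,
where $\lambda$ is a lower bound for the sampled moment form
(`opNorm_pushforwardMatrix_sub_approxMatrix_le`). Logarithm: a resolvent identity under the integral
gives the Lipschitz constant $B_m^2/\gamma_2$ (`norm_matLog_sub_le`).

In (a), $\lambda=N\gamma_1\Lambda_n(\mu)$ by the relative closeness of the moment matrices. In (b),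
weak convergence on a compact set makes the moment matrices converge, so $\Lambda_n(\mu)/2$ serves
for large $N$, and the condition on the lower limit of $\Lambda_n(\mu)^{1/(2n)}$ turns
$R_\mu^n/\Lambda_n(\mu)^{1/2}$ into $\rho^n$.

The early parts supply analyticity: Osgood's lemma, and the holomorphic dependence of solutions on
initial values. -/

theorem differentiableOn_line {f : E → F} {U : Set E} (hf : DifferentiableOn ℂ f U) (x v : E) :
    DifferentiableOn ℂ (fun s : ℂ => f (x + s • v)) {s | x + s • v ∈ U} := by
  refine hf.comp (fun s _ => DifferentiableAt.differentiableWithinAt (by fun_prop)) fun s hs => hs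

theorem deriv_line {f : E → F} {x v : E} {s : ℂ} (hf : DifferentiableAt ℂ f (x + s • v)) :
    deriv (fun s : ℂ => f (x + s • v)) s = fderiv ℂ f (x + s • v) v := by
  have h1 : HasDerivAt (fun s : ℂ => x + s • v) v s := by
    simpa using ((hasDerivAt_id s).smul_const v).const_add x
  exact (hf.hasFDerivAt.comp_hasDerivAt s h1).deriv

/-- Cauchy's estimate for directional derivatives. -/
theorem norm_fderiv_apply_le {f : E → F} {x v : E} {ρ M : ℝ} (hρ : 0 < ρ)
    (hf : ∀ s : ℂ, ‖s‖ ≤ ρ → DifferentiableAt ℂ f (x + s • v))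
    (hM : ∀ s : ℂ, ‖s‖ ≤ ρ → ‖f (x + s • v)‖ ≤ M) : ‖fderiv ℂ f x v‖ ≤ M / ρ := by
  have h0 := deriv_line (s := 0) (x := x) (v := v) (hf 0 (by simpa using hρ.le))
  rw [zero_smul, add_zero] at h0
  rw [← h0]
  refine Complex.norm_deriv_le_of_forall_mem_sphere_norm_le hρ ?_ ?_
  · refine DifferentiableOn.diffContOnCl_ball (U := Metric.closedBall 0 ρ) ?_ le_rfl
    intro s hs
    have h1 : DifferentiableAt ℂ (fun s : ℂ => x + s • v) s := by fun_prop
    exact ((hf s (by simpa using hs)).comp s h1).differentiableWithinAt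
  · intro s hs
    exact hM s (by simpa using hs.le)

/-- Cauchy's estimate for the Fréchet derivative. -/
theorem norm_fderiv_le {f : E → F} {x : E} {r R M : ℝ} (hr : 0 < r) (hrR : r < R)
    (hf : DifferentiableOn ℂ f (Metric.ball x R)) (hM : ∀ y ∈ Metric.ball x R, ‖f y‖ ≤ M) :
    ‖fderiv ℂ f x‖ ≤ M / r := by
  have hM0 : 0 ≤ M := (norm_nonneg _).trans (hM x (Metric.mem_ball_self (hr.trans hrR)))
  refine ContinuousLinearMap.opNorm_le_bound _ (by positivity) fun v => ?_
  rcases eq_or_ne v 0 with rfl | hv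
  · simp
  have hv' : 0 < ‖v‖ := norm_pos_iff.2 hv
  have hin : ∀ s : ℂ, ‖s‖ ≤ r / ‖v‖ → x + s • v ∈ Metric.ball x R := by
    intro s hs
    rw [mem_ball_iff_norm, add_sub_cancel_left, norm_smul]
    rw [le_div_iff₀ hv'] at hs
    exact hs.trans_lt hrR
  have := norm_fderiv_apply_le (f := f) (x := x) (v := v) (div_pos hr hv')
    (fun s hs => hf.differentiableAt (Metric.isOpen_ball.mem_nhds (hin s hs)))
    (fun s hs => hM _ (hin s hs))
  refine this.trans (le_of_eq ?_)
  field_simp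

/-- In a finite basis $b_i$ one has $A(z)=\sum_i b_i^*\otimes A(z)b_i$, a fixed linear expression in
finitely many values. -/
theorem differentiableAt_clm_of_apply [FiniteDimensional ℂ E] {D : Type} [NormedAddCommGroup D]
    [NormedSpace ℂ D] {A : D → E →L[ℂ] F} {x : D}
    (h : ∀ v, DifferentiableAt ℂ (fun z => A z v) x) : DifferentiableAt ℂ A x := by
  let b := Module.finBasis ℂ E
  have : A = fun z => ∑ i, (LinearMap.toContinuousLinearMap (b.coord i)).smulRight (A z (b i)) := by
    funext z
    ext v
    have h2 := congrArg (A z) (b.sum_repr v)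
    rw [map_sum] at h2
    rw [← h2]
    simp
  rw [this]
  refine DifferentiableAt.fun_sum fun i _ => ?_
  exact ((ContinuousLinearMap.smulRightL ℂ E F
    (LinearMap.toContinuousLinearMap (b.coord i))).differentiableAt).comp x (h (b i))

/-- Each directional derivative is a Cauchy integral of $f$ over a fixed small circle in that
direction, and this integral can be differentiated in $z$ under the integral sign. The dominating
constant comes from Cauchy's estimate for the derivative. Continuity of the derivative is not yet
known, but `measurable_fderiv` provides the measurability needed. -/
theorem differentiableOn_fderiv [FiniteDimensional ℂ E] [FiniteDimensional ℂ F] {f : E → F}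
    {U : Set E} (hU : IsOpen U) (hf : DifferentiableOn ℂ f U) :
    DifferentiableOn ℂ (fderiv ℂ f) U := by
  have : CompleteSpace F := FiniteDimensional.complete ℂ F
  have : CompleteSpace E := FiniteDimensional.complete ℂ E
  have : ProperSpace E := FiniteDimensional.proper ℂ E
  have : ProperSpace F := FiniteDimensional.proper ℂ F
  have : FiniteDimensional ℂ (E →L[ℂ] F) := inferInstance
  have : ProperSpace (E →L[ℂ] F) := FiniteDimensional.proper ℂ _
  let _ : MeasurableSpace E := borel E
  have : BorelSpace E := ⟨rfl⟩
  let _ : MeasurableSpace (E →L[ℂ] F) := borel _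
  have : BorelSpace (E →L[ℂ] F) := ⟨rfl⟩
  intro x hx
  refine DifferentiableAt.differentiableWithinAt (differentiableAt_clm_of_apply fun v => ?_)
  obtain ⟨M, r, hr, hrU, hM⟩ : ∃ M r, 0 < r ∧ Metric.ball x (4 * r) ⊆ U ∧
      ∀ y ∈ Metric.ball x (4 * r), ‖f y‖ ≤ M := by
    have hc : ContinuousAt f x := (hf.differentiableAt (hU.mem_nhds hx)).continuousAt
    have h1 : ∀ᶠ y in 𝓝 x, ‖f y‖ < ‖f x‖ + 1 :=
      hc.norm.eventually (gt_mem_nhds (by linarith))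
    obtain ⟨ε, hε, h⟩ := Metric.eventually_nhds_iff_ball.1 (h1.and (hU.mem_nhds hx))
    refine ⟨‖f x‖ + 1, ε / 4, by positivity, fun y hy => (h y (by
      rwa [mul_div_cancel₀ _ (by norm_num : (4:ℝ) ≠ 0)] at hy)).2, fun y hy => ((h y (by
      rwa [mul_div_cancel₀ _ (by norm_num : (4:ℝ) ≠ 0)] at hy)).1).le⟩
  have hdiff : ∀ y ∈ Metric.ball x (4 * r), DifferentiableAt ℂ f y := fun y hy =>
    hf.differentiableAt (hU.mem_nhds (hrU hy))
  obtain ⟨ρ, hρ, hρv⟩ : ∃ ρ : ℝ, 0 < ρ ∧ ρ * ‖v‖ < r := by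
    refine ⟨r / (‖v‖ + 1), by positivity, ?_⟩
    rw [div_mul_eq_mul_div, div_lt_iff₀ (by positivity)]
    nlinarith [norm_nonneg v]
  have hin : ∀ z ∈ Metric.ball x r, ∀ s : ℂ, ‖s‖ ≤ ρ → z + s • v ∈ Metric.ball x (2 * r) := by
    intro z hz s hs
    rw [mem_ball_iff_norm] at hz ⊢
    calc ‖z + s • v - x‖ = ‖(z - x) + s • v‖ := by congr 1; abel
      _ ≤ ‖z - x‖ + ‖s‖ * ‖v‖ := (norm_add_le _ _).trans (by rw [norm_smul])
      _ < 2 * r := by nlinarith [mul_le_mul_of_nonneg_right hs (norm_nonneg v)]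
  have hsub : Metric.ball x (2 * r) ⊆ Metric.ball x (4 * r) :=
    Metric.ball_subset_ball (by linarith)
  have hfd : ∀ y ∈ Metric.ball x (2 * r), ‖fderiv ℂ f y‖ ≤ M / r := by
    intro y hy
    have hs : Metric.ball y (2 * r) ⊆ Metric.ball x (4 * r) :=
      Metric.ball_subset_ball' (by rw [Metric.mem_ball] at hy; linarith)
    exact norm_fderiv_le hr (by linarith : r < 2 * r) (hf.mono (hs.trans hrU))
      fun z hz => hM z (hs hz)
  have hcm : ∀ θ : ℝ, ‖circleMap 0 ρ θ‖ ≤ ρ := fun θ => by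
    simp [abs_of_pos hρ]
  -- Cauchy's formula for the derivative at $s=0$ of $s\mapsto f(z+sv)$, with one radius $\rho$
  -- valid for all $z$ near $x$.
  have hrep : ∀ z ∈ Metric.ball x r, fderiv ℂ f z v = (2 * (Real.pi : ℂ) * Complex.I)⁻¹ •
      ∮ s in C(0, ρ), ((s - 0) ^ 2)⁻¹ • f (z + s • v) := by
    intro z hz
    have hopen : IsOpen {s : ℂ | z + s • v ∈ Metric.ball x (4 * r)} :=
      Metric.isOpen_ball.preimage (by fun_prop)
    rw [Complex.two_pi_I_inv_smul_circleIntegral_sub_sq_inv_smul_of_differentiable hopen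
      (fun s hs => hsub (hin z hz s (by simpa using hs)))
      (differentiableOn_line (hf.mono hrU) z v) (by simpa using hρ)]
    rw [deriv_line (hdiff _ (hsub (hin z hz 0 (by simpa using hρ.le))))]
    simp
  have hev : (fun z => fderiv ℂ f z v) =ᶠ[𝓝 x] fun z => (2 * (Real.pi : ℂ) * Complex.I)⁻¹ •
      ∮ s in C(0, ρ), ((s - 0) ^ 2)⁻¹ • f (z + s • v) := by
    filter_upwards [Metric.ball_mem_nhds x hr] with z hz using hrep z hz
  refine DifferentiableAt.congr_of_eventuallyEq (DifferentiableAt.const_smul ?_ _) hev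
  simp only [circleIntegral]
  have hcont : ∀ z ∈ Metric.ball x r, Continuous fun θ : ℝ =>
      deriv (circleMap 0 ρ) θ • ((circleMap 0 ρ θ - 0) ^ 2)⁻¹ • f (z + circleMap 0 ρ θ • v) := by
    intro z hz
    have h1 : Continuous fun θ : ℝ => f (z + circleMap 0 ρ θ • v) := by
      refine continuous_iff_continuousAt.2 fun θ => ?_
      have h2 := (hdiff _ (hsub (hin z hz _ (hcm θ)))).continuousAt
      exact ContinuousAt.comp (f := fun θ : ℝ => z + circleMap 0 ρ θ • v) h2
        (Continuous.continuousAt (by fun_prop))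
    have h3 : Continuous fun θ : ℝ => deriv (circleMap 0 ρ) θ := by
      simp only [deriv_circleMap]; fun_prop
    refine h3.smul (Continuous.smul (Continuous.inv₀ (by fun_prop) fun θ => ?_) h1)
    simpa using hρ.ne'
  refine (intervalIntegral.hasFDerivAt_integral_of_dominated_of_fderiv_le (𝕜 := ℂ)
    (s := Metric.ball x r) (bound := fun _ => ρ * (ρ ^ 2)⁻¹ * (M / r))
    (F' := fun z θ => deriv (circleMap 0 ρ) θ • ((circleMap 0 ρ θ - 0) ^ 2)⁻¹ •
      fderiv ℂ f (z + circleMap 0 ρ θ • v))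
    (Metric.ball_mem_nhds x hr) ?_ ?_ ?_ ?_ ?_ ?_).differentiableAt
  · filter_upwards [Metric.ball_mem_nhds x hr] with z hz
    exact (hcont z hz).aestronglyMeasurable
  · exact (hcont x (Metric.mem_ball_self hr)).intervalIntegrable _ _
  · refine Measurable.aestronglyMeasurable ?_
    have h3 : Measurable fun θ : ℝ => deriv (circleMap 0 ρ) θ := measurable_deriv _
    refine h3.smul (Measurable.smul (f := fun θ : ℝ => ((circleMap 0 ρ θ - 0) ^ 2)⁻¹) (by fun_prop) ?_)
    exact (measurable_fderiv ℂ f).comp (Continuous.measurable (by fun_prop))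
  · refine ae_of_all _ fun θ _ z hz => ?_
    rw [norm_smul, norm_smul, ← mul_assoc]
    have := hfd _ (hin z hz _ (hcm θ))
    simp only [deriv_circleMap, norm_mul, norm_inv, norm_pow, sub_zero, norm_circleMap_zero,
      Complex.norm_I, mul_one, abs_of_pos hρ]
    gcongr
  · simp
  · refine ae_of_all _ fun θ _ z hz => ?_
    have h1 := (hdiff _ (hsub (hin z hz _ (hcm θ)))).hasFDerivAt
    have h2 : HasFDerivAt (fun z : E => z + circleMap 0 ρ θ • v) (ContinuousLinearMap.id ℂ E) z :=
      (hasFDerivAt_id z).add_const _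
    exact (((h1.comp z h2).const_smul _).const_smul _)

theorem contDiffOn_of_differentiableOn [FiniteDimensional ℂ E] (n : ℕ) :
    ∀ {F : Type} [NormedAddCommGroup F] [NormedSpace ℂ F] [FiniteDimensional ℂ F] {f : E → F}
      {U : Set E}, IsOpen U → DifferentiableOn ℂ f U → ContDiffOn ℂ n f U := by
  induction n with
  | zero =>
    intro F _ _ _ f U hU hf
    exact contDiffOn_zero.2 hf.continuousOn
  | succ n ih =>
    intro F _ _ _ f U hU hf
    have := (contDiffOn_succ_iff_fderiv_of_isOpen (𝕜 := ℂ) (n := n) hU (f := f)).2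
      ⟨hf, fun h => by simp at h, ih hU (differentiableOn_fderiv hU hf)⟩
    exact_mod_cast this

/-- Cauchy's estimate is applied $k$ times, each time giving up a margin $\delta$ of the radius.
Taking $\delta$ of order $R/k$ yields growth $k^k$, which is no worse than $k!\,e^k$. -/
theorem norm_iteratedFDeriv_le_of_bound [FiniteDimensional ℂ E] (k : ℕ) :
    ∀ {F : Type} [NormedAddCommGroup F] [NormedSpace ℂ F] [FiniteDimensional ℂ F] {f : E → F}
      {x : E} {δ R M : ℝ}, 0 < δ → k * δ < R → DifferentiableOn ℂ f (Metric.ball x R) →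
      (∀ y ∈ Metric.ball x R, ‖f y‖ ≤ M) → ‖iteratedFDeriv ℂ k f x‖ ≤ M / δ ^ k := by
  induction k with
  | zero =>
    intro F _ _ _ f x δ R M hδ hR hf hM
    simpa using hM x (Metric.mem_ball_self (by simpa using hR))
  | succ k ih =>
    intro F _ _ _ f x δ R M hδ hR hf hM
    push_cast at hR
    rw [← norm_iteratedFDeriv_fderiv]
    obtain ⟨R', h1, h2⟩ := exists_between (show k * δ < R - δ by linarith)
    have := ih (f := fderiv ℂ f) (x := x) (δ := δ) (R := R') (M := M / δ) hδ h1
      ((differentiableOn_fderiv Metric.isOpen_ball hf).mono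
        (Metric.ball_subset_ball (by linarith))) (by
        intro y hy
        have hs : Metric.ball y (R - R') ⊆ Metric.ball x R :=
          Metric.ball_subset_ball' (by rw [Metric.mem_ball] at hy; linarith)
        exact norm_fderiv_le hδ (by linarith : δ < R - R') (hf.mono hs) fun z hz => hM z (hs hz))
    rwa [div_div, ← pow_succ'] at this

theorem iteratedDeriv_line [FiniteDimensional ℂ E] [FiniteDimensional ℂ F] {f : E → F} {U : Set E}
    (hU : IsOpen U) (hf : DifferentiableOn ℂ f U) {x : E} (hx : x ∈ U) (y : E) (k : ℕ) :
    iteratedDeriv k (fun s : ℂ => f (x + s • y)) 0 = iteratedFDeriv ℂ k f x fun _ => y := by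
  let g : ℂ →L[ℂ] E := (ContinuousLinearMap.id ℂ ℂ).smulRight y
  let f' : E → F := fun z => f (x + z)
  let U' : Set E := (fun z => x + z) ⁻¹' U
  have hU' : IsOpen U' := hU.preimage (by fun_prop)
  have hf' : ContDiffOn ℂ k f' U' := by
    refine contDiffOn_of_differentiableOn k hU' (hf.comp ?_ fun z hz => hz)
    exact fun z _ => DifferentiableAt.differentiableWithinAt (by fun_prop)
  have hpre : IsOpen (g ⁻¹' U') := hU'.preimage g.continuous
  have h0 : g 0 ∈ U' := by simpa [U', g] using hx
  have h := g.iteratedFDerivWithin_comp_right hf' hU'.uniqueDiffOn hpre.uniqueDiffOn (x := 0) h0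
    (i := k) le_rfl
  rw [iteratedFDerivWithin_of_isOpen k hpre h0, iteratedFDerivWithin_of_isOpen k hU' h0] at h
  have h2 := congrArg (fun m => m fun _ => (1 : ℂ)) h
  have e : f' ∘ g = fun s : ℂ => f (x + s • y) := rfl
  rw [iteratedDeriv_eq_iteratedFDeriv, ← e]
  simp only [h2, ContinuousMultilinearMap.compContinuousLinearMap_apply]
  rw [map_zero, iteratedFDeriv_comp_add_left, add_zero]
  simp [g]

/-- Osgood's lemma: complex differentiable functions on an open subset of a finite-dimensional
space are analytic. -/
theorem analyticOnNhd_of_differentiableOn [FiniteDimensional ℂ E] [FiniteDimensional ℂ F]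
    {f : E → F} {U : Set E} (hU : IsOpen U) (hf : DifferentiableOn ℂ f U) :
    AnalyticOnNhd ℂ f U := by
  have : CompleteSpace F := FiniteDimensional.complete ℂ F
  intro x hx
  obtain ⟨M, r, hr, hrU, hM⟩ : ∃ M r, 0 < r ∧ Metric.ball x r ⊆ U ∧
      ∀ y ∈ Metric.ball x r, ‖f y‖ ≤ M := by
    have hc : ContinuousAt f x := (hf.differentiableAt (hU.mem_nhds hx)).continuousAt
    have h1 : ∀ᶠ y in 𝓝 x, ‖f y‖ < ‖f x‖ + 1 :=
      hc.norm.eventually (gt_mem_nhds (by linarith))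
    obtain ⟨ε, hε, h⟩ := Metric.eventually_nhds_iff_ball.1 (h1.and (hU.mem_nhds hx))
    exact ⟨‖f x‖ + 1, ε, hε, fun y hy => (h y hy).2, fun y hy => (h y hy).1.le⟩
  have hM0 : 0 ≤ M := (norm_nonneg _).trans (hM x (Metric.mem_ball_self hr))
  have hfr : DifferentiableOn ℂ f (Metric.ball x r) := hf.mono hrU
  let p : FormalMultilinearSeries ℂ E F := fun k => (k.factorial : ℂ)⁻¹ • iteratedFDeriv ℂ k f x
  -- With margin $\delta=r/(2k)$ the $k$-th coefficient is at most $M(2k/r)^k/k!\le M(2e/r)^k$,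
  -- which dictates this radius.
  let ρ : NNReal := ⟨r / (2 * Real.exp 1), by positivity⟩
  have hρ : (0 : ℝ) < ρ := by change 0 < r / (2 * Real.exp 1); positivity
  have hρr : (ρ : ℝ) < r := by
    change r / (2 * Real.exp 1) < r
    rw [div_lt_iff₀ (by positivity)]
    nlinarith [Real.add_one_le_exp 1]
  refine ⟨p, ρ, ?_, by exact_mod_cast hρ, ?_⟩
  · refine p.le_radius_of_bound M fun k => ?_
    have hk : ‖iteratedFDeriv ℂ k f x‖ ≤ M * (2 * k / r) ^ k := by
      rcases Nat.eq_zero_or_pos k with rfl | hk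
      · simpa using hM x (Metric.mem_ball_self hr)
      · have hk' : (0 : ℝ) < k := by exact_mod_cast hk
        have := norm_iteratedFDeriv_le_of_bound k (f := f) (x := x) (δ := r / (2 * k)) (R := r)
          (M := M) (by positivity) (by field_simp; linarith) hfr hM
        refine this.trans (le_of_eq ?_)
        rw [div_eq_mul_inv, ← inv_pow, inv_div]
    have hfac : (0 : ℝ) < k.factorial := by exact_mod_cast k.factorial_pos
    have hexp : (k : ℝ) ^ k / k.factorial ≤ Real.exp 1 ^ k := by
      rw [← Real.exp_nat_mul, mul_one]
      exact Real.pow_div_factorial_le_exp k (by positivity) k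
    have hpk : ‖p k‖ = (k.factorial : ℝ)⁻¹ * ‖iteratedFDeriv ℂ k f x‖ := by
      simp [p, norm_smul]
    rw [hpk]
    change _ * (r / (2 * Real.exp 1)) ^ k ≤ M
    calc (k.factorial : ℝ)⁻¹ * ‖iteratedFDeriv ℂ k f x‖ * (r / (2 * Real.exp 1)) ^ k
        ≤ (k.factorial : ℝ)⁻¹ * (M * (2 * k / r) ^ k) * (r / (2 * Real.exp 1)) ^ k := by gcongr
      _ = M * ((k : ℝ) ^ k / k.factorial) * (Real.exp 1 ^ k)⁻¹ := by
        simp only [div_pow, mul_pow]; field_simp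
      _ ≤ M * Real.exp 1 ^ k * (Real.exp 1 ^ k)⁻¹ := by gcongr
      _ = M := by field_simp
  · intro y hy
    have hy' : ‖y‖ < ρ := by
      simpa [Metric.mem_eball, edist_zero_right, enorm_eq_nnnorm, ← NNReal.coe_lt_coe] using hy
    have hyr : ‖y‖ < r := hy'.trans hρr
    -- On the line through $x$ in direction $y$ the function is holomorphic on a disc of radius
    -- $q>1$, so its one-variable Taylor series may be evaluated at $s=1$.
    obtain ⟨q, hq1, hq⟩ : ∃ q : ℝ, 1 < q ∧ q * ‖y‖ < r := by
      refine ⟨2 * r / (r + ‖y‖), ?_, ?_⟩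
      · rw [lt_div_iff₀ (by positivity)]; linarith
      · rw [div_mul_eq_mul_div, div_lt_iff₀ (by positivity)]; nlinarith
    have hd : DifferentiableOn ℂ (fun s : ℂ => f (x + s • y)) (Metric.ball 0 q) := by
      refine (differentiableOn_line hf x y).mono fun s hs => hrU ?_
      rw [mem_ball_iff_norm, add_sub_cancel_left, norm_smul]
      rw [mem_ball_zero_iff] at hs
      nlinarith [norm_nonneg y]
    have := Complex.hasSum_taylorSeries_on_ball hd (z := 1) (by simpa using hq1)
    simp only [one_smul, sub_zero, one_pow] at this
    convert this using 2 with k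
    rw [iteratedDeriv_line hU hf hx y k]
    rfl

end Osgood

/-! ### Holomorphic dependence of solutions of differential equations on the initial value -/

/-- Picard–Lindelöf with a common existence time, shrunk until all solutions stay in the prescribed
neighbourhood. -/
theorem exists_local_flow_lipschitz {E : Type} [NormedAddCommGroup E] [NormedSpace ℝ E]
    [CompleteSpace E] {v : E → E} {x₀ : E} (hv : ContDiffAt ℝ 1 v x₀) {N : Set E} (hN : N ∈ 𝓝 x₀) :
    ∃ r > (0 : ℝ), ∃ ε > (0 : ℝ), ∃ α : E → ℝ → E,
      (∀ x ∈ Metric.closedBall x₀ r, α x 0 = x ∧ ∀ t ∈ Set.Icc (0 : ℝ) ε, α x t ∈ N ∧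
        HasDerivWithinAt (α x) (v (α x t)) (Set.Icc 0 ε) t) ∧
      ∃ L : NNReal, ∀ t ∈ Set.Icc (0 : ℝ) ε, LipschitzOnWith L (α · t) (Metric.closedBall x₀ r) := by
  obtain ⟨ε, hε, a, r, _, _, hr, hpl⟩ := IsPicardLindelof.of_contDiffAt_one hv
  obtain ⟨α, hα, L, hL⟩ := (hpl 0).exists_forall_mem_closedBall_eq_hasDerivWithinAt_lipschitzOnWith
  simp only [zero_sub, zero_add] at hα hL
  obtain ⟨b, hb, hbN⟩ := Metric.mem_nhds_iff.1 hN
  have hr' : (0 : ℝ) < r := hr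
  have h0 := hα x₀ (Metric.mem_closedBall_self hr'.le)
  have hc : ContinuousAt (α x₀) 0 :=
    ((h0.2 0 ⟨by linarith, hε.le⟩).hasDerivAt (Icc_mem_nhds (by linarith) hε)).continuousAt
  have h1 : ∀ᶠ t in 𝓝 (0 : ℝ), dist (α x₀ t) x₀ < b / 2 := by
    have := hc.eventually (Metric.ball_mem_nhds _ (half_pos hb))
    simpa [h0.1] using this
  obtain ⟨η, hη, hη'⟩ := Metric.eventually_nhds_iff_ball.1 h1
  -- Half of the room $b$ is spent on the motion of the central solution, half on the Lipschitz
  -- spread of its neighbours.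
  let r' : ℝ := min r (b / 2 / (L + 1))
  let ε' : ℝ := min ε (η / 2)
  have hr'' : 0 < r' := lt_min hr' (by positivity)
  have hε'' : 0 < ε' := lt_min hε (half_pos hη)
  have hsub : Set.Icc 0 ε' ⊆ Set.Icc (-ε) ε :=
    Set.Icc_subset_Icc (by linarith) (min_le_left _ _)
  have hsub' : Metric.closedBall x₀ r' ⊆ Metric.closedBall x₀ r :=
    Metric.closedBall_subset_closedBall (min_le_left _ _)
  refine ⟨r', hr'', ε', hε'', α, fun x hx => ⟨(hα x (hsub' hx)).1, fun t ht =>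
    ⟨hbN ?_, ((hα x (hsub' hx)).2 t (hsub ht)).mono hsub⟩⟩, L, fun t ht =>
    (hL t (hsub ht)).mono hsub'⟩
  have h2 := (hL t (hsub ht)).dist_le_mul x (hsub' hx) x₀ (Metric.mem_closedBall_self hr'.le)
  have h3 := hη' t (by
    rw [Metric.mem_ball, Real.dist_eq, sub_zero, abs_of_nonneg ht.1]
    exact (ht.2.trans (min_le_right _ _)).trans_lt (by linarith))
  have h4 : dist x x₀ ≤ b / 2 / (L + 1) := (Metric.mem_closedBall.1 hx).trans (min_le_right _ _)
  have h5 : (L : ℝ) * dist x x₀ ≤ b / 2 := by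
    rw [le_div_iff₀ (by positivity)] at h4
    nlinarith [dist_nonneg (x := x) (y := x₀)]
  rw [Metric.mem_ball]
  calc dist (α x t) x₀ ≤ dist (α x t) (α x₀ t) + dist (α x₀ t) x₀ := dist_triangle _ _ _
    _ < b := by linarith

/-- Mean value inequality on the segment for $V$ minus its linearisation at $x$, whose derivative
there is at most $K\|y-x\|$. -/
theorem norm_sub_sub_fderiv_le {E : Type} [NormedAddCommGroup E] [NormedSpace ℂ E] {V : E → E}
    {B : Set E} (hB : Convex ℝ B) {K : NNReal}
    (hV : ∀ x ∈ B, DifferentiableAt ℂ V x) (hK : LipschitzOnWith K (fderiv ℂ V) B) {x y : E}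
    (hx : x ∈ B) (hy : y ∈ B) : ‖V y - V x - fderiv ℂ V x (y - x)‖ ≤ K * ‖y - x‖ ^ 2 := by
  have hseg : segment ℝ x y ⊆ B := hB.segment_subset hx hy
  have := (convex_segment x y).norm_image_sub_le_of_norm_hasFDerivWithin_le' (𝕜 := ℂ) (f := V)
    (f' := fderiv ℂ V) (φ := fderiv ℂ V x) (C := K * ‖y - x‖)
    (fun z hz => (hV z (hseg hz)).hasFDerivAt.hasFDerivWithinAt) (fun z hz => by
      have h1 := hK.norm_sub_le (hseg hz) hx
      refine h1.trans ?_
      gcongr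
      obtain ⟨t, ht, rfl⟩ := (segment_eq_image' ℝ x y ▸ hz : z ∈ _)
      simp only [add_sub_cancel_left, norm_smul, Real.norm_eq_abs, abs_of_nonneg ht.1]
      nlinarith [norm_nonneg (y - x), ht.2]) (left_mem_segment ℝ x y) (right_mem_segment ℝ x y)
  linarith

theorem gronwallBound_zero_mul (K ε x : ℝ) :
    gronwallBound 0 K ε x = ε * gronwallBound 0 K 1 x := by
  by_cases h : K = 0
  · subst h; simp [gronwallBound_K0]
  · simp [gronwallBound_of_K_ne_0 h]; ring

theorem hasDerivWithinAt_Ici_of_Icc {E : Type} [NormedAddCommGroup E] [NormedSpace ℝ E]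
    {γ : ℝ → E} {γ' : E} {a b t : ℝ} (h : HasDerivWithinAt γ γ' (Set.Icc a b) t)
    (ht : t ∈ Set.Ico a b) : HasDerivWithinAt γ γ' (Set.Ici t) t :=
  (h.mono_of_mem_nhdsWithin (Icc_mem_nhdsGE_of_mem ht))

/-- The equation is solved together with its variational equation $\dot Y=DV(z)Y$, $Y(0)=I$. The
complex linear map $Y$ is the derivative of the flow map: $\psi_\tau(y)-\psi_\tau(x)-Y_\tau(x)(y-x)$
vanishes at time $0$ and satisfies a linear differential inequality with forcing $O(\|y-x\|^2)$, so
Grönwall's inequality makes it $O(\|y-x\|^2)$. -/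
theorem exists_local_flow_holomorphic {d : ℕ} {V : CSpace d → CSpace d} {U : Set (CSpace d)}
    (hU : IsOpen U) (hV : DifferentiableOn ℂ V U) {x₀ : CSpace d} (hx₀ : x₀ ∈ U)
    {N : Set (CSpace d)} (hN : N ∈ 𝓝 x₀) :
    ∃ r > (0 : ℝ), ∃ ε > (0 : ℝ), ∃ ψ : ℝ → CSpace d → CSpace d,
      (∀ x ∈ Metric.ball x₀ r, ψ 0 x = x ∧ ∀ t ∈ Set.Icc (0 : ℝ) ε, ψ t x ∈ N ∧
        HasDerivWithinAt (ψ · x) (V (ψ t x)) (Set.Icc 0 ε) t) ∧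
      ∀ t ∈ Set.Icc (0 : ℝ) ε, DifferentiableOn ℂ (ψ t) (Metric.ball x₀ r) := by
  have hVd := differentiableOn_fderiv hU hV
  have hA : AnalyticAt ℂ (fderiv ℂ V) x₀ := analyticOnNhd_of_differentiableOn hU hVd x₀ hx₀
  have hVA : AnalyticAt ℂ V x₀ := analyticOnNhd_of_differentiableOn hU hV x₀ hx₀
  obtain ⟨K, s, hs, hK⟩ := (hA.contDiffAt (n := 1)).exists_lipschitzOnWith
  have hbd : ∀ᶠ y in 𝓝 x₀, ‖fderiv ℂ V y‖ < ‖fderiv ℂ V x₀‖ + 1 :=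
    hA.continuousAt.norm.eventually (gt_mem_nhds (by linarith))
  set M := ‖fderiv ℂ V x₀‖ + 1 with hM
  obtain ⟨a, ha, hB⟩ := Metric.mem_nhds_iff.1
    (Filter.inter_mem (Filter.inter_mem hs hbd) (Filter.inter_mem (hU.mem_nhds hx₀) hN))
  set B := Metric.ball x₀ a
  let W : CSpace d × (CSpace d →L[ℂ] CSpace d) → CSpace d × (CSpace d →L[ℂ] CSpace d) :=
    fun q => (V q.1, (fderiv ℂ V q.1).comp q.2)
  have hW : ContDiffAt ℂ 1 W (x₀, ContinuousLinearMap.id ℂ _) := by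
    refine ContDiffAt.prodMk ?_ ?_
    · exact (hVA.contDiffAt (n := 1)).comp (x₀, ContinuousLinearMap.id ℂ _) contDiffAt_fst
    · exact ((hA.contDiffAt (n := 1)).comp (x₀, ContinuousLinearMap.id ℂ _)
        contDiffAt_fst).clm_comp contDiffAt_snd
  obtain ⟨r, hr, ε, hε, α, hα, L, hL⟩ := exists_local_flow_lipschitz (hW.restrict_scalars ℝ)
    (N := B ×ˢ Set.univ) (prod_mem_nhds (Metric.ball_mem_nhds _ ha) Filter.univ_mem)
  have hin : ∀ x ∈ Metric.ball x₀ r,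
      (x, ContinuousLinearMap.id ℂ (CSpace d)) ∈
        Metric.closedBall (x₀, ContinuousLinearMap.id ℂ (CSpace d)) r := by
    intro x hx
    rw [Metric.mem_closedBall, Prod.dist_eq]
    simpa using (Metric.mem_ball.1 hx).le
  let ψ : ℝ → CSpace d → CSpace d := fun t x => (α (x, ContinuousLinearMap.id ℂ _) t).1
  let Y : ℝ → CSpace d → (CSpace d →L[ℂ] CSpace d) :=
    fun t x => (α (x, ContinuousLinearMap.id ℂ _) t).2
  have hψ : ∀ x ∈ Metric.ball x₀ r, ∀ t ∈ Set.Icc (0 : ℝ) ε, ψ t x ∈ B ∧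
      HasDerivWithinAt (ψ · x) (V (ψ t x)) (Set.Icc 0 ε) t := fun x hx t ht =>
    ⟨((hα _ (hin x hx)).2 t ht).1.1, ((hα _ (hin x hx)).2 t ht).2.fst⟩
  have hY : ∀ x ∈ Metric.ball x₀ r, ∀ t ∈ Set.Icc (0 : ℝ) ε,
      HasDerivWithinAt (Y · x) ((fderiv ℂ V (ψ t x)).comp (Y t x)) (Set.Icc 0 ε) t :=
    fun x hx t ht => ((hα _ (hin x hx)).2 t ht).2.snd
  refine ⟨r, hr, ε, hε, ψ, fun x hx => ⟨by simp [ψ, (hα _ (hin x hx)).1], fun t ht =>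
    ⟨(hB (hψ x hx t ht).1).2.2, (hψ x hx t ht).2⟩⟩, fun t ht x hx => ?_⟩
  refine HasFDerivWithinAt.differentiableWithinAt (f' := Y t x) (HasFDerivAt.hasFDerivWithinAt ?_)
  refine HasFDerivAt.of_isLittleO ?_
  refine Asymptotics.IsBigO.trans_isLittleO ?_ (Asymptotics.isLittleO_pow_sub_sub x one_lt_two)
  refine Asymptotics.IsBigO.of_bound (K * L ^ 2 * gronwallBound 0 M 1 t) ?_
  filter_upwards [Metric.isOpen_ball.mem_nhds hx] with y hy
  have hdist : ∀ τ ∈ Set.Icc (0 : ℝ) ε, ‖ψ τ y - ψ τ x‖ ≤ L * ‖y - x‖ := by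
    intro τ hτ
    have h1 := (hL τ hτ).norm_sub_le (hin y hy) (hin x hx)
    refine (norm_fst_le (α (y, ContinuousLinearMap.id ℂ _) τ -
      α (x, ContinuousLinearMap.id ℂ _) τ)).trans (h1.trans (le_of_eq ?_))
    simp [Prod.norm_def]
  let e : ℝ → CSpace d := fun τ => ψ τ y - ψ τ x - Y τ x (y - x)
  have he : ∀ τ ∈ Set.Icc (0 : ℝ) ε, HasDerivWithinAt e
      (V (ψ τ y) - V (ψ τ x) - (fderiv ℂ V (ψ τ x)) (Y τ x (y - x))) (Set.Icc 0 ε) τ := by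
    intro τ hτ
    refine ((hψ y hy τ hτ).2.sub (hψ x hx τ hτ).2).sub ?_
    have h1 := hY x hx τ hτ
    let ev : (CSpace d →L[ℂ] CSpace d) →L[ℝ] CSpace d :=
      (ContinuousLinearMap.apply ℂ (CSpace d) (y - x)).restrictScalars ℝ
    exact (ev.hasFDerivAt.comp_hasDerivWithinAt τ h1)
  have he0 : e 0 = 0 := by
    simp [e, ψ, Y, (hα _ (hin x hx)).1, (hα _ (hin y hy)).1]
  have hM0 : 0 ≤ M := by positivity
  have hgr := norm_le_gronwallBound_of_norm_deriv_right_le (f := e) (δ := 0) (K := M)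
    (ε := K * L ^ 2 * ‖y - x‖ ^ 2) (a := 0) (b := ε)
    (fun τ hτ => (he τ hτ).continuousWithinAt)
    (fun τ hτ => hasDerivWithinAt_Ici_of_Icc (he τ (Set.Ico_subset_Icc_self hτ)) hτ)
    (by simp [he0]) (fun τ hτ => by
      have hτ' := Set.Ico_subset_Icc_self hτ
      have hx' := (hψ x hx τ hτ').1
      have hy' := (hψ y hy τ hτ').1
      have h1 := norm_sub_sub_fderiv_le (V := V) (convex_ball x₀ a) (K := K)
        (fun z hz => hV.differentiableAt (hU.mem_nhds (hB hz).2.1))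
        (hK.mono fun z hz => (hB hz).1.1) hx' hy'
      have h2 : V (ψ τ y) - V (ψ τ x) - (fderiv ℂ V (ψ τ x)) (Y τ x (y - x)) =
          (V (ψ τ y) - V (ψ τ x) - (fderiv ℂ V (ψ τ x)) (ψ τ y - ψ τ x)) +
            (fderiv ℂ V (ψ τ x)) (e τ) := by
        simp only [e, map_sub]; abel
      rw [h2]
      refine (norm_add_le _ _).trans ?_
      have h3 : ‖(fderiv ℂ V (ψ τ x)) (e τ)‖ ≤ M * ‖e τ‖ :=
        (ContinuousLinearMap.le_opNorm _ _).trans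
          (mul_le_mul_of_nonneg_right (hB hx').1.2.le (norm_nonneg _))
      have h4 : (K : ℝ) * ‖ψ τ y - ψ τ x‖ ^ 2 ≤ K * L ^ 2 * ‖y - x‖ ^ 2 := by
        have := hdist τ hτ'
        calc (K : ℝ) * ‖ψ τ y - ψ τ x‖ ^ 2 ≤ K * (L * ‖y - x‖) ^ 2 := by gcongr
          _ = _ := by ring
      linarith) t ht
  rw [gronwallBound_zero_mul, sub_zero] at hgr
  rw [norm_pow, norm_norm]
  refine hgr.trans (le_of_eq ?_)
  ring

/-- The two trajectories fill a compact subset of $U$, on which the locally Lipschitz field $V$ is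
Lipschitz. -/
theorem solution_unique {d : ℕ} {V : CSpace d → CSpace d} {U : Set (CSpace d)}
    (hU : IsOpen U) (hV : DifferentiableOn ℂ V U) {τ : ℝ} {γ₁ γ₂ : ℝ → CSpace d}
    (h₁ : ∀ t ∈ Set.Icc (0 : ℝ) τ, γ₁ t ∈ U ∧ HasDerivWithinAt γ₁ (V (γ₁ t)) (Set.Icc 0 τ) t)
    (h₂ : ∀ t ∈ Set.Icc (0 : ℝ) τ, γ₂ t ∈ U ∧ HasDerivWithinAt γ₂ (V (γ₂ t)) (Set.Icc 0 τ) t)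
    (h0 : γ₁ 0 = γ₂ 0) : Set.EqOn γ₁ γ₂ (Set.Icc 0 τ) := by
  have hc₁ : ContinuousOn γ₁ (Set.Icc 0 τ) := fun t ht => (h₁ t ht).2.continuousWithinAt
  have hc₂ : ContinuousOn γ₂ (Set.Icc 0 τ) := fun t ht => (h₂ t ht).2.continuousWithinAt
  let S := γ₁ '' Set.Icc 0 τ ∪ γ₂ '' Set.Icc 0 τ
  have hS : IsCompact S := (isCompact_Icc.image_of_continuousOn hc₁).union
    (isCompact_Icc.image_of_continuousOn hc₂)
  have hSU : S ⊆ U := by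
    rintro _ (⟨t, ht, rfl⟩ | ⟨t, ht, rfl⟩)
    exacts [(h₁ t ht).1, (h₂ t ht).1]
  have hL : LocallyLipschitzOn S V := by
    intro x hx
    obtain ⟨K, s, hs, hK⟩ := ((analyticOnNhd_of_differentiableOn hU hV x (hSU hx)).contDiffAt
      (n := 1)).exists_lipschitzOnWith
    exact ⟨K, s, mem_nhdsWithin_of_mem_nhds hs, hK⟩
  obtain ⟨K, hK⟩ := hL.exists_lipschitzOnWith_of_compact hS
  exact ODE_solution_unique_of_mem_Icc_right (v := fun _ => V) (s := fun _ => S) (K := K)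
    (fun _ _ => hK) hc₁
    (fun t ht => hasDerivWithinAt_Ici_of_Icc (h₁ t (Set.Ico_subset_Icc_self ht)).2 ht)
    (fun t ht => Or.inl ⟨t, Set.Ico_subset_Icc_self ht, rfl⟩) hc₂
    (fun t ht => hasDerivWithinAt_Ici_of_Icc (h₂ t (Set.Ico_subset_Icc_self ht)).2 ht)
    (fun t ht => Or.inr ⟨t, Set.Ico_subset_Icc_self ht, rfl⟩) h0

/-! ### Flow maps over a finite time interval -/

section Flow

variable {d : ℕ} {V : CSpace d → CSpace d} {U K : Set (CSpace d)} {T : ℝ}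
  {φ : ℝ → CSpace d → CSpace d}

theorem IsFlowOn.shift (hφ : IsFlowOn V U K T φ) {w : CSpace d} (hw : w ∈ K) {s τ : ℝ}
    (hs : 0 ≤ s) (hst : s + τ ≤ T) : ∀ t ∈ Set.Icc (0 : ℝ) τ, φ (s + t) w ∈ U ∧
      HasDerivWithinAt (fun t => φ (s + t) w) (V (φ (s + t) w)) (Set.Icc 0 τ) t := by
  intro t ht
  have h := (hφ w hw).2 (s + t) ⟨by linarith [ht.1], by linarith [ht.2]⟩
  refine ⟨h.1, ?_⟩
  have h1 : HasDerivWithinAt (fun t : ℝ => s + t) 1 (Set.Icc 0 τ) t :=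
    ((hasDerivAt_id t).const_add s).hasDerivWithinAt
  have := h.2.scomp t h1 (fun x hx => ⟨by linarith [hx.1], by linarith [hx.2]⟩)
  simpa [Function.comp_def] using this

theorem IsFlowOn.add (hU : IsOpen U) (hV : DifferentiableOn ℂ V U) (hφ : IsFlowOn V U K T φ)
    {w : CSpace d} (hw : w ∈ K) {s t : ℝ} (hs : 0 ≤ s) (ht : 0 ≤ t) (hst : s + t ≤ T)
    (hsw : φ s w ∈ K) : φ (s + t) w = φ t (φ s w) := by
  have h1 := hφ.shift hw (τ := t) hs hst
  have h2 := hφ.shift hsw (s := 0) (τ := t) le_rfl (by linarith)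
  have := solution_unique hU hV h1 h2 (by simp [(hφ _ hsw).1]) ⟨ht, le_rfl⟩
  simpa using this

theorem IsFlowOn.eq_self (hU : IsOpen U) (hV : DifferentiableOn ℂ V U) (hφ : IsFlowOn V U K T φ)
    {p : CSpace d} (hp : p ∈ K) (hpU : p ∈ U) (hVp : V p = 0) {t : ℝ} (ht : t ∈ Set.Icc 0 T) :
    φ t p = p := by
  have h2 : ∀ t ∈ Set.Icc (0 : ℝ) T, (fun _ : ℝ => p) t ∈ U ∧
      HasDerivWithinAt (fun _ : ℝ => p) (V ((fun _ : ℝ => p) t)) (Set.Icc 0 T) t :=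
    fun t _ => ⟨hpU, by simpa [hVp] using hasDerivWithinAt_const t (Set.Icc 0 T) p⟩
  exact solution_unique hU hV (hφ p hp).2 h2 (hφ p hp).1 ht

/-- The flow map of a holomorphic vector field extends, near each starting point, to a
holomorphic map. -/
theorem IsFlowOn.exists_holomorphic_extension (hU : IsOpen U) (hV : DifferentiableOn ℂ V U)
    (hφ : IsFlowOn V U K T φ) {w : CSpace d} (hw : w ∈ K) {t : ℝ} (ht : t ∈ Set.Icc 0 T) :
    ∃ (O : Set (CSpace d)) (F : CSpace d → CSpace d), IsOpen O ∧ w ∈ O ∧ DifferentiableOn ℂ F O ∧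
      ∀ z ∈ O ∩ K, F z = φ t z := by
  have hc : ContinuousOn (fun t => φ t w) (Set.Icc 0 T) :=
    fun t ht => ((hφ w hw).2 t ht).2.continuousWithinAt
  have hΓ := isCompact_Icc.image_of_continuousOn hc
  -- Compactness of the trajectory gives one time step $\varepsilon$ on which a local holomorphic
  -- flow exists around each of its points.
  obtain ⟨ε, hε, hloc⟩ : ∃ ε > (0 : ℝ), ∀ x ∈ (fun t => φ t w) '' Set.Icc 0 T,
      ∃ (O : Set (CSpace d)) (ψ : ℝ → CSpace d → CSpace d), IsOpen O ∧ x ∈ O ∧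
        (∀ z ∈ O, ψ 0 z = z ∧ ∀ t ∈ Set.Icc (0 : ℝ) ε, ψ t z ∈ U ∧
          HasDerivWithinAt (ψ · z) (V (ψ t z)) (Set.Icc 0 ε) t) ∧
        ∀ t ∈ Set.Icc (0 : ℝ) ε, DifferentiableOn ℂ (ψ t) O := by
    refine hΓ.induction_on (p := fun S => ∃ ε > (0 : ℝ), ∀ x ∈ S,
      ∃ (O : Set (CSpace d)) (ψ : ℝ → CSpace d → CSpace d), IsOpen O ∧ x ∈ O ∧
        (∀ z ∈ O, ψ 0 z = z ∧ ∀ t ∈ Set.Icc (0 : ℝ) ε, ψ t z ∈ U ∧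
          HasDerivWithinAt (ψ · z) (V (ψ t z)) (Set.Icc 0 ε) t) ∧
        ∀ t ∈ Set.Icc (0 : ℝ) ε, DifferentiableOn ℂ (ψ t) O)
      ⟨1, one_pos, by simp⟩ ?_ ?_ ?_
    · rintro S S' hSS ⟨ε, hε, h⟩
      exact ⟨ε, hε, fun x hx => h x (hSS hx)⟩
    · rintro S S' ⟨ε, hε, h⟩ ⟨ε', hε', h'⟩
      have key : ∀ {δ η : ℝ}, δ ≤ η → ∀ {x : CSpace d}, (∃ (O : Set (CSpace d))
          (ψ : ℝ → CSpace d → CSpace d), IsOpen O ∧ x ∈ O ∧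
          (∀ z ∈ O, ψ 0 z = z ∧ ∀ t ∈ Set.Icc (0 : ℝ) η, ψ t z ∈ U ∧
            HasDerivWithinAt (ψ · z) (V (ψ t z)) (Set.Icc 0 η) t) ∧
          ∀ t ∈ Set.Icc (0 : ℝ) η, DifferentiableOn ℂ (ψ t) O) → (∃ (O : Set (CSpace d))
          (ψ : ℝ → CSpace d → CSpace d), IsOpen O ∧ x ∈ O ∧
          (∀ z ∈ O, ψ 0 z = z ∧ ∀ t ∈ Set.Icc (0 : ℝ) δ, ψ t z ∈ U ∧
            HasDerivWithinAt (ψ · z) (V (ψ t z)) (Set.Icc 0 δ) t) ∧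
          ∀ t ∈ Set.Icc (0 : ℝ) δ, DifferentiableOn ℂ (ψ t) O) := by
        rintro δ η hδ x ⟨O, ψ, h1, h2, h3, h4⟩
        have hs := Set.Icc_subset_Icc (le_refl (0 : ℝ)) hδ
        exact ⟨O, ψ, h1, h2, fun z hz => ⟨(h3 z hz).1, fun t ht => ⟨((h3 z hz).2 t (hs ht)).1,
          ((h3 z hz).2 t (hs ht)).2.mono hs⟩⟩, fun t ht => h4 t (hs ht)⟩
      refine ⟨min ε ε', lt_min hε hε', ?_⟩
      rintro x (hx | hx)
      · exact key (min_le_left _ _) (h x hx)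
      · exact key (min_le_right _ _) (h' x hx)
    · rintro x ⟨t, ht, rfl⟩
      obtain ⟨r, hr, ε, hε, ψ, h1, h2⟩ := exists_local_flow_holomorphic hU hV
        ((hφ w hw).2 t ht).1 (hU.mem_nhds ((hφ w hw).2 t ht).1)
      exact ⟨Metric.ball (φ t w) r, mem_nhdsWithin_of_mem_nhds (Metric.ball_mem_nhds _ hr),
        ε, hε, fun y hy => ⟨_, ψ, Metric.isOpen_ball, hy, h1, h2⟩⟩
  -- Each time step composes the extension already built with a local flow; uniqueness of solutions
  -- identifies the result with $\phi^t$ on $K$.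
  have main : ∀ (n : ℕ), ∀ t ∈ Set.Icc 0 T, t ≤ n * ε → ∃ (O : Set (CSpace d))
      (F : CSpace d → CSpace d), IsOpen O ∧ w ∈ O ∧ DifferentiableOn ℂ F O ∧
      ∀ z ∈ O ∩ K, F z = φ t z := by
    intro n
    induction n with
    | zero =>
      intro t ht htn
      obtain rfl : t = 0 := le_antisymm (by simpa using htn) ht.1
      exact ⟨Set.univ, id, isOpen_univ, trivial, differentiableOn_id,
        fun z hz => ((hφ z hz.2).1).symm⟩
    | succ n ih =>
      intro t ht htn
      rcases le_or_gt t (n * ε) with h | h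
      · exact ih t ht h
      · have hs0 : 0 ≤ n * ε := by positivity
        have hsT : n * ε ∈ Set.Icc 0 T := ⟨hs0, h.le.trans ht.2⟩
        obtain ⟨O₁, F₁, ho₁, hw₁, hF₁, he₁⟩ := ih (n * ε) hsT le_rfl
        obtain ⟨O₂, ψ, ho₂, hw₂, h3, h4⟩ := hloc (φ (n * ε) w) ⟨_, hsT, rfl⟩
        push_cast at htn
        have hτ : t - n * ε ∈ Set.Icc 0 ε := ⟨by linarith, by linarith⟩
        refine ⟨O₁ ∩ F₁ ⁻¹' O₂, ψ (t - n * ε) ∘ F₁, hF₁.continuousOn.isOpen_inter_preimage ho₁ ho₂,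
          ⟨hw₁, ?_⟩, (h4 _ hτ).comp (hF₁.mono Set.inter_subset_left) fun z hz => hz.2, ?_⟩
        · rw [Set.mem_preimage, he₁ w ⟨hw₁, hw⟩]; exact hw₂
        · rintro z ⟨⟨hz₁, hz₂⟩, hzK⟩
          rw [Set.mem_preimage, he₁ z ⟨hz₁, hzK⟩] at hz₂
          have e1 := hφ.shift hzK (s := n * ε) (τ := t - n * ε) hs0 (by linarith [ht.2])
          have hs := Set.Icc_subset_Icc (le_refl (0 : ℝ)) hτ.2
          have := solution_unique hU hV (γ₁ := fun τ => ψ τ (φ (n * ε) z))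
            (fun τ hτ => ⟨((h3 _ hz₂).2 τ (hs hτ)).1, ((h3 _ hz₂).2 τ (hs hτ)).2.mono hs⟩) e1
            (by simp [(h3 _ hz₂).1]) ⟨hτ.1, le_rfl⟩
          simp only [add_sub_cancel] at this
          rw [Function.comp_apply, he₁ z ⟨hz₁, hzK⟩, this]
  obtain ⟨n, hn⟩ := exists_nat_ge (t / ε)
  exact main n t ht ((div_le_iff₀ hε).1 hn)

theorem IsFlowOn.continuousOn (hU : IsOpen U) (hV : DifferentiableOn ℂ V U)
    (hφ : IsFlowOn V U K T φ) {t : ℝ} (ht : t ∈ Set.Icc 0 T) : ContinuousOn (φ t) K := by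
  intro w hw
  obtain ⟨O, F, hO, hwO, hF, he⟩ := hφ.exists_holomorphic_extension hU hV hw ht
  have h1 : ContinuousWithinAt F K w :=
    (hF.continuousOn.continuousAt (hO.mem_nhds hwO)).continuousWithinAt
  refine h1.congr_of_eventuallyEq ?_ (he w ⟨hwO, hw⟩).symm
  filter_upwards [mem_nhdsWithin_of_mem_nhds (hO.mem_nhds hwO), self_mem_nhdsWithin] with z h2 h3
  exact (he z ⟨h2, h3⟩).symm

theorem IsFlowOn.differentiableAt (hU : IsOpen U) (hV : DifferentiableOn ℂ V U)
    (hφ : IsFlowOn V U K T φ) {t : ℝ} (ht : t ∈ Set.Icc 0 T) {w : CSpace d} (hw : K ∈ 𝓝 w) :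
    DifferentiableAt ℂ (φ t) w := by
  obtain ⟨O, F, hO, hwO, hF, he⟩ := hφ.exists_holomorphic_extension hU hV (mem_of_mem_nhds hw) ht
  refine (hF.differentiableAt (hO.mem_nhds hwO)).congr_of_eventuallyEq ?_
  filter_upwards [hO.mem_nhds hwO, hw] with z h2 h3
  exact (he z ⟨h2, h3⟩).symm

theorem IsFlowOn.analyticAt (hU : IsOpen U) (hV : DifferentiableOn ℂ V U)
    (hφ : IsFlowOn V U K T φ) {t : ℝ} (ht : t ∈ Set.Icc 0 T) {w : CSpace d} (hw : K ∈ 𝓝 w) :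
    AnalyticAt ℂ (φ t) w :=
  analyticOnNhd_of_differentiableOn (isOpen_interior (s := K))
    (fun _ hz => (hφ.differentiableAt hU hV ht (mem_interior_iff_mem_nhds.1
      hz)).differentiableWithinAt) w (mem_interior_iff_mem_nhds.2 hw)

end Flow

/-! ### Vanishing order at a point -/

section Vanishing

variable {d : ℕ} {p : CSpace d} {F : Type} [NormedAddCommGroup F]

/-- `h` vanishes at `p` to order `k`. -/
def VanishTo (p : CSpace d) (k : ℕ) (h : CSpace d → F) : Prop :=
  h =O[𝓝 p] fun z => ‖z - p‖ ^ k

theorem VanishTo.mono {k l : ℕ} {h : CSpace d → F} (hh : VanishTo p k h) (hl : l ≤ k) :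
    VanishTo p l h := by
  refine hh.trans (Asymptotics.IsBigO.of_bound 1 ?_)
  filter_upwards [Metric.ball_mem_nhds p one_pos] with z hz
  rw [mem_ball_iff_norm] at hz
  rw [norm_pow, norm_pow, norm_norm, one_mul]
  exact pow_le_pow_of_le_one (norm_nonneg _) hz.le hl

theorem VanishTo.add {k : ℕ} {g h : CSpace d → F} (hg : VanishTo p k g) (hh : VanishTo p k h) :
    VanishTo p k fun z => g z + h z :=
  Asymptotics.IsBigO.add hg hh

theorem VanishTo.sub {k : ℕ} {g h : CSpace d → F} (hg : VanishTo p k g) (hh : VanishTo p k h) :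
    VanishTo p k fun z => g z - h z :=
  Asymptotics.IsBigO.sub hg hh

theorem VanishTo.const_smul [NormedSpace ℂ F] {k : ℕ} {g : CSpace d → F} (hg : VanishTo p k g) (c : ℂ) :
    VanishTo p k fun z => c • g z :=
  Asymptotics.IsBigO.const_smul_left hg c

theorem vanishTo_sum {ι : Type*} {k : ℕ} {g : ι → CSpace d → F} (s : Finset ι)
    (hg : ∀ i ∈ s, VanishTo p k (g i)) : VanishTo p k fun z => ∑ i ∈ s, g i z :=
  Asymptotics.IsBigO.fun_sum hg

theorem VanishTo.congr {k : ℕ} {g h : CSpace d → F} (hg : VanishTo p k g) (hgh : g =ᶠ[𝓝 p] h) :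
    VanishTo p k h :=
  Asymptotics.IsBigO.congr' hg hgh EventuallyEq.rfl

theorem VanishTo.mul {k l : ℕ} {g h : CSpace d → ℂ} (hg : VanishTo p k g) (hh : VanishTo p l h) :
    VanishTo p (k + l) fun z => g z * h z := by
  simpa only [VanishTo, pow_add] using Asymptotics.IsBigO.mul hg hh

theorem vanishTo_zero_of_continuousAt {h : CSpace d → F} (hh : ContinuousAt h p) :
    VanishTo p 0 h := by
  simpa [VanishTo] using hh.norm.isBoundedUnder_le.isBigO_one ℝ

theorem vanishTo_one_of_differentiableAt [NormedSpace ℂ F] {h : CSpace d → F} (hh : DifferentiableAt ℂ h p)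
    (h0 : h p = 0) : VanishTo p 1 h := by
  have := hh.hasFDerivAt.isBigO_sub
  simp only [h0, sub_zero] at this
  simpa [VanishTo] using this.norm_right

theorem VanishTo.eq_zero {k : ℕ} {h : CSpace d → F} (hh : VanishTo p (k + 1) h) : h p = 0 := by
  obtain ⟨C, hC⟩ := Asymptotics.IsBigO.bound hh
  simpa using hC.self_of_nhds

theorem VanishTo.comp {r k : ℕ} {f : CSpace r → CSpace d} {q : CSpace r} {h : CSpace d → F}
    (hf : DifferentiableAt ℂ f q) (hfq : f q = p) (hh : VanishTo p k h) :
    VanishTo q k fun z => h (f z) := by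
  subst hfq
  have h1 : (fun z => h (f z)) =O[𝓝 q] fun z => ‖f z - f q‖ ^ k :=
    Asymptotics.IsBigO.comp_tendsto hh hf.continuousAt.tendsto
  exact h1.trans (((hf.hasFDerivAt.isBigO_sub).norm_norm).pow k)

/-- Cauchy's estimate with radius $\|z-p\|$: the slightly larger ball used lies within distance
$3\|z-p\|$ of $p$, so dividing $(3\|z-p\|)^{k+1}$ by the radius costs one order. At $z=p$ this
radius is zero and the derivative is computed directly. -/
theorem VanishTo.fderiv [NormedSpace ℂ F] [CompleteSpace F] {k : ℕ} {h : CSpace d → F}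
    (ha : AnalyticAt ℂ h p) (hh : VanishTo p (k + 1) h) : VanishTo p k (fderiv ℂ h) := by
  obtain ⟨C, hC0, hC⟩ := Asymptotics.IsBigO.exists_pos hh
  have h0 : ‖_root_.fderiv ℂ h p‖ ≤ C * 3 ^ (k + 1) * ‖‖p - p‖ ^ k‖ := by
    rcases Nat.eq_zero_or_pos k with rfl | hk
    · have h1 : ‖_root_.fderiv ℂ h p‖ ≤ C := by
        refine HasFDerivAt.le_of_lip' ha.differentiableAt.hasFDerivAt hC0.le ?_
        filter_upwards [hC.bound] with z hz
        simpa [hh.eq_zero] using hz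
      simpa using h1.trans (by linarith)
    · have hd : HasFDerivAt (𝕜 := ℂ) h 0 p := Asymptotics.IsBigO.hasFDerivAt hh (by omega)
      simp [hd.fderiv, hk.ne']
  obtain ⟨ε, hε, hball⟩ := Metric.eventually_nhds_iff_ball.1
    (hC.bound.and ha.eventually_analyticAt)
  refine Asymptotics.IsBigO.of_bound (C * 3 ^ (k + 1)) ?_
  filter_upwards [Metric.ball_mem_nhds p (show 0 < ε / 3 by positivity)] with z hz
  rcases eq_or_ne z p with rfl | hzp
  · exact h0
  have hR : 0 < ‖z - p‖ := norm_pos_iff.2 (sub_ne_zero.2 hzp)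
  rw [mem_ball_iff_norm] at hz
  have hsub : ∀ y ∈ Metric.ball z (2 * ‖z - p‖), ‖y - p‖ < 3 * ‖z - p‖ := by
    intro y hy
    rw [mem_ball_iff_norm] at hy
    calc ‖y - p‖ = ‖(y - z) + (z - p)‖ := by congr 1; abel
      _ ≤ ‖y - z‖ + ‖z - p‖ := norm_add_le _ _
      _ < 3 * ‖z - p‖ := by linarith
  have hin : ∀ y ∈ Metric.ball z (2 * ‖z - p‖), y ∈ Metric.ball p ε := fun y hy => by
    rw [mem_ball_iff_norm]; linarith [hsub y hy]
  have := norm_fderiv_le (f := h) (x := z) (M := C * (3 * ‖z - p‖) ^ (k + 1)) hR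
    (by linarith : ‖z - p‖ < 2 * ‖z - p‖)
    (fun y hy => (hball y (hin y hy)).2.differentiableAt.differentiableWithinAt) (fun y hy => by
      have h1 := (hball y (hin y hy)).1
      rw [norm_pow, norm_norm] at h1
      exact h1.trans (by gcongr; exact (hsub y hy).le))
  refine this.trans (le_of_eq ?_)
  rw [norm_pow, norm_norm, mul_pow, pow_succ ‖z - p‖]
  field_simp

/-- The converse of `VanishTo.fderiv`, by the mean value inequality on the ball of radius $\|z-p\|$
about $p$. -/
theorem vanishTo_succ_of_fderiv [NormedSpace ℂ F] [CompleteSpace F] {k : ℕ} {h : CSpace d → F} (ha : AnalyticAt ℂ h p)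
    (hh : VanishTo p k (_root_.fderiv ℂ h)) (h0 : h p = 0) : VanishTo p (k + 1) h := by
  obtain ⟨C, hC0, hC⟩ := Asymptotics.IsBigO.exists_pos hh
  obtain ⟨ε, hε, hball⟩ := Metric.eventually_nhds_iff_ball.1
    (hC.bound.and ha.eventually_analyticAt)
  refine Asymptotics.IsBigO.of_bound C ?_
  filter_upwards [Metric.ball_mem_nhds p hε] with z hz
  rw [mem_ball_iff_norm] at hz
  have hsub : Metric.closedBall p ‖z - p‖ ⊆ Metric.ball p ε := Metric.closedBall_subset_ball hz
  have := Convex.norm_image_sub_le_of_norm_fderiv_le (𝕜 := ℂ) (f := h) (C := C * ‖z - p‖ ^ k)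
    (s := Metric.closedBall p ‖z - p‖) (x := p) (y := z)
    (fun y hy => (hball y (hsub hy)).2.differentiableAt) (fun y hy => by
      have h1 := (hball y (hsub hy)).1
      rw [norm_pow, norm_norm] at h1
      rw [mem_closedBall_iff_norm] at hy
      exact h1.trans (by gcongr)) (convex_closedBall _ _) (by simp) (by
        rw [mem_closedBall_iff_norm])
  rw [h0, sub_zero] at this
  rw [norm_pow, norm_norm, pow_succ, ← mul_assoc]
  exact this

theorem VanishTo.pderiv {k : ℕ} {h : CSpace d → ℂ} (ha : AnalyticAt ℂ h p)
    (hh : VanishTo p (k + 1) h) (i : Fin d) : VanishTo p k (pderiv i h) := by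
  refine Asymptotics.IsBigO.trans ?_ (hh.fderiv ha)
  refine Asymptotics.IsBigO.of_bound 1 (Eventually.of_forall fun z => ?_)
  rw [one_mul]
  refine (ContinuousLinearMap.le_opNorm _ _).trans ?_
  simp

theorem VanishTo.pderiv_iterate {k : ℕ} (n : ℕ) {h : CSpace d → ℂ} (ha : AnalyticAt ℂ h p)
    (hh : VanishTo p (n + k) h) (i : Fin d) :
    VanishTo p k ((FockPushforward.pderiv i)^[n] h) := by
  induction n generalizing k with
  | zero => simpa using hh
  | succ n ih =>
    rw [Function.iterate_succ', Function.comp_apply]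
    exact VanishTo.pderiv ((germLinear_iterate p i n).an h ha)
      (ih (k := k + 1) (hh.mono (by omega))) i

theorem VanishTo.multiDeriv {k : ℕ} (α : Fin d → ℕ) {h : CSpace d → ℂ} (ha : AnalyticAt ℂ h p)
    (hh : VanishTo p (∑ i, α i + k) h) : VanishTo p k (multiDeriv α h) := by
  have hl : ∀ (l : List (Fin d)) (k : ℕ), VanishTo p ((l.map α).sum + k) h →
      AnalyticAt ℂ (l.foldr (fun i g => (FockPushforward.pderiv i)^[α i] g) h) p ∧
      VanishTo p k (l.foldr (fun i g => (FockPushforward.pderiv i)^[α i] g) h) := by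
    intro l
    induction l with
    | nil => intro k hk; exact ⟨ha, by simpa using hk⟩
    | cons i l ih =>
      intro k hk
      have h1 := ih (α i + k) (hk.mono (by simp; omega))
      exact ⟨(germLinear_iterate p i (α i)).an _ h1.1, h1.2.pderiv_iterate (α i) h1.1 i⟩
  refine (hl (List.finRange d) k ?_).2
  rwa [← List.ofFn_eq_map, List.sum_ofFn]

/-- Each $\partial^\alpha$ lowers the vanishing order by $|\alpha|\le m$, leaving at least order
one. Thus functionals of order $m$ only see $m$-jets. -/
theorem jetFunctional_eq_zero {m : ℕ} {ℓ : Module.Dual ℂ (Hol {p})} (hℓ : ℓ ∈ jetFunctionals p m)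
    (h : Hol {p}) (hh : VanishTo p (m + 1) h.1) : ℓ h = 0 := by
  induction hℓ using Submodule.span_induction with
  | mem x hx =>
    obtain ⟨α, rfl⟩ := hx
    refine (VanishTo.multiDeriv (k := m - ∑ i, α.1 i + 1) α.1 (h.2 p rfl)
      (hh.mono ?_)).eq_zero
    have := α.2
    omega
  | zero => rfl
  | add x y _ _ hx hy => simp [hx, hy]
  | smul c x _ hx => simp [hx]

end Vanishing

/-! ### Continuity of jet functionals -/

section Bounded

variable {d : ℕ} {p : CSpace d}

/-- Operators on holomorphic functions satisfying Cauchy estimates on balls around `p`. -/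
def CauchyBounded (p : CSpace d) (D : (CSpace d → ℂ) → (CSpace d → ℂ)) : Prop :=
  ∀ r' r : ℝ, 0 < r' → r' < r → ∃ C : ℝ, 0 ≤ C ∧ ∀ (h : CSpace d → ℂ) (M : ℝ),
    DifferentiableOn ℂ h (Metric.ball p r) → (∀ z ∈ Metric.ball p r, ‖h z‖ ≤ M) →
      DifferentiableOn ℂ (D h) (Metric.ball p r') ∧ ∀ z ∈ Metric.ball p r', ‖D h z‖ ≤ C * M

theorem cauchyBounded_id : CauchyBounded p fun h => h := fun _ _ _ hr =>
  ⟨1, zero_le_one, fun _ _ hh hM => ⟨hh.mono (Metric.ball_subset_ball hr.le), fun z hz => by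
    simpa using hM z (Metric.ball_subset_ball hr.le hz)⟩⟩

theorem CauchyBounded.comp {D D' : (CSpace d → ℂ) → (CSpace d → ℂ)} (hD : CauchyBounded p D)
    (hD' : CauchyBounded p D') : CauchyBounded p fun h => D (D' h) := by
  intro r' r hr' hr
  obtain ⟨s, h1, h2⟩ := exists_between hr
  obtain ⟨C, hC, hCD⟩ := hD r' s hr' h1
  obtain ⟨C', hC', hCD'⟩ := hD' s r (hr'.trans h1) h2
  refine ⟨C * C', by positivity, fun h M hh hM => ?_⟩
  have := hCD' h M hh hM
  simpa [mul_assoc] using hCD _ _ this.1 this.2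

theorem cauchyBounded_pderiv (i : Fin d) : CauchyBounded p (pderiv i) := by
  intro r' r hr' hr
  have hρ : 0 < (r - r') / 2 := by linarith
  refine ⟨((r - r') / 2)⁻¹, by positivity, fun h M hh hM => ⟨?_, fun z hz => ?_⟩⟩
  · have h1 := (differentiableOn_fderiv Metric.isOpen_ball hh).mono
      (Metric.ball_subset_ball hr.le)
    exact fun z hz => (h1 z hz).clm_apply (differentiableWithinAt_const _)
  · have hin : ∀ s : ℂ, ‖s‖ ≤ (r - r') / 2 →
        z + s • EuclideanSpace.single i (1 : ℂ) ∈ Metric.ball p r := by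
      intro s hs
      rw [mem_ball_iff_norm] at hz ⊢
      calc ‖z + s • EuclideanSpace.single i (1 : ℂ) - p‖
          = ‖(z - p) + s • EuclideanSpace.single i (1 : ℂ)‖ := by congr 1; abel
        _ ≤ ‖z - p‖ + ‖s‖ := (norm_add_le _ _).trans (by rw [norm_smul]; simp)
        _ < r := by linarith
    have := norm_fderiv_apply_le (f := h) (x := z) (v := EuclideanSpace.single i (1 : ℂ)) hρ
      (fun s hs => hh.differentiableAt (Metric.isOpen_ball.mem_nhds (hin s hs)))
      (fun s hs => hM _ (hin s hs))
    rwa [div_eq_inv_mul] at this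

theorem cauchyBounded_multiDeriv (α : Fin d → ℕ) : CauchyBounded p (multiDeriv α) := by
  have hit : ∀ (i : Fin d) (n : ℕ), CauchyBounded p ((pderiv i)^[n]) := by
    intro i n
    induction n with
    | zero => exact cauchyBounded_id
    | succ n ih =>
      have := (cauchyBounded_pderiv (p := p) i).comp ih
      simpa only [Function.iterate_succ', Function.comp_def] using this
  have hl : ∀ l : List (Fin d),
      CauchyBounded p (fun h => l.foldr (fun i g => (pderiv i)^[α i] g) h) := by
    intro l
    induction l with
    | nil => exact cauchyBounded_id
    | cons i l ih => exact (hit i (α i)).comp ih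
  exact hl _

/-- Continuity for the supremum norm on a ball, which lets coordinates of germs pass to limits of
difference quotients, both in a parameter $\zeta$ and in time. -/
theorem exists_bound_jetFunctional {m : ℕ} {ℓ : Module.Dual ℂ (Hol {p})}
    (hℓ : ℓ ∈ jetFunctionals p m) {r : ℝ} (hr : 0 < r) : ∃ C : ℝ, 0 ≤ C ∧
      ∀ (h : Hol {p}) (M : ℝ), DifferentiableOn ℂ h.1 (Metric.ball p r) →
        (∀ z ∈ Metric.ball p r, ‖h.1 z‖ ≤ M) → ‖ℓ h‖ ≤ C * M := by
  induction hℓ using Submodule.span_induction with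
  | mem x hx =>
    obtain ⟨α, rfl⟩ := hx
    obtain ⟨C, hC, h⟩ := cauchyBounded_multiDeriv (p := p) α.1 (r / 2) r (by linarith) (by linarith)
    exact ⟨C, hC, fun g M h1 h2 => (h g.1 M h1 h2).2 p (Metric.mem_ball_self (by linarith))⟩
  | zero => exact ⟨0, le_rfl, by simp⟩
  | add x y _ _ hx hy =>
    obtain ⟨C, hC, h⟩ := hx
    obtain ⟨C', hC', h'⟩ := hy
    refine ⟨C + C', by positivity, fun g M h1 h2 => ?_⟩
    rw [LinearMap.add_apply, add_mul]
    exact (norm_add_le _ _).trans (add_le_add (h g M h1 h2) (h' g M h1 h2))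
  | smul c x _ hx =>
    obtain ⟨C, hC, h⟩ := hx
    refine ⟨‖c‖ * C, by positivity, fun g M h1 h2 => ?_⟩
    rw [LinearMap.smul_apply, norm_smul, mul_assoc]
    exact mul_le_mul_of_nonneg_left (h g M h1 h2) (norm_nonneg _)

end Bounded

/-! ### Taylor expansion in the functions `u_{p,α}` -/

section Taylor

variable {d : ℕ} {p : CSpace d}

theorem differentiable_mono (p : CSpace d) (α : Fin d → ℕ) :
    Differentiable ℂ fun z => mono (z - p) α := by
  unfold mono
  fun_prop

theorem differentiable_expFun (ζ : CSpace d) : Differentiable ℂ (expFun ζ) :=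
  fun z => (analyticAt_expFun ζ z).differentiableAt

theorem differentiable_u (p : CSpace d) (α : Fin d → ℕ) : Differentiable ℂ (u p α) :=
  ((differentiable_mono p α).const_mul _).mul (differentiable_expFun p)

theorem analyticAt_of_differentiable {f : CSpace d → ℂ} (hf : Differentiable ℂ f) (z : CSpace d) :
    AnalyticAt ℂ f z :=
  analyticOnNhd_of_differentiableOn isOpen_univ hf.differentiableOn z (Set.mem_univ z)

theorem analyticAt_u (p : CSpace d) (α : Fin d → ℕ) (z : CSpace d) : AnalyticAt ℂ (u p α) z :=
  analyticAt_of_differentiable (differentiable_u p α) z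

theorem coord_sub_mul_mem {k : ℕ} (j : Fin d) {g : CSpace d → ℂ} (hg : g ∈ polySpan p k) :
    (fun z => (z - p) j * g z) ∈ polySpan p (k + 1) := by
  convert Submodule.sub_mem _ (coord_mul_mem j hg)
    (Submodule.smul_mem _ (p j) (polySpan_mono p (Nat.le_succ k) hg)) using 1
  funext z
  simp [sub_mul]

theorem prod_coord_mem {ι : Type*} (s : Finset ι) (r : ι → Fin d) :
    (fun z => ∏ i ∈ s, (z - p) (r i)) ∈ polySpan p s.card := by
  classical
  induction s using Finset.induction_on with
  | empty => simpa using const_mem p 0 1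
  | insert i s hi ih =>
    rw [Finset.card_insert_of_notMem hi]
    simpa only [Finset.prod_insert hi] using coord_sub_mul_mem (r i) ih

/-- Expanding $z-p$ in the standard basis in each slot turns the homogeneous part of a power series
into a combination of monomials. -/
theorem multilinear_diag_mem {k : ℕ} (q : ContinuousMultilinearMap ℂ (fun _ : Fin k => CSpace d) ℂ) :
    (fun z => q fun _ => z - p) ∈ polySpan p k := by
  have h : (fun z => q fun _ => z - p) = ∑ r : Fin k → Fin d,
      (q fun i => EuclideanSpace.single (r i) 1) • fun z => ∏ i, (z - p) (r i) := by
    funext z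
    have h1 : z - p = ∑ j, (z - p) j • EuclideanSpace.single j (1 : ℂ) := by
      ext i
      simp [Pi.single_apply]
    conv_lhs => rw [h1]
    rw [q.map_sum]
    simp only [Finset.sum_apply, Pi.smul_apply, smul_eq_mul]
    refine Finset.sum_congr rfl fun r _ => ?_
    rw [q.map_smul_univ, smul_eq_mul, mul_comm]
  rw [h]
  refine Submodule.sum_mem _ fun r _ => Submodule.smul_mem _ _ ?_
  simpa using prod_coord_mem Finset.univ r

/-- The functions $u_{p,\alpha}$ are monomials times $e^{p^*z}$, so the Taylor polynomial is taken
for $h\,e^{-p^*z}$ and multiplied back. -/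
theorem exists_taylor {h : CSpace d → ℂ} (hh : AnalyticAt ℂ h p) (m : ℕ) :
    ∃ a : MultiIdx d m → ℂ, VanishTo p (m + 1) fun z => h z - ∑ α, a α * u p α.1 z := by
  have hg : AnalyticAt ℂ (fun z => h z * expFun (-p) z) p := hh.mul (analyticAt_expFun _ _)
  obtain ⟨q, hq⟩ := hg
  have hb := hq.isBigO_sub_partialSum_pow (m + 1)
  have hmem : (fun z => q.partialSum (m + 1) (z - p)) ∈ polySpan p m := by
    have : (fun z => q.partialSum (m + 1) (z - p)) =
        ∑ k ∈ Finset.range (m + 1), fun z => q k fun _ => z - p := by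
      funext z; simp [FormalMultilinearSeries.partialSum]
    rw [this]
    exact Submodule.sum_mem _ fun k hk =>
      polySpan_mono p (Nat.lt_succ_iff.1 (Finset.mem_range.1 hk)) (multilinear_diag_mem (q k))
  obtain ⟨a, ha⟩ := exists_u_coords p hmem
  refine ⟨a, ?_⟩
  have h1 : VanishTo p (m + 1) fun z => h z * expFun (-p) z - q.partialSum (m + 1) (z - p) := by
    have ht : Tendsto (fun z : CSpace d => z - p) (𝓝 p) (𝓝 0) := by
      have : ContinuousAt (fun z : CSpace d => z - p) p := by fun_prop
      simpa [ContinuousAt] using this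
    have := hb.comp_tendsto ht
    simpa [Function.comp_def, VanishTo] using this
  have h2 := h1.mul (vanishTo_zero_of_continuousAt (analyticAt_expFun p p).continuousAt)
  refine h2.congr (Eventually.of_forall fun z => ?_)
  have h3 := congrFun ha z
  simp only [Finset.sum_apply, Pi.smul_apply, smul_eq_mul] at h3
  simp only [sub_mul, ← h3]
  have : expFun (-p) z * expFun p z = 1 := by
    rw [expFun, expFun, ← Complex.exp_add]; simp
  rw [mul_assoc, this, mul_one]

theorem sum_multiIdx {M : Type*} [AddCommMonoid M] (m : ℕ) (F : (Fin d → ℕ) → M) :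
    ∑ β : MultiIdx d m, F β.1 =
      ∑ k ∈ Finset.range (m + 1), ∑ β ∈ Finset.piAntidiag Finset.univ k, F β := by
  rw [← Finset.sum_fiberwise_of_maps_to (s := (Finset.univ : Finset (MultiIdx d m)))
    (t := Finset.range (m + 1)) (g := fun β => ∑ i, β.1 i)
    (fun β _ => Finset.mem_range.2 (Nat.lt_succ_of_le β.2))]
  refine Finset.sum_congr rfl fun k hk => ?_
  refine Finset.sum_bij (fun β _ => β.1) ?_ ?_ ?_ ?_
  · intro β hβ
    simpa using (Finset.mem_filter.1 hβ).2
  · intro β _ β' _ h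
    exact Subtype.ext h
  · intro β hβ
    have hβ' : ∑ i, β i = k := by simpa using hβ
    have hk' := Finset.mem_range.1 hk
    exact ⟨⟨β, by omega⟩, by simpa using hβ', rfl⟩
  · intro β _
    rfl

/-- The multinomial theorem, one length $k=|\beta|$ at a time. -/
theorem sum_mono_mul_mono (m : ℕ) (a b : CSpace d) :
    ∑ β : MultiIdx d m, ((multiFactorial β.1 : ℝ) : ℂ)⁻¹ * (mono a β.1 * mono b β.1) =
      ∑ k ∈ Finset.range (m + 1), (∑ i, a i * b i) ^ k / (k.factorial : ℂ) := by
  rw [sum_multiIdx m fun β => ((multiFactorial β : ℝ) : ℂ)⁻¹ * (mono a β * mono b β)]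
  refine Finset.sum_congr rfl fun k _ => ?_
  rw [Finset.sum_pow_eq_sum_piAntidiag, Finset.sum_div]
  refine Finset.sum_congr rfl fun β hβ => ?_
  have h1 := Nat.multinomial_spec Finset.univ β
  rw [(Finset.mem_piAntidiag.1 hβ).1] at h1
  have h2 : ((multiFactorial β : ℝ) : ℂ) * (Nat.multinomial Finset.univ β : ℂ) =
      (k.factorial : ℂ) := by
    rw [← h1]; push_cast [multiFactorial]; rfl
  have h3 : ((multiFactorial β : ℝ) : ℂ) ≠ 0 := by
    have : 0 < multiFactorial β := Finset.prod_pos fun i _ => Nat.factorial_pos _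
    exact_mod_cast this.ne'
  have h4 : (k.factorial : ℂ) ≠ 0 := by exact_mod_cast k.factorial_ne_zero
  simp only [mono, mul_pow, Finset.prod_mul_distrib]
  field_simp
  rw [← h2]
  ring

theorem conj_mono (z : CSpace d) (α : Fin d → ℕ) :
    conj (mono z α) = mono (WithLp.toLp 2 fun i => conj (z i)) α := by
  simp [mono, map_prod]

theorem conj_u_mul_u (α : Fin d → ℕ) (ζ z : CSpace d) :
    conj (u p α ζ) * u p α z = Complex.exp (-(‖p‖ : ℂ) ^ 2) * expFun ζ p * expFun p z *
      (((multiFactorial α : ℝ) : ℂ)⁻¹ * (conj (mono (ζ - p) α) * mono (z - p) α)) := by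
  have h1 : ((Real.exp (-‖p‖ ^ 2 / 2) / √(multiFactorial α : ℝ) : ℝ) : ℂ) *
      ((Real.exp (-‖p‖ ^ 2 / 2) / √(multiFactorial α : ℝ) : ℝ) : ℂ) =
      Complex.exp (-(‖p‖ : ℂ) ^ 2) * ((multiFactorial α : ℝ) : ℂ)⁻¹ := by
    rw [← Complex.ofReal_mul, div_mul_div_comm, ← Real.exp_add,
      Real.mul_self_sqrt (by positivity), div_eq_mul_inv]
    push_cast
    ring_nf
  have h2 : conj (Complex.exp (inner ℂ p ζ)) = expFun ζ p := by
    rw [← Complex.exp_conj, inner_conj_symm]; rfl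
  simp only [u, map_mul, Complex.conj_ofReal, h2]
  rw [show Complex.exp (inner ℂ p z) = expFun p z from rfl]
  calc _ = (((Real.exp (-‖p‖ ^ 2 / 2) / √(multiFactorial α : ℝ) : ℝ) : ℂ) *
      ((Real.exp (-‖p‖ ^ 2 / 2) / √(multiFactorial α : ℝ) : ℝ) : ℂ)) *
        (conj (mono (ζ - p) α) * mono (z - p) α * expFun ζ p * expFun p z) := by ring
    _ = _ := by rw [h1]; ring

/-- Truncation of the expansion `e^{ζ^* z} = ∑ conj (u_{p,β}(ζ)) u_{p,β}(z)` of the reproducing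
kernel. -/
theorem sum_conj_u_mul_u (m : ℕ) (ζ z : CSpace d) :
    ∑ β : MultiIdx d m, conj (u p β.1 ζ) * u p β.1 z =
      Complex.exp (-(‖p‖ : ℂ) ^ 2) * expFun ζ p * expFun p z *
        ∑ k ∈ Finset.range (m + 1), (inner ℂ (ζ - p) (z - p)) ^ k / (k.factorial : ℂ) := by
  simp only [conj_u_mul_u, ← Finset.mul_sum]
  congr 1
  simp only [conj_mono (ζ - p)]
  rw [sum_mono_mul_mono]
  refine Finset.sum_congr rfl fun k _ => ?_
  congr 2
  rw [PiLp.inner_apply]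
  refine Finset.sum_congr rfl fun i _ => ?_
  simp [mul_comm]

/-- Recentring at $p$: $\zeta^*z=-\|p\|^2+\zeta^*p+p^*z+(\zeta-p)^*(z-p)$. The last exponential is
the one whose partial sums occur in `sum_conj_u_mul_u`. -/
theorem expFun_eq (ζ z : CSpace d) : expFun ζ z =
    Complex.exp (-(‖p‖ : ℂ) ^ 2) * expFun ζ p * expFun p z *
      Complex.exp (inner ℂ (ζ - p) (z - p)) := by
  simp only [expFun]
  rw [← Complex.exp_add, ← Complex.exp_add, ← Complex.exp_add]
  congr 1
  have : inner ℂ p p = (‖p‖ : ℂ) ^ 2 := inner_self_eq_norm_sq_to_K p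
  simp only [inner_sub_left, inner_sub_right, this]
  ring

theorem vanishTo_expFun_sub (m : ℕ) (ζ : CSpace d) :
    VanishTo p (m + 1) fun z =>
      expFun ζ z - ∑ β : MultiIdx d m, conj (u p β.1 ζ) * u p β.1 z := by
  have h1 : VanishTo p (m + 1) fun z : CSpace d => Complex.exp (inner ℂ (ζ - p) (z - p)) -
      ∑ k ∈ Finset.range (m + 1), (inner ℂ (ζ - p) (z - p)) ^ k / (k.factorial : ℂ) := by
    refine Asymptotics.IsBigO.of_bound (‖ζ - p‖ ^ (m + 1) * Real.exp ‖ζ - p‖) ?_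
    filter_upwards [Metric.ball_mem_nhds p one_pos] with z hz
    rw [mem_ball_iff_norm] at hz
    have h2 : ‖inner ℂ (ζ - p) (z - p)‖ ≤ ‖ζ - p‖ * ‖z - p‖ := norm_inner_le_norm _ _
    have h3 : ‖inner ℂ (ζ - p) (z - p)‖ ≤ ‖ζ - p‖ :=
      h2.trans (mul_le_of_le_one_right (norm_nonneg _) hz.le)
    refine (Complex.norm_exp_sub_sum_le_norm_mul_exp _ _).trans ?_
    rw [norm_pow, norm_norm]
    calc _ ≤ (‖ζ - p‖ * ‖z - p‖) ^ (m + 1) * Real.exp ‖ζ - p‖ := by gcongr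
      _ = _ := by ring
  have h4 : ContinuousAt (fun z => Complex.exp (-(‖p‖ : ℂ) ^ 2) * expFun ζ p * expFun p z) p :=
    continuousAt_const.mul (analyticAt_expFun p p).continuousAt
  have h5 := (vanishTo_zero_of_continuousAt h4).mul h1
  rw [zero_add] at h5
  refine h5.congr (Eventually.of_forall fun z => ?_)
  simp only [sum_conj_u_mul_u]
  rw [mul_sub, ← expFun_eq]

end Taylor

/-! ### Coordinates of germs -/

section Coordinates

variable {d : ℕ} {p : CSpace d}

theorem jetFunctionals_mono (p : CSpace d) {k m : ℕ} (h : k ≤ m) :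
    jetFunctionals p k ≤ jetFunctionals p m := by
  refine Submodule.span_mono ?_
  rintro _ ⟨β, rfl⟩
  exact ⟨β.incl h, rfl⟩

/-- The functional with Fourier–Borel transform `u_{p,α}`. -/
noncomputable def coordFunctional (p : CSpace d) (α : Fin d → ℕ) : Module.Dual ℂ (Hol {p}) :=
  (exists_functional p (⟨α, le_rfl⟩ : MultiIdx d (∑ i, α i))).choose

theorem coordFunctional_mem (p : CSpace d) {α : Fin d → ℕ} {m : ℕ} (h : ∑ i, α i ≤ m) :
    coordFunctional p α ∈ jetFunctionals p m :=
  jetFunctionals_mono p h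
    (exists_functional p (⟨α, le_rfl⟩ : MultiIdx d (∑ i, α i))).choose_spec.1

theorem fourierBorel_coordFunctional (p : CSpace d) (α : Fin d → ℕ) :
    fourierBorel (coordFunctional p α) = u p α :=
  (exists_functional p (⟨α, le_rfl⟩ : MultiIdx d (∑ i, α i))).choose_spec.2

theorem coordFunctional_expHol (p : CSpace d) (α : Fin d → ℕ) (ζ : CSpace d) :
    coordFunctional p α (expHol {p} ζ) = conj (u p α ζ) := by
  have := congrArg conj (congrFun (fourierBorel_coordFunctional p α) ζ)
  simpa [fourierBorel] using this

theorem analyticOnNhd_singleton {h : CSpace d → ℂ} (hh : AnalyticAt ℂ h p) :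
    AnalyticOnNhd ℂ h {p} := by
  intro z hz
  rwa [Set.mem_singleton_iff.1 hz]

open Classical in
/-- The coordinate of the germ of `h` at `p` with respect to `u_{p,α}`. -/
noncomputable def coef (p : CSpace d) (α : Fin d → ℕ) (h : CSpace d → ℂ) : ℂ :=
  if hh : AnalyticAt ℂ h p then coordFunctional p α ⟨h, analyticOnNhd_singleton hh⟩ else 0

theorem coef_eq {h : CSpace d → ℂ} (hh : AnalyticAt ℂ h p) (α : Fin d → ℕ) :
    coef p α h = coordFunctional p α ⟨h, analyticOnNhd_singleton hh⟩ :=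
  dif_pos hh

theorem coef_sub {g h : CSpace d → ℂ} (hg : AnalyticAt ℂ g p) (hh : AnalyticAt ℂ h p)
    (α : Fin d → ℕ) : coef p α (fun z => g z - h z) = coef p α g - coef p α h := by
  have hgh : AnalyticAt ℂ (fun z => g z - h z) p := hg.sub hh
  rw [coef_eq hg, coef_eq hh, coef_eq hgh, ← map_sub]
  rfl

theorem coef_add {g h : CSpace d → ℂ} (hg : AnalyticAt ℂ g p) (hh : AnalyticAt ℂ h p)
    (α : Fin d → ℕ) : coef p α (fun z => g z + h z) = coef p α g + coef p α h := by
  have hgh : AnalyticAt ℂ (fun z => g z + h z) p := hg.add hh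
  rw [coef_eq hg, coef_eq hh, coef_eq hgh, ← map_add]
  rfl

theorem coef_const_mul {g : CSpace d → ℂ} (hg : AnalyticAt ℂ g p) (c : ℂ)
    (α : Fin d → ℕ) : coef p α (fun z => c * g z) = c * coef p α g := by
  have hcg : AnalyticAt ℂ (fun z => c * g z) p := analyticAt_const.mul hg
  rw [coef_eq hg, coef_eq hcg, ← smul_eq_mul, ← map_smul]
  rfl

theorem coef_zero (α : Fin d → ℕ) : coef p α (fun _ => 0) = 0 := by
  rw [coef_eq analyticAt_const]
  exact map_zero _

theorem coef_sum {ι : Type*} (s : Finset ι) {g : ι → CSpace d → ℂ}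
    (hg : ∀ i, AnalyticAt ℂ (g i) p) (c : ι → ℂ) (α : Fin d → ℕ) :
    coef p α (fun z => ∑ i ∈ s, c i * g i z) = ∑ i ∈ s, c i * coef p α (g i) := by
  classical
  induction s using Finset.induction_on with
  | empty => simpa using coef_zero α
  | insert i s hi ih =>
    simp only [Finset.sum_insert hi]
    have h1 : ∀ j, AnalyticAt ℂ (fun z => c j * g j z) p := fun j => analyticAt_const.mul (hg j)
    rw [coef_add (h1 i) (Finset.analyticAt_fun_sum s fun j _ => h1 j), coef_const_mul (hg i), ih]

theorem coef_eq_of_vanishTo {g h : CSpace d → ℂ} (hg : AnalyticAt ℂ g p) (hh : AnalyticAt ℂ h p)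
    {m : ℕ} (hgh : VanishTo p (m + 1) fun z => g z - h z) {α : Fin d → ℕ} (hα : ∑ i, α i ≤ m) :
    coef p α g = coef p α h := by
  have hgh' : AnalyticAt ℂ (fun z => g z - h z) p := hg.sub hh
  rw [← sub_eq_zero, ← coef_sub hg hh, coef_eq hgh']
  exact jetFunctional_eq_zero (coordFunctional_mem p hα) _ hgh

theorem coef_expFun (α : Fin d → ℕ) (ζ : CSpace d) : coef p α (expFun ζ) = conj (u p α ζ) := by
  rw [coef_eq (analyticAt_expFun ζ p)]
  exact coordFunctional_expHol p α ζ

theorem analyticAt_u_comp {r : ℕ} {q : CSpace r} {f : CSpace r → CSpace d}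
    (hf : AnalyticAt ℂ f q) (β : Fin d → ℕ) : AnalyticAt ℂ (fun z => u p β (f z)) q :=
  (analyticAt_u p β (f q)).comp hf

/-- The kernel expansion may be truncated at order $m$ before composing with $f$, because
composition with a map fixing $p$ preserves the vanishing order. -/
theorem coef_expFun_comp {f : CSpace d → CSpace d} (hf : AnalyticAt ℂ f p) (hfp : f p = p)
    {m : ℕ} {α : Fin d → ℕ} (hα : ∑ i, α i ≤ m) (ζ : CSpace d) :
    coef p α (fun z => expFun ζ (f z)) =
      ∑ β : MultiIdx d m, conj (u p β.1 ζ) * coef p α (fun z => u p β.1 (f z)) := by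
  have h1 : AnalyticAt ℂ (fun z => expFun ζ (f z)) p := (analyticAt_expFun ζ (f p)).comp hf
  have h2 : ∀ β : MultiIdx d m, AnalyticAt ℂ (fun z => u p β.1 (f z)) p :=
    fun β => analyticAt_u_comp hf β.1
  rw [← coef_sum Finset.univ h2]
  refine coef_eq_of_vanishTo h1
    (Finset.analyticAt_fun_sum _ fun β _ => analyticAt_const.mul (h2 β)) ?_ hα
  exact (vanishTo_expFun_sub m ζ).comp hf.differentiableAt hfp

/-- Linear independence of the $u_{p,\beta}$ as functions of $\zeta$ allows coefficients to be
compared. With $f=\mathrm{id}$ this gives the duality `coef_u`; for general $f$ it identifies the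
push-forward matrix. -/
theorem eq_coef_of_expFun {f : CSpace d → CSpace d} (hf : AnalyticAt ℂ f p) (hfp : f p = p)
    {m : ℕ} {α : Fin d → ℕ} (hα : ∑ i, α i ≤ m) (c : MultiIdx d m → ℂ)
    (hc : ∀ ζ, coef p α (fun z => expFun ζ (f z)) = ∑ β, conj (u p β.1 ζ) * c β)
    (β : MultiIdx d m) : c β = coef p α fun z => u p β.1 (f z) := by
  have := u_independent p (fun β => conj (c β) - conj (coef p α fun z => u p β.1 (f z))) (by
    funext ζ
    have h1 := (hc ζ).symm.trans (coef_expFun_comp hf hfp hα ζ)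
    have h2 := congrArg conj h1
    simp only [map_sum, map_mul, Complex.conj_conj] at h2
    simp only [sub_smul, Finset.sum_sub_distrib, Finset.sum_apply, Pi.sub_apply, Pi.smul_apply,
      smul_eq_mul, Pi.zero_apply]
    rw [sub_eq_zero]
    simpa only [mul_comm] using h2)
  have h := congrFun this β
  exact (starRingEnd ℂ).injective (sub_eq_zero.1 h)

theorem coef_u {m : ℕ} (α β : MultiIdx d m) :
    coef p α.1 (u p β.1) = if α = β then 1 else 0 := by
  have hid : AnalyticAt ℂ (fun z : CSpace d => z) p := analyticAt_id
  have := eq_coef_of_expFun (f := fun z => z) hid rfl α.2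
    (fun β => if α = β then (1 : ℂ) else 0) (fun ζ => by
      rw [Finset.sum_eq_single α (fun b _ hb => by rw [if_neg hb.symm, mul_zero])
        (fun h => absurd (Finset.mem_univ α) h), if_pos rfl, mul_one]
      exact coef_expFun α.1 ζ) β
  exact this.symm

theorem coef_sum_u {m : ℕ} (a : MultiIdx d m → ℂ) (α : MultiIdx d m) :
    coef p α.1 (fun z => ∑ β, a β * u p β.1 z) = a α := by
  rw [coef_sum Finset.univ (g := fun β : MultiIdx d m => u p β.1)
    (fun β => analyticAt_u p β.1 p)]
  simp [coef_u]

theorem analyticAt_sum_u {m : ℕ} (a : MultiIdx d m → ℂ) (z : CSpace d) :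
    AnalyticAt ℂ (fun z => ∑ β, a β * u p β.1 z) z :=
  Finset.analyticAt_fun_sum _ fun β _ => analyticAt_const.mul (analyticAt_u p β.1 z)

theorem coef_of_vanishTo {h : CSpace d → ℂ} (hh : AnalyticAt ℂ h p) {m : ℕ}
    {a : MultiIdx d m → ℂ} (ha : VanishTo p (m + 1) fun z => h z - ∑ β, a β * u p β.1 z)
    (α : MultiIdx d m) : coef p α.1 h = a α := by
  rw [coef_eq_of_vanishTo hh (analyticAt_sum_u a p) ha α.2, coef_sum_u]

theorem vanishTo_sub_coef {h : CSpace d → ℂ} (hh : AnalyticAt ℂ h p) (m : ℕ) :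
    VanishTo p (m + 1) fun z => h z - ∑ α : MultiIdx d m, coef p α.1 h * u p α.1 z := by
  obtain ⟨a, ha⟩ := exists_taylor hh m
  have : (fun α : MultiIdx d m => coef p α.1 h) = a := funext fun α => coef_of_vanishTo hh ha α
  simpa only [← this] using ha

theorem exists_bound_coef (p : CSpace d) (α : Fin d → ℕ) {r : ℝ} (hr : 0 < r) : ∃ C : ℝ, 0 ≤ C ∧
    ∀ (h : CSpace d → ℂ) (M : ℝ), DifferentiableOn ℂ h (Metric.ball p r) →
      (∀ z ∈ Metric.ball p r, ‖h z‖ ≤ M) → ‖coef p α h‖ ≤ C * M := by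
  obtain ⟨C, hC, hb⟩ := exists_bound_jetFunctional (coordFunctional_mem p (le_refl (∑ i, α i))) hr
  refine ⟨C, hC, fun h M hh hM => ?_⟩
  have hA : AnalyticAt ℂ h p :=
    analyticOnNhd_of_differentiableOn Metric.isOpen_ball hh p (Metric.mem_ball_self hr)
  rw [coef_eq hA]
  exact hb _ M hh hM

/-- The conjugation comes from the antilinearity of the conjugated Fourier–Borel transform: undoing
it on column $\alpha$ gives the $\alpha$-coordinate of $e^{\zeta^*f}$ expanded in
$\overline{u_{p,\beta}(\zeta)}$. -/
theorem star_pushforwardMatrix_apply {f : CSpace d → CSpace d} (hf : AnalyticAt ℂ f p)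
    (hfp : f p = p) {m : ℕ} (α β : MultiIdx d m) :
    conj (pushforwardMatrix p f m β α) = coef p α.1 fun z => u p β.1 (f z) := by
  obtain ⟨hf', hC⟩ := isPushforwardMatrix_pushforwardMatrix hf m
  refine eq_coef_of_expFun hf hfp α.2 (fun β => conj (pushforwardMatrix p f m β α))
    (fun ζ => ?_) β
  have h1 := congrFun (hC α _ (coordFunctional_mem p α.2) (fourierBorel_coordFunctional p α.1)) ζ
  have h2 := congrArg conj h1
  have hu : ∀ β, u (f p) β = u p β := fun β => by rw [hfp]
  simp only [hu, fourierBorel, Complex.conj_conj, Finset.sum_apply, Pi.smul_apply, smul_eq_mul,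
    map_sum, map_mul] at h2
  have h3 : AnalyticAt ℂ (fun z => expFun ζ (f z)) p := (analyticAt_expFun ζ (f p)).comp hf
  rw [coef_eq h3]
  simp only [mul_comm (conj (u p _ ζ))]
  rw [← h2]
  rfl

theorem norm_exp_sub_one_sub_le {w : ℂ} (hw : ‖w‖ ≤ 1) : ‖Complex.exp w - 1 - w‖ ≤ 3 * ‖w‖ ^ 2 := by
  have := Complex.norm_exp_sub_sum_le_norm_mul_exp w 2
  simp only [Finset.sum_range_succ, Finset.sum_range_zero, zero_add, pow_zero, pow_one,
    Nat.factorial_zero, Nat.factorial_one, Nat.cast_one, div_one] at this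
  rw [sub_sub]
  refine this.trans ?_
  have h1 : Real.exp ‖w‖ ≤ 3 := (Real.exp_le_exp.2 hw).trans (by linarith [Real.exp_one_lt_d9])
  nlinarith [sq_nonneg ‖w‖]

/-- The coordinates of the coordinate functions. -/
theorem coef_coord (β : Fin d → ℕ) (i : Fin d) :
    coef p β (fun z => z i) = conj (pderiv i (u p β) 0) := by
  let e : CSpace d := EuclideanSpace.single i 1
  have hcoord : AnalyticAt ℂ (fun z : CSpace d => z i) p :=
    analyticAt_of_differentiable (by fun_prop) p
  obtain ⟨C, hC, hb⟩ := exists_bound_coef p β one_pos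
  set R : ℝ := ‖p‖ + 1 with hR
  have hR0 : 0 < R := by positivity
  have hinner : ∀ (s : ℝ) (z : CSpace d), inner ℂ ((s : ℂ) • e) z = s * z i := by
    intro s z
    simp [e, EuclideanSpace.inner_single_left]
  -- The functions $s^{-1}(e^{(se_i)^*z}-1)$ converge uniformly near $p$ to $z_i$, so their
  -- coordinates converge. These coordinates are also conjugated difference quotients of
  -- $u_{p,\beta}$ at $0$; taking $s$ real keeps conjugation out of the factor $s^{-1}$.
  have hlim1 : Tendsto (fun s : ℝ => (s : ℂ)⁻¹ * (conj (u p β ((s : ℂ) • e)) - conj (u p β 0)))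
      (𝓝[>] 0) (𝓝 (coef p β fun z => z i)) := by
    rw [tendsto_iff_norm_sub_tendsto_zero]
    have hlin : Tendsto (fun s : ℝ => C * (3 * R ^ 2 * s)) (𝓝[>] 0) (𝓝 0) := by
      have : Continuous fun s : ℝ => C * (3 * R ^ 2 * s) := by fun_prop
      simpa using (this.tendsto 0).mono_left nhdsWithin_le_nhds
    refine squeeze_zero' (Eventually.of_forall fun _ => norm_nonneg _) ?_ hlin
    have hs1 : ∀ᶠ s : ℝ in 𝓝[>] 0, s < 1 / R :=
      mem_nhdsWithin_of_mem_nhds (gt_mem_nhds (by positivity))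
    filter_upwards [hs1, self_mem_nhdsWithin] with s hs hs0
    have hs0' : (0 : ℝ) < s := hs0
    have hsc : (s : ℂ) ≠ 0 := by exact_mod_cast hs0'.ne'
    have hexp : ∀ ζ : CSpace d, AnalyticAt ℂ (expFun ζ) p := fun ζ => analyticAt_expFun ζ p
    have e1 : (s : ℂ)⁻¹ * (conj (u p β ((s : ℂ) • e)) - conj (u p β 0)) - coef p β (fun z => z i)
        = coef p β fun z => (s : ℂ)⁻¹ * (expFun ((s : ℂ) • e) z - expFun 0 z) - z i := by
      have h1 : AnalyticAt ℂ (fun z => expFun ((s : ℂ) • e) z - expFun 0 z) p :=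
        (hexp _).sub (hexp _)
      have h2 : AnalyticAt ℂ (fun z => (s : ℂ)⁻¹ * (expFun ((s : ℂ) • e) z - expFun 0 z)) p :=
        analyticAt_const.mul h1
      rw [coef_sub h2 hcoord, coef_const_mul h1, coef_sub (hexp _) (hexp _), coef_expFun,
        coef_expFun]
    rw [e1]
    refine hb _ _ ?_ fun z hz => ?_
    · refine Differentiable.differentiableOn ?_
      exact (((differentiable_expFun _).sub (differentiable_expFun _)).const_mul _).sub
        (by fun_prop)
    · have hzR : ‖z i‖ ≤ R := by
        rw [mem_ball_iff_norm] at hz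
        refine (PiLp.norm_apply_le z i).trans ?_
        have := norm_le_norm_sub_add z p
        linarith
      have h2 : ‖(s : ℂ) * z i‖ ≤ s * R := by
        rw [norm_mul, Complex.norm_real, Real.norm_eq_abs, abs_of_pos hs0']
        gcongr
      have h3 : s * R ≤ 1 := by
        rw [lt_div_iff₀ hR0] at hs
        exact hs.le
      have h4 := norm_exp_sub_one_sub_le (h2.trans h3)
      have h5 : (s : ℂ)⁻¹ * (expFun ((s : ℂ) • e) z - expFun 0 z) - z i =
          (s : ℂ)⁻¹ * (Complex.exp (s * z i) - 1 - s * z i) := by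
        simp only [expFun, hinner, inner_zero_left, Complex.exp_zero]
        field_simp
      rw [h5, norm_mul, norm_inv, Complex.norm_real, Real.norm_eq_abs, abs_of_pos hs0',
        inv_mul_le_iff₀ hs0']
      calc _ ≤ 3 * ‖(s : ℂ) * z i‖ ^ 2 := h4
        _ ≤ 3 * (s * R) ^ 2 := by gcongr
        _ = _ := by ring
  have hlim2 : Tendsto (fun s : ℝ => (s : ℂ)⁻¹ * (conj (u p β ((s : ℂ) • e)) - conj (u p β 0)))
      (𝓝[>] 0) (𝓝 (conj (pderiv i (u p β) 0))) := by
    have hd : HasDerivAt (fun s : ℂ => u p β (s • e)) (pderiv i (u p β) 0) 0 := by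
      have h1 : HasDerivAt (fun s : ℂ => s • e) e 0 := by
        simpa using (hasDerivAt_id (0 : ℂ)).smul_const e
      have h2 : HasFDerivAt (u p β) (fderiv ℂ (u p β) ((0 : ℂ) • e)) ((0 : ℂ) • e) :=
        (differentiable_u p β _).hasFDerivAt
      have := h2.comp_hasDerivAt 0 h1
      rw [zero_smul] at this
      exact this
    have h1 := hd.tendsto_slope_zero
    simp only [zero_add, zero_smul, smul_eq_mul] at h1
    have h2 : Tendsto (fun s : ℝ => (s : ℂ)) (𝓝[>] 0) (𝓝[≠] 0) := by
      refine tendsto_nhdsWithin_iff.2 ⟨?_, ?_⟩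
      · have := (Complex.continuous_ofReal.tendsto 0).mono_left
          (nhdsWithin_le_nhds (s := Set.Ioi (0 : ℝ)))
        simpa using this
      · filter_upwards [self_mem_nhdsWithin] with s hs
        have : (0 : ℝ) < s := hs
        simpa using this.ne'
    have h3 := (Complex.continuous_conj.tendsto _).comp (h1.comp h2)
    refine h3.congr fun s => ?_
    simp
  exact tendsto_nhds_unique hlim1 hlim2

end Coordinates

/-! ### The Lie derivative on jets -/

section Lie

variable {d : ℕ} {p : CSpace d}

theorem analyticAt_clm_apply {g : CSpace d → CSpace d →L[ℂ] ℂ} {W : CSpace d → CSpace d}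
    (hg : AnalyticAt ℂ g p) (hW : AnalyticAt ℂ W p) : AnalyticAt ℂ (fun z => g z (W z)) p :=
  ((ContinuousLinearMap.id ℂ (CSpace d →L[ℂ] ℂ)).analyticAt_bilinear (g p, W p)).comp₂ hg hW

/-- The derivative of `h` along the vector field `V`. -/
noncomputable def lieDeriv (V : CSpace d → CSpace d) (h : CSpace d → ℂ) : CSpace d → ℂ :=
  fun z => fderiv ℂ h z (V z)

theorem analyticAt_lieDeriv {V : CSpace d → CSpace d} {h : CSpace d → ℂ}
    (hV : AnalyticAt ℂ V p) (hh : AnalyticAt ℂ h p) : AnalyticAt ℂ (lieDeriv V h) p :=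
  analyticAt_clm_apply hh.fderiv hV

theorem vanishTo_fderiv_apply {k l : ℕ} {h : CSpace d → ℂ} {W : CSpace d → CSpace d}
    (hh : VanishTo p k (fderiv ℂ h)) (hW : VanishTo p l W) :
    VanishTo p (k + l) fun z => fderiv ℂ h z (W z) := by
  have h1 : (fun z => ‖fderiv ℂ h z‖ * ‖W z‖) =O[𝓝 p] fun z => ‖z - p‖ ^ k * ‖z - p‖ ^ l :=
    hh.norm_left.mul hW.norm_left
  unfold VanishTo
  simp only [pow_add]
  refine Asymptotics.IsBigO.trans (Asymptotics.IsBigO.of_bound 1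
    (Eventually.of_forall fun z => ?_)) h1
  rw [one_mul, norm_mul, norm_norm, norm_norm]
  exact ContinuousLinearMap.le_opNorm _ _

/-- Differentiation loses one order and the zero of $V$ at $p$ restores it; this is why the Lie
derivative acts on $m$-jets. -/
theorem VanishTo.lieDeriv {V : CSpace d → CSpace d} {h : CSpace d → ℂ} {m : ℕ}
    (hV : AnalyticAt ℂ V p) (hVp : V p = 0) (ha : AnalyticAt ℂ h p) (hh : VanishTo p (m + 1) h) :
    VanishTo p (m + 1) (lieDeriv V h) :=
  vanishTo_fderiv_apply (hh.fderiv ha) (vanishTo_one_of_differentiableAt hV.differentiableAt hVp)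

theorem lieDeriv_sum {ι : Type*} (s : Finset ι) {g : ι → CSpace d → ℂ}
    (V : CSpace d → CSpace d) (hg : ∀ i z, DifferentiableAt ℂ (g i) z) (c : ι → ℂ) :
    lieDeriv V (fun z => ∑ i ∈ s, c i * g i z) = fun z => ∑ i ∈ s, c i * lieDeriv V (g i) z := by
  funext z
  have h1 : HasFDerivAt (fun z => ∑ i ∈ s, c i * g i z) (∑ i ∈ s, c i • fderiv ℂ (g i) z) z :=
    HasFDerivAt.fun_sum fun i _ => (hg i z).hasFDerivAt.const_mul (c i)
  simp [lieDeriv, h1.fderiv]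

theorem lieDeriv_sub_eventuallyEq {g h : CSpace d → ℂ} (V : CSpace d → CSpace d)
    (hg : AnalyticAt ℂ g p) (hh : AnalyticAt ℂ h p) :
    lieDeriv V (fun z => g z - h z) =ᶠ[𝓝 p] fun z => lieDeriv V g z - lieDeriv V h z := by
  filter_upwards [hg.eventually_analyticAt, hh.eventually_analyticAt] with z h1 h2
  simp [lieDeriv, fderiv_fun_sub h1.differentiableAt h2.differentiableAt]

/-- The matrix of the Lie derivative on `m`-jets at a zero `p` of `V`. -/
noncomputable def lieMatrix (p : CSpace d) (V : CSpace d → CSpace d) (m : ℕ) :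
    Matrix (MultiIdx d m) (MultiIdx d m) ℂ :=
  Matrix.of fun α β => coef p α.1 (lieDeriv V (u p β.1))

theorem coef_lieDeriv {V : CSpace d → CSpace d} (hV : AnalyticAt ℂ V p) (hVp : V p = 0)
    {h : CSpace d → ℂ} (hh : AnalyticAt ℂ h p) {m : ℕ} (α : MultiIdx d m) :
    coef p α.1 (lieDeriv V h) = ∑ β, lieMatrix p V m α β * coef p β.1 h := by
  have hs := analyticAt_sum_u (p := p) (fun α : MultiIdx d m => coef p α.1 h) p
  have h1 := VanishTo.lieDeriv hV hVp (hh.sub hs) (vanishTo_sub_coef hh m)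
  have h2 := h1.congr (lieDeriv_sub_eventuallyEq V hh hs)
  rw [coef_eq_of_vanishTo (analyticAt_lieDeriv hV hh) (analyticAt_lieDeriv hV hs) h2 α.2,
    lieDeriv_sum Finset.univ V fun β z => differentiable_u p _ z,
    coef_sum Finset.univ (g := fun β : MultiIdx d m => lieDeriv V (u p β.1))
      (fun β => analyticAt_lieDeriv hV (analyticAt_u p β.1 p))]
  simp [lieMatrix, mul_comm]

/-- The matrix of the composition operator `h ↦ h ∘ f` on `m`-jets at a fixed point `p` of `f`. -/
noncomputable def compMatrix (p : CSpace d) (f : CSpace d → CSpace d) (m : ℕ) :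
    Matrix (MultiIdx d m) (MultiIdx d m) ℂ :=
  Matrix.of fun α β => coef p α.1 fun z => u p β.1 (f z)

theorem conjTranspose_pushforwardMatrix {f : CSpace d → CSpace d} (hf : AnalyticAt ℂ f p)
    (hfp : f p = p) (m : ℕ) : (pushforwardMatrix p f m)ᴴ = compMatrix p f m := by
  ext α β
  exact star_pushforwardMatrix_apply hf hfp α β

theorem coef_comp {f : CSpace d → CSpace d} (hf : AnalyticAt ℂ f p) (hfp : f p = p)
    {h : CSpace d → ℂ} (hh : AnalyticAt ℂ h p) {m : ℕ} (α : MultiIdx d m) :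
    coef p α.1 (fun z => h (f z)) = ∑ β, compMatrix p f m α β * coef p β.1 h := by
  have h0 : AnalyticAt ℂ (fun z => h (f z)) p := by
    have : AnalyticAt ℂ h (f p) := by rwa [hfp]
    exact this.comp hf
  have hs : ∀ β : MultiIdx d m, AnalyticAt ℂ (fun z => u p β.1 (f z)) p :=
    fun β => analyticAt_u_comp hf β.1
  have h2 := (vanishTo_sub_coef hh m).comp hf.differentiableAt hfp
  have h3 : AnalyticAt ℂ (fun z => ∑ β : MultiIdx d m, coef p β.1 h * u p β.1 (f z)) p :=
    Finset.analyticAt_fun_sum _ fun β _ => analyticAt_const.mul (hs β)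
  rw [coef_eq_of_vanishTo h0 h3 h2 α.2,
    coef_sum Finset.univ (g := fun (β : MultiIdx d m) z => u p β.1 (f z)) hs]
  simp [compMatrix, mul_comm]

/-- Pull-back is contravariant, $(g\circ f)^*=f^*g^*$, and the matrices represent pull-backs. -/
theorem compMatrix_comp {f g : CSpace d → CSpace d} (hf : AnalyticAt ℂ f p) (hfp : f p = p)
    (hg : AnalyticAt ℂ g p) (m : ℕ) :
    compMatrix p (fun z => g (f z)) m = compMatrix p f m * compMatrix p g m := by
  ext α β
  exact coef_comp hf hfp (h := fun z => u p β.1 (g z)) (analyticAt_u_comp hg β.1) α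

theorem compMatrix_congr {f g : CSpace d → CSpace d} (hf : AnalyticAt ℂ f p)
    (hfg : f =ᶠ[𝓝 p] g) (m : ℕ) : compMatrix p f m = compMatrix p g m := by
  ext α β
  refine coef_eq_of_vanishTo (analyticAt_u_comp hf β.1)
    (analyticAt_u_comp (hf.congr hfg) β.1) (m := m) ?_ α.2
  refine VanishTo.congr (g := fun _ => 0) ?_ ?_
  · exact Asymptotics.isBigO_zero _ _
  · filter_upwards [hfg] with z hz
    rw [hz, sub_self]

theorem vanishTo_fderiv_of_apply {k : ℕ} {h : CSpace d → ℂ}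
    (hh : ∀ i : Fin d, VanishTo p k fun z => fderiv ℂ h z (EuclideanSpace.single i 1)) :
    VanishTo p k (fderiv ℂ h) := by
  have h1 : VanishTo p k fun z => ∑ i, fderiv ℂ h z (EuclideanSpace.single i 1) •
      (EuclideanSpace.proj i : CSpace d →L[ℂ] ℂ) := by
    refine vanishTo_sum Finset.univ fun i _ => ?_
    refine Asymptotics.IsBigO.trans (Asymptotics.IsBigO.of_bound
      ‖(EuclideanSpace.proj i : CSpace d →L[ℂ] ℂ)‖ (Eventually.of_forall fun z => ?_)) (hh i)
    rw [norm_smul, mul_comm]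
  refine h1.congr (Eventually.of_forall fun z => ?_)
  ext v
  have h2 : v = ∑ j, v j • EuclideanSpace.single j (1 : ℂ) := by
    ext i
    simp [Pi.single_apply]
  conv_rhs => rw [h2]
  simp [mul_comm]

theorem fderiv_fderiv_apply_comm {h : CSpace d → ℂ} {z : CSpace d} (hh : AnalyticAt ℂ h z)
    (v w : CSpace d) : fderiv ℂ (fun y => fderiv ℂ h y v) z w =
      fderiv ℂ (fun y => fderiv ℂ h y w) z v := by
  have hd := hh.fderiv.differentiableAt
  have e : ∀ v w : CSpace d, fderiv ℂ (fun y => fderiv ℂ h y v) z w =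
      fderiv ℂ (fderiv ℂ h) z w v := by
    intro v w
    rw [fderiv_clm_apply hd (differentiableAt_const v)]
    simp
  rw [e, e]
  exact (hh.contDiffAt (n := 2)).isSymmSndFDerivAt
    (by rw [minSmoothness_of_isRCLikeNormedField]) w v

/-- If a germ which does not vanish to order `k` is, up to order `k`, an eigenfunction of a linear
vector field with real eigenvalues, then its eigenvalue is real. -/
theorem im_eq_zero_of_linear_lieDeriv (L : CSpace d →L[ℂ] CSpace d)
    (hL : ∀ c : ℂ, Module.End.HasEigenvalue (L : CSpace d →ₗ[ℂ] CSpace d) c → c.im = 0) (k : ℕ) :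
    ∀ (c : ℂ) (h : CSpace d → ℂ), AnalyticAt ℂ h p →
      VanishTo p k (fun z => lieDeriv (fun z => L (z - p)) h z - c * h z) → ¬ VanishTo p k h →
      c.im = 0 := by
  induction k with
  | zero =>
    intro c h hh _ hk
    exact absurd (vanishTo_zero_of_continuousAt hh.continuousAt) hk
  | succ k ih =>
    intro c h hh hv hk
    have hLa : ∀ z : CSpace d, AnalyticAt ℂ (fun z => L (z - p)) z := fun z =>
      (L.analyticAt _).comp (analyticAt_id.sub analyticAt_const)
    -- The directions in which the derivative of $h$ vanishes to order $k$.
    let S : Submodule ℂ (CSpace d) :=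
      { carrier := {v | VanishTo p k fun z => fderiv ℂ h z v}
        add_mem' := fun {v w} hv hw => by
          simpa only [Set.mem_ofPred_eq, map_add] using hv.add hw
        zero_mem' := by
          simp only [Set.mem_ofPred_eq, map_zero]
          exact Asymptotics.isBigO_zero _ _
        smul_mem' := fun c v hv => by
          simpa only [Set.mem_ofPred_eq, map_smul] using hv.const_smul c }
    -- The eigenvalue relation differentiated along $v$: commuting $\partial_v$ with the linear
    -- field produces the extra term $\partial_{Lv}h$.
    have hder : ∀ v : CSpace d, VanishTo p k fun z =>
        lieDeriv (fun z => L (z - p)) (fun y => fderiv ℂ h y v) z + fderiv ℂ h z (L v) -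
          c * fderiv ℂ h z v := by
      intro v
      have ha : AnalyticAt ℂ (fun z => lieDeriv (fun z => L (z - p)) h z - c * h z) p :=
        (analyticAt_lieDeriv (hLa p) hh).sub (analyticAt_const.mul hh)
      have h1 := vanishTo_fderiv_apply (hv.fderiv ha) (l := 0) (W := fun _ => v)
        (vanishTo_zero_of_continuousAt continuousAt_const)
      refine h1.congr ?_
      filter_upwards [hh.eventually_analyticAt] with z hz
      have e1 : HasFDerivAt (fun z => L (z - p)) L z := by
        have := (L.hasFDerivAt (x := z - p)).comp z ((hasFDerivAt_id z).sub_const p)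
        rw [ContinuousLinearMap.comp_id] at this
        exact this
      have e2 : DifferentiableAt ℂ (fderiv ℂ h) z := hz.fderiv.differentiableAt
      have e3 : fderiv ℂ (fun z => lieDeriv (fun z => L (z - p)) h z - c * h z) z v =
          fderiv ℂ (fderiv ℂ h) z v (L (z - p)) + fderiv ℂ h z (L v) - c * fderiv ℂ h z v := by
        have e4 := (e2.hasFDerivAt.clm_apply e1).sub (hz.differentiableAt.hasFDerivAt.const_mul c)
        have e5 : fderiv ℂ (fun z => lieDeriv (fun z => L (z - p)) h z - c * h z) z = _ :=
          e4.fderiv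
        rw [e5]
        simp [add_comm]
      rw [e3]
      congr 2
      have e6 := fderiv_fderiv_apply_comm hz v (L (z - p))
      rw [lieDeriv, e6, fderiv_clm_apply e2 (differentiableAt_const _)]
      simp
    -- If every first derivative vanishes to order $k$, then $h(p)\ne0$, and evaluating the relation
    -- at $p$, where the field is zero, forces $c=0$. Otherwise some generalised eigenvector of $L$
    -- lies outside $S$.
    by_cases hS : S = ⊤
    · have h1 : VanishTo p k (fderiv ℂ h) := vanishTo_fderiv_of_apply fun i => by
        have : EuclideanSpace.single i (1 : ℂ) ∈ S := hS ▸ Submodule.mem_top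
        exact this
      have h2 : h p ≠ 0 := fun h0 => hk (vanishTo_succ_of_fderiv hh h1 h0)
      have h3 := hv.eq_zero
      simp only [lieDeriv, sub_self, map_zero, zero_sub, neg_eq_zero] at h3
      rw [(mul_eq_zero.1 h3).resolve_right h2]
      rfl
    · let f : Module.End ℂ (CSpace d) := (L : CSpace d →ₗ[ℂ] CSpace d)
      obtain ⟨μ, hμ⟩ : ∃ μ, ¬ f.maxGenEigenspace μ ≤ S := by
        by_contra! hcon
        exact hS (top_le_iff.1 ((Module.End.iSup_maxGenEigenspace_eq_top f).symm.le.trans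
          (iSup_le hcon)))
      obtain ⟨v, hv1, hv2⟩ := SetLike.not_le_iff_exists.1 hμ
      obtain ⟨n, hn⟩ := (Module.End.mem_maxGenEigenspace f μ v).1 hv1
      have hμr : μ.im = 0 := by
        refine hL μ (Module.End.HasUnifEigenvalue.lt (k := ⊤) one_pos ?_)
        intro hbot
        have : v ∈ (⊥ : Submodule ℂ (CSpace d)) := hbot ▸ hv1
        rw [Submodule.mem_bot] at this
        exact hv2 (this ▸ S.zero_mem)
      have hex : ∃ n, ((f - μ • (1 : Module.End ℂ (CSpace d))) ^ n) v ∈ S := ⟨n, hn ▸ S.zero_mem⟩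
      classical
      obtain ⟨j, hj⟩ : ∃ j, Nat.find hex = j + 1 := by
        refine Nat.exists_eq_succ_of_ne_zero fun h0 => hv2 ?_
        have := Nat.find_spec hex
        rw [h0] at this
        simpa using this
      -- The last vector of the chain $(L-\mu)^jv$ outside $S$. It is an eigenvector modulo $S$, so
      -- $\partial_wh$ is an approximate eigenfunction with eigenvalue $c-\mu$, to which the
      -- induction hypothesis applies; $\mu$ is real.
      set w := ((f - μ • (1 : Module.End ℂ (CSpace d))) ^ j) v with hw
      have hwS : w ∉ S := Nat.find_min hex (by omega)
      have hwS' : L w - μ • w ∈ S := by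
        have := Nat.find_spec hex
        rw [hj, pow_succ', Module.End.mul_apply, ← hw] at this
        exact this
      have hsub := ih (c - μ) (fun y => fderiv ℂ h y w)
        (analyticAt_clm_apply hh.fderiv analyticAt_const) ?_ hwS
      · simpa [hμr] using hsub
      · have h1 : VanishTo p k fun z => fderiv ℂ h z (L w - μ • w) := hwS'
        refine ((hder w).sub h1).congr (Eventually.of_forall fun z => ?_)
        simp only [map_sub, map_smul, smul_eq_mul]
        ring

theorem vanishTo_two_sub_linear {V : CSpace d → CSpace d} (hV : AnalyticAt ℂ V p) (hVp : V p = 0) :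
    VanishTo p 2 fun z => V z - fderiv ℂ V p (z - p) := by
  have hlin : ∀ z, HasFDerivAt (fun z => fderiv ℂ V p (z - p)) (fderiv ℂ V p) z := fun z => by
    have := ((fderiv ℂ V p).hasFDerivAt (x := z - p)).comp z ((hasFDerivAt_id z).sub_const p)
    rw [ContinuousLinearMap.comp_id] at this
    exact this
  have ha : AnalyticAt ℂ (fun z => fderiv ℂ V p (z - p)) p :=
    ((fderiv ℂ V p).analyticAt _).comp (analyticAt_id.sub analyticAt_const)
  refine vanishTo_succ_of_fderiv (hV.sub ha) ?_ (by simp [hVp])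
  have h1 : VanishTo p 1 fun z => fderiv ℂ V z - fderiv ℂ V p :=
    vanishTo_one_of_differentiableAt (hV.fderiv.differentiableAt.sub_const _) (by simp)
  refine h1.congr ?_
  filter_upwards [hV.eventually_analyticAt] with z hz
  exact ((hz.differentiableAt.hasFDerivAt.sub (hlin z)).fderiv).symm

/-- An eigenvector is the coordinate vector of a function $h$ which is an eigenfunction of $dh(V)$
up to order $m+1$. Let $k\le m$ be the exact vanishing order of $h$. Replacing $V$ by its linear
part changes $dh(V)$ only to order $k+1$, since $dh$ has order $k-1$ and $V$ minus its linear part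
has order $2$. This reduces the claim to linear fields. -/
theorem im_eq_zero_of_lieMatrix_mulVec {V : CSpace d → CSpace d} (hV : AnalyticAt ℂ V p)
    (hVp : V p = 0)
    (hreal : ∀ c : ℂ, Module.End.HasEigenvalue
      ((fderiv ℂ V p : CSpace d →L[ℂ] CSpace d) : CSpace d →ₗ[ℂ] CSpace d) c → c.im = 0)
    {m : ℕ} {c : ℂ} {a : MultiIdx d m → ℂ} (ha : a ≠ 0)
    (hc : lieMatrix p V m *ᵥ a = c • a) : c.im = 0 := by
  let h : CSpace d → ℂ := fun z => ∑ β, a β * u p β.1 z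
  have hh : AnalyticAt ℂ h p := analyticAt_sum_u a p
  have hcoef : ∀ α : MultiIdx d m, coef p α.1 h = a α := coef_sum_u a
  have hl := analyticAt_lieDeriv hV hh
  have h1 : VanishTo p (m + 1) fun z => lieDeriv V h z - c * h z := by
    refine (vanishTo_sub_coef hl m).congr (Eventually.of_forall fun z => ?_)
    simp only [coef_lieDeriv hV hVp hh, hcoef, h, Finset.mul_sum]
    congr 1
    refine Finset.sum_congr rfl fun α _ => ?_
    have := congrFun hc α
    simp only [mulVec, dotProduct, Pi.smul_apply, smul_eq_mul] at this
    rw [this, mul_assoc]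
  have h2 : ¬ VanishTo p (m + 1) h := by
    intro hv
    refine ha (funext fun α => ?_)
    rw [← hcoef α, coef_eq_of_vanishTo hh (h := fun _ => 0) analyticAt_const (by simpa using hv)
      α.2, coef_zero]
    rfl
  have hex : ∃ k, ¬ VanishTo p k h := ⟨m + 1, h2⟩
  classical
  obtain ⟨k, hk⟩ : ∃ k, Nat.find hex = k + 1 := by
    refine Nat.exists_eq_succ_of_ne_zero fun h0 => ?_
    have := Nat.find_spec hex
    rw [h0] at this
    exact this (vanishTo_zero_of_continuousAt hh.continuousAt)
  have hkm : k + 1 ≤ m + 1 := hk ▸ Nat.find_min' hex h2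
  have hnot : ¬ VanishTo p (k + 1) h := hk ▸ Nat.find_spec hex
  have hyes : VanishTo p k h := not_not.1 (Nat.find_min hex (by omega))
  refine im_eq_zero_of_linear_lieDeriv (fderiv ℂ V p) hreal (k + 1) c h hh ?_ hnot
  have h3 : VanishTo p (k + 1) fun z => fderiv ℂ h z (V z - fderiv ℂ V p (z - p)) := by
    have h4 := vanishTo_two_sub_linear hV hVp
    rcases Nat.eq_zero_or_pos k with rfl | hk0
    · exact (vanishTo_fderiv_apply (k := 0)
        (vanishTo_zero_of_continuousAt hh.fderiv.continuousAt) h4).mono (by omega)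
    · obtain ⟨j, rfl⟩ : ∃ j, k = j + 1 := ⟨k - 1, by omega⟩
      exact (vanishTo_fderiv_apply (hyes.fderiv hh) h4).mono (by omega)
  refine ((h1.mono hkm).sub h3).congr (Eventually.of_forall fun z => ?_)
  simp only [lieDeriv, map_sub]
  ring

end Lie

/-! ### Taylor remainders on complex lines in an absolutely convex set -/

theorem iteratedDeriv_eq_zero_of_isBigO {f : ℂ → ℂ} (hf : AnalyticAt ℂ f 0) {n : ℕ}
    (hO : f =O[𝓝 0] fun t => ‖t‖ ^ n) {i : ℕ} (hi : i < n) : iteratedDeriv i f 0 = 0 := by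
  refine (natCast_le_analyticOrderAt_iff_iteratedDeriv_eq_zero hf).1 ?_ i hi
  by_contra! hlt
  obtain ⟨k, hk⟩ := ENat.ne_top_iff_exists.1 (ne_top_of_lt hlt)
  rw [← hk, Nat.cast_lt] at hlt
  obtain ⟨g, hg, hg0, hfg⟩ := hf.analyticOrderAt_eq_natCast.1 hk.symm
  obtain ⟨C, hC⟩ := hO.bound
  have h1 : Tendsto (fun t : ℂ => ‖g t‖) (𝓝[≠] 0) (𝓝 ‖g 0‖) :=
    hg.continuousAt.norm.tendsto.mono_left nhdsWithin_le_nhds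
  have h2 : Tendsto (fun t : ℂ => C * ‖t‖ ^ (n - k)) (𝓝[≠] 0) (𝓝 (C * ‖(0 : ℂ)‖ ^ (n - k))) :=
    (Continuous.tendsto (by fun_prop) 0).mono_left nhdsWithin_le_nhds
  have h3 := le_of_tendsto_of_tendsto h1 h2 (by
    filter_upwards [nhdsWithin_le_nhds hC, nhdsWithin_le_nhds hfg, self_mem_nhdsWithin]
      with t h4 h5 (h6 : t ≠ 0)
    rw [h5, sub_zero, norm_smul, norm_pow, norm_pow, norm_norm] at h4
    have h7 : 0 < ‖t‖ ^ k := by positivity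
    have h8 : ‖t‖ ^ n = ‖t‖ ^ k * ‖t‖ ^ (n - k) := by rw [← pow_add]; congr 1; omega
    rw [h8] at h4
    nlinarith)
  rw [norm_zero, zero_pow (by omega), mul_zero] at h3
  exact hg0 (norm_le_zero_iff.1 h3)

theorem iteratedDeriv_polynomial (q : Polynomial ℂ) (k : ℕ) :
    iteratedDeriv k (fun t => q.eval t) = fun t => (Polynomial.derivative^[k] q).eval t := by
  induction k with
  | zero => simp
  | succ k ih =>
    rw [iteratedDeriv_succ, ih, Function.iterate_succ_apply']
    funext t
    exact Polynomial.deriv _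

/-- Remainder of the Taylor polynomial of a bounded holomorphic function on the unit disc. -/
theorem norm_sub_taylor_le {g : ℂ → ℂ} (hg : DifferentiableOn ℂ g (Metric.ball 0 1)) {M : ℝ}
    (hM : ∀ t ∈ Metric.ball (0 : ℂ) 1, ‖g t‖ ≤ M) {n : ℕ} {q : Polynomial ℂ}
    (hq : q.natDegree ≤ n) (hO : (fun t => g t - q.eval t) =O[𝓝 0] fun t => ‖t‖ ^ (n + 1))
    {t : ℂ} (ht : ‖t‖ < 1) : ‖g t - q.eval t‖ ≤ M * ‖t‖ ^ (n + 1) / (1 - ‖t‖) := by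
  have hqd : Differentiable ℂ fun t => q.eval t := q.differentiable
  have hga : AnalyticAt ℂ g 0 := hg.analyticAt (Metric.ball_mem_nhds 0 one_pos)
  have hqa : AnalyticAt ℂ (fun t => q.eval t) 0 := hqd.analyticAt 0
  have hHd : DifferentiableOn ℂ (fun t => g t - q.eval t) (Metric.ball 0 1) :=
    hg.sub hqd.differentiableOn
  have hs := Complex.hasSum_taylorSeries_on_ball hHd (mem_ball_zero_iff.2 ht)
  -- Below degree $n+1$ the coefficients of $g-q$ vanish; from there on they are those of $g$, so
  -- the degree bound on $q$ lets the bound on $g$ alone control the tail.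
  have hcoef : ∀ k, n + 1 ≤ k →
      iteratedDeriv k (fun t => g t - q.eval t) 0 = iteratedDeriv k g 0 := by
    intro k hk
    rw [iteratedDeriv_fun_sub hga.contDiffAt hqa.contDiffAt, iteratedDeriv_polynomial,
      Polynomial.iterate_derivative_eq_zero (by omega)]
    simp
  -- The bound is only available on the open disc, so Cauchy's estimate is used on radii $r<1$ and
  -- $r\to1$ is taken.
  have hcauchy : ∀ k, ‖iteratedDeriv k g 0‖ ≤ k.factorial * M := by
    intro k
    have h1 : Tendsto (fun r : ℝ => k.factorial * M / r ^ k) (𝓝[<] 1)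
        (𝓝 (k.factorial * M / 1 ^ k)) := by
      refine Tendsto.mono_left (ContinuousAt.tendsto ?_) nhdsWithin_le_nhds
      exact ContinuousAt.div₀ (by fun_prop) (by fun_prop) (by simp)
    rw [one_pow, div_one] at h1
    refine ge_of_tendsto h1 ?_
    filter_upwards [Ioo_mem_nhdsLT one_pos] with r hr
    refine Complex.norm_iteratedDeriv_le_of_forall_mem_sphere_norm_le k hr.1 ?_ fun z hz =>
      hM z (by rw [mem_sphere_zero_iff_norm] at hz; rw [mem_ball_zero_iff, hz]; exact hr.2)
    refine DifferentiableOn.diffContOnCl_ball (U := Metric.ball 0 1) hg ?_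
    exact Metric.closedBall_subset_ball hr.2
  set a : ℕ → ℂ := fun k => (k.factorial : ℂ)⁻¹ • (t - 0) ^ k •
    iteratedDeriv k (fun t => g t - q.eval t) 0 with ha
  have hzero : ∑ k ∈ Finset.range (n + 1), a k = 0 := by
    refine Finset.sum_eq_zero fun k hk => ?_
    have : iteratedDeriv k (fun t => g t - q.eval t) 0 = 0 :=
      iteratedDeriv_eq_zero_of_isBigO (hga.sub hqa) hO (Finset.mem_range.1 hk)
    simp [ha, this]
  have hs' := (hasSum_nat_add_iff' (n + 1)).2 hs
  rw [hzero, sub_zero] at hs'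
  have hgeo := ((hasSum_geometric_of_lt_one (norm_nonneg t) ht).mul_left (M * ‖t‖ ^ (n + 1)))
  have hle : ∀ k, ‖a (k + (n + 1))‖ ≤ M * ‖t‖ ^ (n + 1) * ‖t‖ ^ k := by
    intro k
    have h2 : (0 : ℝ) < (k + (n + 1)).factorial := by positivity
    rw [ha]
    simp only [sub_zero, norm_smul, norm_inv, norm_pow, hcoef _ (Nat.le_add_left _ _)]
    rw [Complex.norm_natCast]
    calc _ ≤ ((k + (n + 1)).factorial : ℝ)⁻¹ *
          (‖t‖ ^ (k + (n + 1)) * ((k + (n + 1)).factorial * M)) := by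
          gcongr; exact hcauchy _
      _ = _ := by field_simp; ring
  have hsum := Summable.of_nonneg_of_le (fun _ => norm_nonneg _) hle hgeo.summable
  rw [← hs'.tsum_eq, div_eq_mul_inv, ← hgeo.tsum_eq]
  exact (norm_tsum_le_tsum_norm hsum).trans (hsum.tsum_le_tsum hle hgeo.summable)

theorem IsAbsConvex.balanced {d : ℕ} {K : Set (CSpace d)} (hK : IsAbsConvex K) : Balanced ℂ K := by
  rw [balanced_iff_smul_mem]
  intro a ha x hx
  simpa using hK x hx x hx a 0 (by simpa using ha)

theorem IsAbsConvex.convex {d : ℕ} {K : Set (CSpace d)} (hK : IsAbsConvex K) : Convex ℝ K := by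
  intro x hx y hy a b ha hb hab
  have := hK x hx y hy a b (by
    rw [Complex.norm_real, Complex.norm_real, Real.norm_of_nonneg ha, Real.norm_of_nonneg hb, hab])
  simpa only [Complex.coe_smul] using this

variable {d : ℕ} {p : CSpace d}

theorem IsAbsConvex.smul_mem_interior {K : Set (CSpace d)} (hK : IsAbsConvex K) (hK0 : K ∈ 𝓝 0)
    {y : CSpace d} (hy : gauge K y ≤ 1) {t : ℂ} (ht : ‖t‖ < 1) : t • y ∈ interior K := by
  rw [← gauge_lt_one_iff_mem_interior hK.convex hK0, gauge_smul hK.balanced]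
  nlinarith [gauge_nonneg (s := K) y, norm_nonneg t]

theorem mono_smul (t : ℂ) (y : CSpace d) (α : Fin d → ℕ) :
    mono (t • y) α = t ^ (∑ i, α i) * mono y α := by
  simp [mono, mul_pow, Finset.prod_mul_distrib, Finset.prod_pow_eq_pow_sum]

/-- For $R>0$ put $y=x/R$; the disc $|t|<1$ maps by $t\mapsto p+ty$ into $p+\operatorname{int}K$.
After multiplication by $e^{-p^*z}$ the jet expansion becomes a polynomial of degree at most $n$ in
$t$, and `norm_sub_taylor_le` is evaluated at $t=R$. The exponential is removed once and restored
once, at the cost $e^{2L}$. For $R=0$ the point must be $p$ itself, hence the separate hypothesis.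
-/
theorem norm_sub_sum_coef_le {K : Set (CSpace d)} (hK : IsAbsConvex K) (hK0 : K ∈ 𝓝 0)
    {h : CSpace d → ℂ} (hd : ∀ x ∈ interior K, DifferentiableAt ℂ h (p + x))
    (hp : AnalyticAt ℂ h p) {M L : ℝ} (hM : ∀ x ∈ interior K, ‖h (p + x)‖ ≤ M)
    (hL : ∀ x ∈ interior K, ‖p‖ * ‖p + x‖ ≤ L) (n : ℕ) {R : ℝ} (hR0 : 0 ≤ R) (hR1 : R < 1)
    {x : CSpace d} (hx : gauge K x ≤ R) (hx0 : R = 0 → x = 0) :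
    ‖h (p + x) - ∑ α : MultiIdx d n, coef p α.1 h * u p α.1 (p + x)‖ ≤
      Real.exp (2 * L) * M * R ^ (n + 1) / (1 - R) := by
  have hv := vanishTo_sub_coef hp n
  rcases hR0.eq_or_lt with hR | hR
  · rw [hx0 hR.symm, add_zero, hv.eq_zero, ← hR]
    simp
  have hRc : (R : ℂ) ≠ 0 := by exact_mod_cast hR.ne'
  set y : CSpace d := (R : ℂ)⁻¹ • x with hy
  have hxy : x = (R : ℂ) • y := by rw [hy, smul_inv_smul₀ hRc]
  have hy1 : gauge K y ≤ 1 := by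
    rw [hy, gauge_smul hK.balanced, norm_inv, Complex.norm_real, Real.norm_of_nonneg hR0,
      inv_mul_le_iff₀ hR, mul_one]
    exact hx
  have hmem : ∀ t ∈ Metric.ball (0 : ℂ) 1, t • y ∈ interior K := fun t ht =>
    hK.smul_mem_interior hK0 hy1 (mem_ball_zero_iff.1 ht)
  have hM0 : 0 ≤ M := (norm_nonneg _).trans (hM 0 (mem_interior_iff_mem_nhds.2 hK0))
  have hexp : ∀ z : CSpace d, ‖p‖ * ‖z‖ ≤ L → ∀ ε : ℂ, ‖ε‖ = 1 →
      ‖Complex.exp (ε * inner ℂ p z)‖ ≤ Real.exp L := by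
    intro z hz ε hε
    rw [Complex.norm_exp]
    refine Real.exp_le_exp.2 ((Complex.re_le_norm _).trans ?_)
    rw [norm_mul, hε, one_mul]
    exact (norm_inner_le_norm _ _).trans hz
  let g : ℂ → ℂ := fun t => h (p + t • y) * Complex.exp (-1 * inner ℂ p (p + t • y))
  have hed : Differentiable ℂ fun t : ℂ => Complex.exp (-1 * inner ℂ p (p + t • y)) := by
    have : Differentiable ℂ fun t : ℂ => innerSL ℂ p (p + t • y) := by fun_prop
    exact (this.const_mul (-1)).cexp
  have hg : DifferentiableOn ℂ g (Metric.ball 0 1) := fun t ht => by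
    have h1 : DifferentiableAt ℂ (fun t : ℂ => p + t • y) t := by fun_prop
    have h2 : DifferentiableAt ℂ (fun t : ℂ => h (p + t • y)) t :=
      DifferentiableAt.comp t (hd _ (hmem t ht)) h1
    exact (h2.mul (hed t)).differentiableWithinAt
  have hgM : ∀ t ∈ Metric.ball (0 : ℂ) 1, ‖g t‖ ≤ M * Real.exp L := fun t ht => by
    rw [norm_mul]
    exact mul_le_mul (hM _ (hmem t ht)) (hexp _ (hL _ (hmem t ht)) (-1) (by simp))
      (norm_nonneg _) hM0
  let q : Polynomial ℂ := ∑ α : MultiIdx d n, Polynomial.monomial (∑ i, α.1 i)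
    (coef p α.1 h * (((Real.exp (-‖p‖ ^ 2 / 2) / √(multiFactorial α.1 : ℝ) : ℝ) : ℂ)) *
      mono y α.1)
  have hq : q.natDegree ≤ n := Polynomial.natDegree_sum_le_of_forall_le _ _ fun α _ =>
    (Polynomial.natDegree_monomial_le _).trans α.2
  have hqe : ∀ t : ℂ, q.eval t = (∑ α : MultiIdx d n, coef p α.1 h * u p α.1 (p + t • y)) *
      Complex.exp (-1 * inner ℂ p (p + t • y)) := by
    intro t
    simp only [q, Polynomial.eval_finsetSum, Polynomial.eval_monomial, Finset.sum_mul]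
    refine Finset.sum_congr rfl fun α _ => ?_
    have he : Complex.exp (inner ℂ p (p + t • y)) * Complex.exp (-1 * inner ℂ p (p + t • y)) = 1 := by
      rw [← Complex.exp_add]
      simp
    rw [u, add_sub_cancel_left, mono_smul t y]
    linear_combination (-(coef p α.1 h *
      (((Real.exp (-‖p‖ ^ 2 / 2) / √(multiFactorial α.1 : ℝ) : ℝ) : ℂ)) *
      (t ^ (∑ i, α.1 i) * mono y α.1))) * he
  have hdiff : ∀ t : ℂ, g t - q.eval t = (h (p + t • y) -
      ∑ α : MultiIdx d n, coef p α.1 h * u p α.1 (p + t • y)) *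
        Complex.exp (-1 * inner ℂ p (p + t • y)) := fun t => by
    rw [hqe, sub_mul]
  have hO : (fun t => g t - q.eval t) =O[𝓝 0] fun t => ‖t‖ ^ (n + 1) := by
    have h1 : Tendsto (fun t : ℂ => p + t • y) (𝓝 0) (𝓝 p) :=
      (Continuous.tendsto (by fun_prop) 0).trans (by simp)
    have h2 := hv.comp_tendsto h1
    have h3 : ((fun z => ‖z - p‖ ^ (n + 1)) ∘ fun t : ℂ => p + t • y) =O[𝓝 0]
        fun t => ‖t‖ ^ (n + 1) := by
      refine Asymptotics.IsBigO.of_bound (‖y‖ ^ (n + 1)) (Eventually.of_forall fun t => ?_)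
      simp [norm_smul, mul_pow, mul_comm]
    have h4 : (fun t : ℂ => Complex.exp (-1 * inner ℂ p (p + t • y))) =O[𝓝 0]
        fun _ => (1 : ℝ) := (hed 0).continuousAt.isBigO_one ℝ
    refine ((h2.trans h3).mul h4).congr (fun t => (hdiff t).symm) fun t => mul_one _
  have key := norm_sub_taylor_le hg hgM hq hO (t := (R : ℂ))
    (by rwa [Complex.norm_real, Real.norm_of_nonneg hR0])
  rw [Complex.norm_real, Real.norm_of_nonneg hR0, hdiff, ← hxy, norm_mul] at key
  have hxK : x ∈ interior K :=
    (gauge_lt_one_iff_mem_interior hK.convex hK0).1 (hx.trans_lt hR1)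
  set A := h (p + x) - ∑ α : MultiIdx d n, coef p α.1 h * u p α.1 (p + x)
  have h5 : ‖A‖ = ‖A‖ * ‖Complex.exp (-1 * inner ℂ p (p + x))‖ *
      ‖Complex.exp (1 * inner ℂ p (p + x))‖ := by
    rw [mul_assoc, ← norm_mul, ← Complex.exp_add]
    simp
  rw [h5]
  have hR' : 0 < 1 - R := by linarith
  calc _ ≤ M * Real.exp L * R ^ (n + 1) / (1 - R) * Real.exp L :=
        mul_le_mul key (hexp _ (hL _ hxK) 1 (by simp)) (norm_nonneg _) (by positivity)
    _ = _ := by rw [two_mul, Real.exp_add]; ring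

/-! ### Resolvents and perturbation of the matrix logarithm -/

section Resolvent

open scoped Matrix.Norms.L2Operator

variable {ι : Type*} [Fintype ι] [DecidableEq ι]

theorem opNorm_eq_norm (A : Matrix ι ι ℂ) : opNorm A = ‖A‖ := rfl

/-- `A` is invertible along the segment to the identity. -/
def SegmentUnit (A : Matrix ι ι ℂ) : Prop :=
  ∀ t ∈ Set.Icc (0 : ℝ) 1, IsUnit (1 + (t : ℂ) • (A - 1))

theorem algebraMap_sub_eq (A : Matrix ι ι ℂ) {t x : ℝ} (h : t * (1 - x) = 1) :
    (1 + (t : ℂ) • (A - 1)) = (-t : ℂ) • (algebraMap ℂ (Matrix ι ι ℂ) x - A) := by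
  have h' : (t : ℂ) * (1 - x) = 1 := by exact_mod_cast h
  have e : (1 : Matrix ι ι ℂ) = ((t : ℂ) * (1 - x)) • (1 : Matrix ι ι ℂ) := by rw [h', one_smul]
  rw [Algebra.algebraMap_eq_smul_one]
  nth_rewrite 1 [e]
  module

/-- For $t\in(0,1]$ one has $I+t(A-I)=-t(xI-A)$ with $x=1-1/t$, and $x$ runs exactly through
$(-\infty,0]$. -/
theorem segmentUnit_iff (A : Matrix ι ι ℂ) : SegmentUnit A ↔ NoNonposEigenvalue A := by
  constructor
  · intro h x hx
    have h1 : 0 < 1 - x := by linarith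
    have h2 := h (1 - x)⁻¹ ⟨by positivity, inv_le_one_of_one_le₀ (by linarith)⟩
    rw [algebraMap_sub_eq A (x := x) (inv_mul_cancel₀ h1.ne')] at h2
    rw [spectrum.notMem_iff]
    have hne : (-((1 - x)⁻¹ : ℝ) : ℂ) ≠ 0 := by
      rw [neg_ne_zero, Complex.ofReal_ne_zero]
      positivity
    have h3 := h2.smul (Units.mk0 _ hne)⁻¹
    rwa [Units.smul_def, Units.val_inv_eq_inv_val, Units.val_mk0, inv_smul_smul₀ hne] at h3
  · intro h t ht
    rcases ht.1.eq_or_lt with h0 | h0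
    · simp [← h0]
    have h1 : t * (1 - (1 - t⁻¹)) = 1 := by field_simp; ring
    have h2 := h (1 - t⁻¹) (by have := (one_le_inv₀ h0).2 ht.2; linarith)
    rw [algebraMap_sub_eq A h1]
    rw [spectrum.notMem_iff] at h2
    exact h2.smul (Units.mk0 (-t : ℂ) (by rw [neg_ne_zero]; exact_mod_cast h0.ne'))

theorem continuousAt_inv_of_isUnit {A : Matrix ι ι ℂ} (hA : IsUnit A) :
    ContinuousAt (fun X : Matrix ι ι ℂ => X⁻¹) A := by
  obtain ⟨a, rfl⟩ := hA
  have e : (fun X : Matrix ι ι ℂ => X⁻¹) = Ring.inverse :=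
    funext Matrix.nonsing_inv_eq_ringInverse
  rw [e]
  exact NormedRing.inverse_continuousAt a

theorem SegmentUnit.continuousOn {A : Matrix ι ι ℂ} (hA : SegmentUnit A) :
    ContinuousOn (fun t : ℝ => (1 + (t : ℂ) • (A - 1))⁻¹) (Set.Icc 0 1) := fun t ht => by
  have h1 : ContinuousAt (fun t : ℝ => 1 + (t : ℂ) • (A - 1)) t := by fun_prop
  exact (ContinuousAt.comp (f := fun t : ℝ => 1 + (t : ℂ) • (A - 1))
    (g := fun X : Matrix ι ι ℂ => X⁻¹) (continuousAt_inv_of_isUnit (hA t ht)) h1).continuousWithinAt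

/-- Continuity of the inverse on the compact segment makes the family bounded, so that
`resolventBound` is a genuine supremum and not a default value. -/
theorem SegmentUnit.norm_inv_le {A : Matrix ι ι ℂ} (hA : SegmentUnit A) {t : ℝ}
    (ht : t ∈ Set.Icc (0 : ℝ) 1) : ‖(1 + (t : ℂ) • (A - 1))⁻¹‖ ≤ resolventBound A := by
  have hb : BddAbove (Set.range fun t : Set.Icc (0 : ℝ) 1 =>
      opNorm ((1 + ((t : ℝ) : ℂ) • (A - 1))⁻¹)) := by
    obtain ⟨C, hC⟩ := isCompact_Icc.exists_bound_of_continuousOn hA.continuousOn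
    exact ⟨C, by rintro _ ⟨t, rfl⟩; exact hC t t.2⟩
  exact le_ciSup hb ⟨t, ht⟩

theorem SegmentUnit.one_le_resolventBound [Nonempty ι] {A : Matrix ι ι ℂ} (hA : SegmentUnit A) :
    1 ≤ resolventBound A := by
  have := hA.norm_inv_le (t := 0) (by simp)
  simpa using this

theorem isUnit_add_of_norm_inv_mul_lt {X E : Matrix ι ι ℂ} (hX : IsUnit X) (h : ‖X⁻¹ * E‖ < 1) :
    IsUnit (X + E) := by
  have h1 : X + E = X * (1 - -(X⁻¹ * E)) := by
    rw [sub_neg_eq_add, mul_add, mul_one, ← mul_assoc,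
      Matrix.mul_nonsing_inv _ ((Matrix.isUnit_iff_isUnit_det _).1 hX), one_mul]
  rw [h1]
  exact hX.mul (isUnit_one_sub_of_norm_lt_one (by rwa [norm_neg]))

theorem inv_sub_inv_eq {X Y : Matrix ι ι ℂ} (hX : IsUnit X) (hY : IsUnit Y) :
    X⁻¹ - Y⁻¹ = X⁻¹ * (Y - X) * Y⁻¹ := by
  rw [mul_sub, sub_mul, mul_assoc, Matrix.mul_nonsing_inv _ ((Matrix.isUnit_iff_isUnit_det _).1 hY),
    Matrix.nonsing_inv_mul _ ((Matrix.isUnit_iff_isUnit_det _).1 hX), mul_one, one_mul]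

section Perturbation

variable {A D : Matrix ι ι ℂ} {γ : ℝ}

/-- A Neumann series argument, uniform along the segment: the relative perturbation has norm at most
$1-\gamma<1$. -/
theorem SegmentUnit.perturb [Nonempty ι] (hA : SegmentUnit A) (hγ : 0 < γ)
    (h : ‖A - D‖ ≤ (1 - γ) * (resolventBound A)⁻¹) : SegmentUnit D ∧ ∀ t ∈ Set.Icc (0 : ℝ) 1,
      ‖(1 + (t : ℂ) • (D - 1))⁻¹‖ ≤ resolventBound A / γ := by
  have hB := hA.one_le_resolventBound
  have hB0 : 0 < resolventBound A := by linarith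
  have h0 : ∀ t ∈ Set.Icc (0 : ℝ) 1,
      1 + (t : ℂ) • (D - 1) = (1 + (t : ℂ) • (A - 1)) + (t : ℂ) • (D - A) := by
    intro t _; module
  have hE : ∀ t ∈ Set.Icc (0 : ℝ) 1,
      ‖(1 + (t : ℂ) • (A - 1))⁻¹‖ * ‖(t : ℂ) • (D - A)‖ ≤ 1 - γ := by
    intro t ht
    calc _ ≤ resolventBound A * ((1 - γ) * (resolventBound A)⁻¹) := by
          refine mul_le_mul (hA.norm_inv_le ht) ?_ (norm_nonneg _) hB0.le
          rw [norm_smul, Complex.norm_real, Real.norm_of_nonneg ht.1, norm_sub_rev]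
          exact (mul_le_of_le_one_left (norm_nonneg _) ht.2).trans h
      _ = 1 - γ := by field_simp
  have hunit : SegmentUnit D := fun t ht => by
    rw [h0 t ht]
    exact isUnit_add_of_norm_inv_mul_lt (hA t ht)
      (((norm_mul_le _ _).trans (hE t ht)).trans_lt (by linarith))
  refine ⟨hunit, fun t ht => ?_⟩
  have h1 := inv_sub_inv_eq (hA t ht) (hunit t ht)
  have h2 : (1 + (t : ℂ) • (D - 1)) - (1 + (t : ℂ) • (A - 1)) = (t : ℂ) • (D - A) := by module
  rw [h2] at h1
  -- The resolvent identity bounds the perturbed inverse by $B+(1-\gamma)$ times itself; solving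
  -- this for the inverse gives $B/\gamma$.
  have h3 : ‖(1 + (t : ℂ) • (D - 1))⁻¹‖ ≤
      resolventBound A + (1 - γ) * ‖(1 + (t : ℂ) • (D - 1))⁻¹‖ := by
    calc _ = ‖(1 + (t : ℂ) • (A - 1))⁻¹ - (1 + (t : ℂ) • (A - 1))⁻¹ * ((t : ℂ) • (D - A)) *
          (1 + (t : ℂ) • (D - 1))⁻¹‖ := by rw [← h1, sub_sub_cancel]
      _ ≤ _ := (norm_sub_le _ _).trans (add_le_add (hA.norm_inv_le ht) ((norm_mul_le _ _).trans
          (mul_le_mul_of_nonneg_right ((norm_mul_le _ _).trans (hE t ht)) (norm_nonneg _))))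
  rw [le_div_iff₀ hγ]
  linarith

theorem matLog_eq_integral (hA : SegmentUnit A) :
    matLog A = ∫ t in (0 : ℝ)..1, (A - 1) * (1 + (t : ℂ) • (A - 1))⁻¹ := by
  have hi : IntervalIntegrable (fun t : ℝ => (1 + (t : ℂ) • (A - 1))⁻¹) volume 0 1 :=
    ContinuousOn.intervalIntegrable (by simpa using hA.continuousOn)
  have h1 := (ContinuousLinearMap.mul ℝ (Matrix ι ι ℂ) (A - 1)).intervalIntegral_comp_comm hi
  simp only [ContinuousLinearMap.mul_apply'] at h1
  rw [h1, matLog]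
  congr 1
  ext i j
  have h2 := (LinearMap.toContinuousLinearMap (Matrix.entryLinearMap ℝ ℂ i j)
    ).intervalIntegral_comp_comm hi
  exact h2

/-- With $X=I+t(A-I)$ and $Y=I+t(D-I)$, the integrands differ by $Y^{-1}(A-D)X^{-1}$: $Y$ commutes
with $D$, and $Y(A-I)-(D-I)X=A-D$ because the terms in $t$ cancel. No commutation of $A$ with $D$ is
needed. -/
theorem matLog_sub_matLog (hA : SegmentUnit A) (hD : SegmentUnit D) :
    matLog A - matLog D = ∫ t in (0 : ℝ)..1,
      (1 + (t : ℂ) • (D - 1))⁻¹ * (A - D) * (1 + (t : ℂ) • (A - 1))⁻¹ := by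
  have hi : ∀ {A : Matrix ι ι ℂ}, SegmentUnit A → IntervalIntegrable
      (fun t : ℝ => (A - 1) * (1 + (t : ℂ) • (A - 1))⁻¹) volume 0 1 := fun hA =>
    ContinuousOn.intervalIntegrable (by
      rw [Set.uIcc_of_le zero_le_one]
      exact continuousOn_const.mul hA.continuousOn)
  rw [matLog_eq_integral hA, matLog_eq_integral hD, ← intervalIntegral.integral_sub (hi hA) (hi hD)]
  refine intervalIntegral.integral_congr fun t ht => ?_
  rw [Set.uIcc_of_le zero_le_one] at ht
  have hX := (Matrix.isUnit_iff_isUnit_det _).1 (hA t ht)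
  have hY := (Matrix.isUnit_iff_isUnit_det _).1 (hD t ht)
  set X := 1 + (t : ℂ) • (A - 1) with hXd
  set Y := 1 + (t : ℂ) • (D - 1) with hYd
  have hcomm : (D - 1) * Y⁻¹ = Y⁻¹ * (D - 1) := by
    have : Y * (D - 1) = (D - 1) * Y := by simp [hYd, mul_add, add_mul]
    calc (D - 1) * Y⁻¹ = Y⁻¹ * (Y * (D - 1)) * Y⁻¹ := by
          rw [← mul_assoc Y⁻¹, Matrix.nonsing_inv_mul _ hY, one_mul]
      _ = Y⁻¹ * (D - 1) := by
          rw [this, mul_assoc, mul_assoc, Matrix.mul_nonsing_inv _ hY, mul_one]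
  have h3 : A - D = Y * (A - 1) - (D - 1) * X := by
    simp only [hXd, hYd, mul_add, add_mul, mul_smul_comm, smul_mul_assoc, mul_one, one_mul]
    abel
  rw [hcomm, h3, mul_sub Y⁻¹ (Y * (A - 1)), sub_mul (Y⁻¹ * (Y * (A - 1))), ← mul_assoc Y⁻¹ Y, Matrix.nonsing_inv_mul _ hY, one_mul,
    mul_assoc Y⁻¹, mul_assoc (D - 1), Matrix.mul_nonsing_inv _ hX, mul_one]

theorem norm_matLog_sub_le [Nonempty ι] (hA : SegmentUnit A) (hγ : 0 < γ)
    (h : ‖A - D‖ ≤ (1 - γ) * (resolventBound A)⁻¹) :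
    ‖matLog A - matLog D‖ ≤ resolventBound A ^ 2 / γ * ‖A - D‖ := by
  obtain ⟨hD, hDb⟩ := hA.perturb hγ h
  have hB := hA.one_le_resolventBound
  rw [matLog_sub_matLog hA hD]
  refine (intervalIntegral.norm_integral_le_of_norm_le_const
    (C := resolventBound A ^ 2 / γ * ‖A - D‖) fun t ht => ?_).trans (by simp)
  rw [Set.uIoc_of_le zero_le_one] at ht
  have ht' : t ∈ Set.Icc (0 : ℝ) 1 := ⟨ht.1.le, ht.2⟩
  calc _ ≤ resolventBound A / γ * ‖A - D‖ * resolventBound A := by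
        refine (norm_mul_le _ _).trans (mul_le_mul ((norm_mul_le _ _).trans ?_)
          (hA.norm_inv_le ht') (norm_nonneg _) (by positivity))
        exact mul_le_mul_of_nonneg_right (hDb t ht') (norm_nonneg _)
    _ = _ := by ring

/-- A primitive of $X_t^{-2}$, where $X_t=I+t(A-I)$; it gives $\int_0^1X_t^{-2}\,dt=A^{-1}$, the
derivative of the logarithm in commuting directions. -/
theorem hasDerivAt_smul_inv (hA : SegmentUnit A) {t : ℝ} (ht : t ∈ Set.Ioo (0 : ℝ) 1) :
    HasDerivAt (fun t : ℝ => t • (1 + (t : ℂ) • (A - 1))⁻¹)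
      ((1 + (t : ℂ) • (A - 1))⁻¹ * (1 + (t : ℂ) • (A - 1))⁻¹) t := by
  obtain ⟨a, ha⟩ := hA t ⟨ht.1.le, ht.2.le⟩
  have h1 : HasDerivAt (fun t : ℝ => 1 + (t : ℂ) • (A - 1)) (A - 1) t := by
    have h := ((Complex.ofRealCLM.hasDerivAt (x := t)).smul_const (A - 1)).const_add 1
    simpa using h
  have h2 := hasFDerivAt_ringInverse (𝕜 := ℝ) a
  rw [ha] at h2
  have h3 := h2.comp_hasDerivAt t h1
  have h4 := (hasDerivAt_id t).smul h3
  have e : Ring.inverse ∘ (fun t : ℝ => 1 + (t : ℂ) • (A - 1)) =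
      fun t : ℝ => (1 + (t : ℂ) • (A - 1))⁻¹ := by
    funext t
    simp [Matrix.nonsing_inv_eq_ringInverse]
  rw [e] at h4
  refine h4.congr_deriv ?_
  have e2 : (↑a⁻¹ : Matrix ι ι ℂ) = (1 + (t : ℂ) • (A - 1))⁻¹ := by
    rw [← ha, Matrix.coe_units_inv]
  have hX := (Matrix.isUnit_iff_isUnit_det _).1 (hA t ⟨ht.1.le, ht.2.le⟩)
  simp only [id, one_smul, _root_.neg_apply, ContinuousLinearMap.mulLeftRight_apply, e2,
    smul_neg]
  have e3 : (t : ℝ) • ((1 + (t : ℂ) • (A - 1))⁻¹ * (A - 1) * (1 + (t : ℂ) • (A - 1))⁻¹) =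
      (1 + (t : ℂ) • (A - 1))⁻¹ * ((t : ℂ) • (A - 1)) * (1 + (t : ℂ) • (A - 1))⁻¹ := by
    simp
  have e4 : (1 + (t : ℂ) • (A - 1))⁻¹ =
      (1 + (t : ℂ) • (A - 1))⁻¹ * ((t : ℂ) • (A - 1)) * (1 + (t : ℂ) • (A - 1))⁻¹ +
        (1 + (t : ℂ) • (A - 1))⁻¹ * (1 + (t : ℂ) • (A - 1))⁻¹ := by
    calc _ = (1 + (t : ℂ) • (A - 1))⁻¹ * (1 + (t : ℂ) • (A - 1)) * (1 + (t : ℂ) • (A - 1))⁻¹ := by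
          rw [Matrix.nonsing_inv_mul _ hX, one_mul]
      _ = _ := by rw [mul_add, add_mul, mul_one, add_comm]
  rw [e3]
  exact neg_add_eq_of_eq_add e4

theorem integral_inv_sq (hA : SegmentUnit A) :
    ∫ t in (0 : ℝ)..1, (1 + (t : ℂ) • (A - 1))⁻¹ * (1 + (t : ℂ) • (A - 1))⁻¹ = A⁻¹ := by
  rw [intervalIntegral.integral_eq_sub_of_hasDerivAt_of_le zero_le_one
    (continuousOn_id.smul hA.continuousOn) (fun t ht => hasDerivAt_smul_inv hA ht)]
  · simp
  · refine ContinuousOn.intervalIntegrable ?_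
    rw [Set.uIcc_of_le zero_le_one]
    exact hA.continuousOn.mul hA.continuousOn

end Perturbation

end Resolvent

/-! ### One-parameter semigroups in a Banach algebra -/

section Semigroup

theorem norm_pow_sub_pow_le {R : Type*} [NormedRing R] [NormOneClass R] {a b : R} {K : ℝ}
    (hK : 1 ≤ K) (ha : ‖a‖ ≤ K) (hb : ‖b‖ ≤ K) (n : ℕ) :
    ‖a ^ n - b ^ n‖ ≤ n * K ^ n * ‖a - b‖ := by
  induction n with
  | zero => simp
  | succ n ih =>
    have h1 : a ^ (n + 1) - b ^ (n + 1) = a ^ n * (a - b) + (a ^ n - b ^ n) * b := by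
      rw [pow_succ, pow_succ]; noncomm_ring
    have hKn : K ^ n ≤ K ^ (n + 1) := pow_le_pow_right₀ hK (Nat.le_succ n)
    have h2 : ‖a ^ n‖ ≤ K ^ n := (norm_pow_le a n).trans (by gcongr)
    calc _ ≤ ‖a ^ n‖ * ‖a - b‖ + ‖a ^ n - b ^ n‖ * ‖b‖ := by
          rw [h1]
          exact (norm_add_le _ _).trans (add_le_add (norm_mul_le _ _) (norm_mul_le _ _))
      _ ≤ K ^ (n + 1) * ‖a - b‖ + (n * K ^ n * ‖a - b‖) * K := by
          gcongr
          exact h2.trans hKn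
      _ = _ := by push_cast; ring

/-- A one-parameter semigroup on `[0, T]` with generator `G` is `exp (t G)`. -/
theorem semigroup_eq_exp {R : Type*} [NormedRing R] [NormOneClass R] [NormedAlgebra ℝ R]
    [CompleteSpace R] {M : ℝ → R} {G : R} {T : ℝ} (hT : 0 < T) (h0 : M 0 = 1)
    (hadd : ∀ s t, 0 ≤ s → 0 ≤ t → s + t ≤ T → M (s + t) = M s * M t)
    (hG : (fun t => M t - 1 - t • G) =o[𝓝[>] 0] fun t => t) : M T = NormedSpace.exp (T • G) := by
  have hexp : (fun t : ℝ => NormedSpace.exp (t • G) - 1 - t • G) =o[𝓝[>] 0] fun t => t := by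
    have := (hasDerivAt_exp_smul_const (𝕂 := ℝ) G (0 : ℝ)).isLittleO
    simp only [zero_smul, NormedSpace.exp_zero, one_mul, sub_zero] at this
    exact this.mono nhdsWithin_le_nhds
  -- $M(t)$ and $e^{tG}$ agree to $o(t)$. Raising both to the power $n$ at $t=T/n$ multiplies the
  -- discrepancy by at most $n\,e^{cT}$, and $n\cdot o(T/n)\to0$.
  have hdiff := hG.sub hexp
  simp only [sub_sub_sub_cancel_right] at hdiff
  have hseq : Tendsto (fun n : ℕ => T / n) atTop (𝓝[>] 0) := by
    refine tendsto_nhdsWithin_iff.2 ⟨tendsto_const_div_atTop_nhds_zero_nat T, ?_⟩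
    filter_upwards [eventually_gt_atTop 0] with n hn
    exact div_pos hT (by exact_mod_cast hn)
  have hpow : ∀ n : ℕ, 0 < n → ∀ k : ℕ, k ≤ n → M (k * (T / n)) = M (T / n) ^ k := by
    intro n hn k
    have hn' : (0 : ℝ) < n := by exact_mod_cast hn
    induction k with
    | zero => intro _; simp [h0]
    | succ k ih =>
      intro hk
      have hk' : ((k : ℝ) + 1) ≤ n := by exact_mod_cast hk
      rw [pow_succ, ← ih (by omega), ← hadd _ _ (by positivity) (by positivity)]
      · congr 1; push_cast; ring
      · calc (k : ℝ) * (T / n) + T / n = (k + 1) * (T / n) := by ring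
          _ ≤ n * (T / n) := by gcongr
          _ = T := by field_simp
  set c := ‖G‖ + 1 with hc
  have hc0 : 0 < c := by positivity
  have hbound : ∀ {F : ℝ → R}, ((fun t => F t - 1 - t • G) =o[𝓝[>] 0] fun t => t) →
      ∀ᶠ t in 𝓝[>] (0 : ℝ), ‖F t‖ ≤ 1 + c * t := by
    intro F hF
    filter_upwards [hF.bound one_pos, self_mem_nhdsWithin] with t ht (ht0 : 0 < t)
    rw [one_mul, Real.norm_of_nonneg ht0.le] at ht
    calc ‖F t‖ = ‖(F t - 1 - t • G) + 1 + t • G‖ := by congr 1; abel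
      _ ≤ t + 1 + t * ‖G‖ := by
        refine (norm_add_le _ _).trans (add_le_add ((norm_add_le _ _).trans
          (add_le_add ht norm_one.le)) ?_)
        rw [norm_smul, Real.norm_of_nonneg ht0.le]
      _ = 1 + c * t := by rw [hc]; ring
  by_contra hne
  have hpos : 0 < ‖M T - NormedSpace.exp (T • G)‖ := norm_pos_iff.2 (sub_ne_zero.2 hne)
  set δ := ‖M T - NormedSpace.exp (T • G)‖ with hδ
  -- Chosen so that the accumulated discrepancy is $\delta/2$, which is incompatible with a distance
  -- $\delta>0$.
  set ε := δ / (2 * (Real.exp (c * T) * T)) with hε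
  have hε0 : 0 < ε := by positivity
  have hev := hseq.eventually ((hbound hG).and ((hbound hexp).and (hdiff.bound hε0)))
  obtain ⟨n, ⟨h1, h2, h3⟩, hn⟩ := (hev.and (eventually_gt_atTop 0)).exists
  have hn' : (0 : ℝ) < n := by exact_mod_cast hn
  have ht0 : 0 < T / n := by positivity
  have e1 : M T = M (T / n) ^ n := by
    rw [← hpow n hn n le_rfl]; congr 1; field_simp
  have e2 : NormedSpace.exp (T • G) = NormedSpace.exp ((T / n) • G) ^ n := by
    have : T • G = n • ((T / n) • G) := by
      rw [← Nat.cast_smul_eq_nsmul ℝ, smul_smul]; congr 1; field_simp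
    rw [this]
    let _ : NormedAlgebra ℚ R := NormedAlgebra.restrictScalars ℚ ℝ R
    exact NormedSpace.exp_nsmul n _
  have h4 := norm_pow_sub_pow_le (by nlinarith) h1 h2 n
  rw [← e1, ← e2, ← hδ] at h4
  rw [Real.norm_of_nonneg ht0.le] at h3
  have h5 : (1 + c * (T / n)) ^ n ≤ Real.exp (c * T) := by
    calc (1 + c * (T / n)) ^ n ≤ Real.exp (c * (T / n)) ^ n := by
          gcongr
          rw [add_comm]; exact Real.add_one_le_exp _
      _ = Real.exp (c * T) := by
          rw [← Real.exp_nat_mul]; congr 1; field_simp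
  have h6 : δ ≤ n * Real.exp (c * T) * (ε * (T / n)) := h4.trans (by gcongr)
  have h7 : n * Real.exp (c * T) * (ε * (T / n)) = δ / 2 := by
    rw [hε]; field_simp
  linarith

end Semigroup

/-! ### The logarithm inverts the exponential -/

section Log

open scoped Matrix.Norms.L2Operator

variable {ι : Type*} [Fintype ι] [DecidableEq ι]

/-- `exp (s X)` has no eigenvalue in `(-∞, 0]` if the eigenvalues of `X` are real. -/
theorem noNonposEigenvalue_exp {X : Matrix ι ι ℂ}
    (hX : ∀ (c : ℂ) (v : ι → ℂ), v ≠ 0 → X *ᵥ v = c • v → c.im = 0) (s : ℝ) :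
    NoNonposEigenvalue (NormedSpace.exp (s • X)) := by
  intro x hx hspec
  rw [← Matrix.spectrum_toLin', ← Module.End.hasEigenvalue_iff_mem_spectrum] at hspec
  set f : Module.End ℂ (ι → ℂ) := Matrix.toLin' (NormedSpace.exp (s • X)) with hf
  set g : Module.End ℂ (ι → ℂ) := Matrix.toLin' X with hg
  have hcomm : Commute f g := by
    have h1 : Commute (NormedSpace.exp (s • X)) X :=
      ((Commute.refl X).smul_left s).exp_left
    rw [commute_iff_eq, hf, hg, Module.End.mul_eq_comp, Module.End.mul_eq_comp, ← Matrix.toLin'_mul,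
      ← Matrix.toLin'_mul, h1.eq]
  set E := f.eigenspace (x : ℂ) with hE
  -- The eigenspace of $e^{sX}$ is stable under the commuting matrix $X$, so it contains an
  -- eigenvector of $X$. There $e^{sX}$ acts by $e^{sc}$ with $c$ real, which is positive.
  have hinv : ∀ v ∈ E, g v ∈ E := by
    intro v hv
    rw [Module.End.mem_eigenspace_iff] at hv ⊢
    have : f (g v) = g (f v) := LinearMap.congr_fun hcomm.eq v
    rw [this, hv, map_smul]
  have : Nontrivial E := (Submodule.nontrivial_iff_ne_bot).2 hspec
  obtain ⟨c, hc⟩ := Module.End.exists_eigenvalue (g.restrict hinv)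
  obtain ⟨v, hv⟩ := hc.exists_hasEigenvector
  have hv0 : (v : ι → ℂ) ≠ 0 := fun h => hv.2 (Subtype.ext h)
  have hgv : X *ᵥ (v : ι → ℂ) = c • (v : ι → ℂ) := by
    have := congrArg Subtype.val hv.apply_eq_smul
    simpa [hg] using this
  have hcr := hX c v hv0 hgv
  have h1 : f v = (x : ℂ) • (v : ι → ℂ) := Module.End.mem_eigenspace_iff.1 v.2
  have h2 : f v = Complex.exp (s * c) • (v : ι → ℂ) := by
    have e0 : (s • X) *ᵥ (v : ι → ℂ) = (s * c : ℂ) • (v : ι → ℂ) := by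
      rw [Matrix.smul_mulVec, hgv]
      exact (Complex.coe_smul s (c • (v : ι → ℂ))).symm.trans (smul_smul _ _ _)
    have e1 : ∀ k : ℕ, ((s • X) ^ k) *ᵥ (v : ι → ℂ) = (s * c) ^ k • (v : ι → ℂ) := by
      intro k
      induction k with
      | zero => simp
      | succ k ih =>
        rw [pow_succ, ← Matrix.mulVec_mulVec, e0, Matrix.mulVec_smul, ih, smul_smul, pow_succ,
          mul_comm]
    have e2 := NormedSpace.exp_series_hasSum_exp' (𝕂 := ℂ) (s • X)
    have e3 := NormedSpace.exp_series_hasSum_exp' (𝕂 := ℂ) (s * c)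
    let ev : Matrix ι ι ℂ →ₗ[ℂ] (ι → ℂ) :=
      { toFun := fun A => A *ᵥ (v : ι → ℂ)
        map_add' := fun A B => Matrix.add_mulVec A B _
        map_smul' := fun a A => Matrix.smul_mulVec a A _ }
    have e4 := e2.mapL (LinearMap.toContinuousLinearMap ev)
    have e5 := e3.smul_const (v : ι → ℂ)
    rw [← Complex.exp_eq_exp_ℂ] at e5
    have e6 : (fun k : ℕ => (LinearMap.toContinuousLinearMap ev)
        ((k.factorial : ℂ)⁻¹ • (s • X) ^ k)) =
        fun k : ℕ => ((k.factorial : ℂ)⁻¹ • (s * c : ℂ) ^ k) • (v : ι → ℂ) := by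
      funext k
      change ((k.factorial : ℂ)⁻¹ • (s • X) ^ k) *ᵥ (v : ι → ℂ) = _
      rw [Matrix.smul_mulVec, e1, smul_assoc]
    rw [e6] at e4
    exact e4.unique e5
  have h3 : (x : ℂ) = Complex.exp (s * c) := smul_left_injective ℂ hv0 (h1.symm.trans h2)
  have h4 : (s * c : ℂ) = ((s * c.re : ℝ) : ℂ) := by
    apply Complex.ext <;> simp [hcr]
  rw [h4, ← Complex.ofReal_exp, Complex.ofReal_inj] at h3
  exact absurd (Real.exp_pos (s * c.re)) (by rw [← h3]; exact hx.not_gt)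

theorem SegmentUnit.commute_inv {A : Matrix ι ι ℂ} (hA : SegmentUnit A) {H : Matrix ι ι ℂ} (hH : Commute A H)
    {t : ℝ} (ht : t ∈ Set.Icc (0 : ℝ) 1) : Commute (1 + (t : ℂ) • (A - 1))⁻¹ H := by
  have hX := (Matrix.isUnit_iff_isUnit_det _).1 (hA t ht)
  have h1 : Commute (1 + (t : ℂ) • (A - 1)) H :=
    (Commute.one_left H).add_left ((hH.sub_left (Commute.one_left H)).smul_left _)
  set X := 1 + (t : ℂ) • (A - 1)
  calc X⁻¹ * H = X⁻¹ * (H * X) * X⁻¹ := by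
        rw [mul_assoc, mul_assoc, Matrix.mul_nonsing_inv _ hX, mul_one]
    _ = H * X⁻¹ := by
        rw [← h1.eq, ← mul_assoc, Matrix.nonsing_inv_mul _ hX, one_mul]

/-- First-order expansion of the logarithm in a commuting direction. Commutation moves $D-A$ to the
front of the integrand; replacing the resolvent of $D$ by that of $A$ then costs another factor
$D-A$. -/
theorem norm_matLog_sub_sub_le [Nonempty ι] {A D : Matrix ι ι ℂ} (hA : SegmentUnit A)
    (hcomm : Commute A D) (h : ‖A - D‖ ≤ (1 - 1 / 2) * (resolventBound A)⁻¹) :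
    ‖matLog D - matLog A - (D - A) * A⁻¹‖ ≤ 2 * resolventBound A ^ 3 * ‖D - A‖ ^ 2 := by
  obtain ⟨hD, hDb⟩ := hA.perturb (by norm_num : (0 : ℝ) < 1 / 2) h
  have hB := hA.one_le_resolventBound
  have hcAD : Commute A (D - A) := hcomm.sub_right (Commute.refl A)
  have hi1 : IntervalIntegrable (fun t : ℝ => (1 + (t : ℂ) • (A - 1))⁻¹ * (D - A) *
      (1 + (t : ℂ) • (D - 1))⁻¹) volume 0 1 := by
    refine ContinuousOn.intervalIntegrable ?_
    rw [Set.uIcc_of_le zero_le_one]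
    exact (hA.continuousOn.mul continuousOn_const).mul hD.continuousOn
  have hi2 : IntervalIntegrable (fun t : ℝ => (1 + (t : ℂ) • (A - 1))⁻¹ *
      (1 + (t : ℂ) • (A - 1))⁻¹) volume 0 1 := by
    refine ContinuousOn.intervalIntegrable ?_
    rw [Set.uIcc_of_le zero_le_one]
    exact hA.continuousOn.mul hA.continuousOn
  have h1 := (ContinuousLinearMap.mul ℝ (Matrix ι ι ℂ) (D - A)).intervalIntegral_comp_comm hi2
  have hi3 := hi2.const_mul (D - A)
  simp only [ContinuousLinearMap.mul_apply'] at h1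
  rw [matLog_sub_matLog hD hA, ← integral_inv_sq hA, ← h1, ← intervalIntegral.integral_sub hi1 hi3]
  refine (intervalIntegral.norm_integral_le_of_norm_le_const
    (C := 2 * resolventBound A ^ 3 * ‖D - A‖ ^ 2) fun t ht => ?_).trans (by simp)
  rw [Set.uIoc_of_le zero_le_one] at ht
  have ht' : t ∈ Set.Icc (0 : ℝ) 1 := ⟨ht.1.le, ht.2⟩
  have e1 := hA.commute_inv hcAD ht'
  have e2 := inv_sub_inv_eq (hD t ht') (hA t ht')
  have e3 : (1 + (t : ℂ) • (A - 1)) - (1 + (t : ℂ) • (D - 1)) = (t : ℂ) • (A - D) := by module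
  have e4 := hA.norm_inv_le ht'
  have e5 := hDb t ht'
  rw [e3] at e2
  set X := (1 + (t : ℂ) • (A - 1))⁻¹
  set Y := (1 + (t : ℂ) • (D - 1))⁻¹
  have e6 : X * (D - A) * Y - (D - A) * (X * X) = (D - A) * (X * (Y - X)) := by
    rw [e1.eq]; noncomm_ring
  rw [e6, e2]
  have e7 : ‖(t : ℂ) • (A - D)‖ ≤ ‖D - A‖ := by
    rw [norm_smul, Complex.norm_real, Real.norm_of_nonneg ht'.1, norm_sub_rev]
    exact mul_le_of_le_one_left (norm_nonneg _) ht'.2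
  calc _ ≤ ‖D - A‖ * (resolventBound A * (resolventBound A / (1 / 2) * ‖D - A‖ *
        resolventBound A)) := by
        refine (norm_mul_le _ _).trans (mul_le_mul_of_nonneg_left ((norm_mul_le _ _).trans
          (mul_le_mul e4 ((norm_mul_le _ _).trans (mul_le_mul ((norm_mul_le _ _).trans
            (mul_le_mul e5 e7 (norm_nonneg _) (by positivity))) e4 (norm_nonneg _) (by positivity)))
            (norm_nonneg _) (by positivity))) (norm_nonneg _))
    _ = _ := by ring

/-- The matrices $e^{sX}$ commute, so $\log e^{sX}$ has derivative $Xe^{sX}e^{-sX}=X$ in $s$ and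
vanishes at $s=0$. Reality of the eigenvalues keeps the whole path in the domain of the logarithm.
-/
theorem matLog_exp [Nonempty ι] {X : Matrix ι ι ℂ}
    (hX : ∀ (c : ℂ) (v : ι → ℂ), v ≠ 0 → X *ᵥ v = c • v → c.im = 0) :
    matLog (NormedSpace.exp X) = X := by
  let Y : ℝ → Matrix ι ι ℂ := fun s => NormedSpace.exp (s • X)
  have hY : ∀ s, SegmentUnit (Y s) := fun s => (segmentUnit_iff _).2 (noNonposEigenvalue_exp hX s)
  have hYd : ∀ s, HasDerivAt Y (X * Y s) s := fun s => hasDerivAt_exp_smul_const' (𝕂 := ℝ) X s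
  have hYc : ∀ s s', Commute (Y s) (Y s') := fun s s' =>
    (((Commute.refl X).smul_left s).smul_right s').exp
  have hder : ∀ s, HasDerivAt (fun s => matLog (Y s)) X s := by
    intro s
    have hYs : IsUnit (Y s).det := by
      have := hY s 1 (by simp)
      rw [Complex.ofReal_one, one_smul, add_sub_cancel] at this
      exact (Matrix.isUnit_iff_isUnit_det _).1 this
    have hB := (hY s).one_le_resolventBound
    have h1 : HasDerivAt (fun s' => (Y s' - Y s) * (Y s)⁻¹) X s := by
      have := ((hYd s).sub_const (Y s)).mul_const (Y s)⁻¹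
      rwa [mul_assoc, Matrix.mul_nonsing_inv _ hYs, mul_one] at this
    have h2 : HasDerivAt (fun s' => matLog (Y s') - matLog (Y s) - (Y s' - Y s) * (Y s)⁻¹) 0 s := by
      have h3 : (fun s' => matLog (Y s') - matLog (Y s) - (Y s' - Y s) * (Y s)⁻¹) =O[𝓝 s]
          fun s' => ‖s' - s‖ ^ 2 := by
        have h4 : (fun s' => Y s' - Y s) =O[𝓝 s] fun s' => s' - s := (hYd s).isBigO_sub
        have h5 := h4.norm_norm.pow 2
        refine Asymptotics.IsBigO.trans (Asymptotics.IsBigO.of_bound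
          (2 * resolventBound (Y s) ^ 3) ?_) h5
        have h6 : Tendsto (fun s' => ‖Y s - Y s'‖) (𝓝 s) (𝓝 0) := by
          have := (continuousAt_const (y := Y s)).sub (hYd s).continuousAt
          simpa using this.norm.tendsto
        filter_upwards [h6.eventually_le_const
          (show (0 : ℝ) < (1 - 1 / 2) * (resolventBound (Y s))⁻¹ by positivity)] with s' hs'
        rw [norm_pow, norm_norm]
        exact norm_matLog_sub_sub_le (hY s) (hYc s s') hs'
      simpa using (h3.hasFDerivAt (𝕜 := ℝ) one_lt_two).hasDerivAt
    have h7 := (h1.add h2).add_const (matLog (Y s))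
    rw [add_zero] at h7
    refine h7.congr_of_eventuallyEq (Eventually.of_forall fun s' => ?_)
    simp only [Pi.add_apply]
    abel
  have hconst : ∀ s, HasDerivAt (fun s => matLog (Y s) - s • X) 0 s := fun s => by
    have : HasDerivAt (fun s => matLog (Y s) - s • X) (X - (1 : ℝ) • X) s :=
      (hder s).sub ((hasDerivAt_id s).smul_const X)
    rwa [one_smul, sub_self] at this
  have h8 := is_const_of_deriv_eq_zero (fun s => (hconst s).differentiableAt)
    (fun s => (hconst s).deriv) 1 0
  have h9 : matLog (1 : Matrix ι ι ℂ) = 0 := by simp [matLog]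
  simpa [Y, h9, sub_eq_zero] using h8

end Log

/-! ### The push-forward semigroup and its generator -/

section Generator

open scoped Matrix.Norms.L2Operator

variable {d : ℕ} {p : CSpace d} {V : CSpace d → CSpace d} {U K : Set (CSpace d)} {T : ℝ}
  {φ : ℝ → CSpace d → CSpace d}

/-- Second order expansion in time of a function transported by a flow near a zero of the field. -/
theorem IsFlowOn.exists_norm_sub_sub_le (hU : IsOpen U) (hV : DifferentiableOn ℂ V U)
    (hφ : IsFlowOn V U K T φ) (hK : K ∈ 𝓝 p) (hpU : p ∈ U) {h : CSpace d → ℂ}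
    (hh : Differentiable ℂ h) :
    ∃ r > (0 : ℝ), ∃ ε > (0 : ℝ), ∃ C : ℝ, Metric.ball p r ⊆ K ∩ U ∧
      ∀ t ∈ Set.Icc (0 : ℝ) ε, t ≤ T → ∀ z ∈ Metric.ball p r,
        ‖h (φ t z) - h z - t * lieDeriv V h z‖ ≤ C * t ^ 2 := by
  have hVA : AnalyticAt ℂ V p := analyticOnNhd_of_differentiableOn hU hV p hpU
  have hk : AnalyticAt ℂ (lieDeriv V h) p := analyticAt_lieDeriv hVA (analyticAt_of_differentiable hh p)
  obtain ⟨L, s, hs, hL⟩ := (hk.contDiffAt (n := 1)).exists_lipschitzOnWith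
  have hbd : ∀ᶠ y in 𝓝 p, ‖V y‖ < ‖V p‖ + 1 :=
    hVA.continuousAt.norm.eventually (gt_mem_nhds (by linarith))
  set M := ‖V p‖ + 1 with hM
  have hN : s ∩ {y | ‖V y‖ < M} ∩ (U ∩ K) ∈ 𝓝 p :=
    inter_mem (inter_mem hs hbd) (inter_mem (hU.mem_nhds hpU) hK)
  obtain ⟨r, hr, ε, hε, ψ, hψ, -⟩ := exists_local_flow_holomorphic hU hV hpU hN
  obtain ⟨a, ha, hB⟩ := Metric.mem_nhds_iff.1 hN
  refine ⟨min a r, lt_min ha hr, ε, hε, L * M, fun z hz => ?_, fun t ht htT z hz => ?_⟩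
  · have := hB (Metric.ball_subset_ball (min_le_left _ _) hz)
    exact ⟨this.2.2, this.2.1⟩
  have hzN := hB (Metric.ball_subset_ball (min_le_left _ _) hz)
  obtain ⟨hψ0, hψt⟩ := hψ z (Metric.ball_subset_ball (min_le_right _ _) hz)
  have hsub : Set.Icc 0 t ⊆ Set.Icc 0 ε := Set.Icc_subset_Icc (le_refl (0 : ℝ)) ht.2
  have hψt' : ∀ τ ∈ Set.Icc (0 : ℝ) t, ψ τ z ∈ s ∩ {y | ‖V y‖ < M} ∩ (U ∩ K) ∧
      HasDerivWithinAt (ψ · z) (V (ψ τ z)) (Set.Icc 0 t) τ := fun τ hτ =>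
    ⟨(hψt τ (hsub hτ)).1, (hψt τ (hsub hτ)).2.mono hsub⟩
  -- The local flow is known to stay where $V$ is bounded and $dh(V)$ is Lipschitz; uniqueness
  -- carries this over to $\phi$.
  have heq : φ t z = ψ t z := by
    refine solution_unique hU hV (τ := t) (γ₁ := fun t => φ t z) (γ₂ := fun t => ψ t z)
      (fun τ hτ => ?_) (fun τ hτ => ⟨(hψt' τ hτ).1.2.1, (hψt' τ hτ).2⟩) ?_ ⟨ht.1, le_rfl⟩
    · have h1 := (hφ z hzN.2.2).2 τ ⟨hτ.1, hτ.2.trans htT⟩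
      exact ⟨h1.1, h1.2.mono (Set.Icc_subset_Icc (le_refl (0 : ℝ)) htT)⟩
    · simp only [(hφ z hzN.2.2).1, hψ0]
  have hdist : ∀ τ ∈ Set.Icc (0 : ℝ) t, ‖ψ τ z - z‖ ≤ M * t := by
    intro τ hτ
    have := norm_image_sub_le_of_norm_deriv_le_segment' (f := fun τ => ψ τ z)
      (fun τ hτ => (hψt' τ hτ).2) (C := M)
      (fun τ hτ => ((hψt' τ ⟨hτ.1, hτ.2.le⟩).1.1.2 : ‖V (ψ τ z)‖ < M).le) τ hτ
    simp only [hψ0, sub_zero] at this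
    exact this.trans (mul_le_mul_of_nonneg_left hτ.2 (by positivity))
  have hder : ∀ τ ∈ Set.Icc (0 : ℝ) t, HasDerivWithinAt
      (fun τ : ℝ => h (ψ τ z) - τ * lieDeriv V h z)
      (lieDeriv V h (ψ τ z) - lieDeriv V h z) (Set.Icc 0 t) τ := by
    intro τ hτ
    have h1 := ((hh (ψ τ z)).hasFDerivAt.restrictScalars ℝ).comp_hasDerivWithinAt τ (hψt' τ hτ).2
    have h2 : HasDerivWithinAt (fun τ : ℝ => (τ : ℂ) * lieDeriv V h z) (lieDeriv V h z)
        (Set.Icc 0 t) τ := by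
      simpa using ((Complex.ofRealCLM.hasDerivAt (x := τ)).mul_const
        (lieDeriv V h z)).hasDerivWithinAt
    exact h1.sub h2
  have := norm_image_sub_le_of_norm_deriv_le_segment' hder (C := L * (M * t))
    (fun τ hτ => by
      have h3 := hψt' τ ⟨hτ.1, hτ.2.le⟩
      refine (hL.norm_sub_le h3.1.1.1 hzN.1.1).trans ?_
      exact mul_le_mul_of_nonneg_left (hdist τ ⟨hτ.1, hτ.2.le⟩) L.2) t ⟨ht.1, le_rfl⟩
  simp only [hψ0, Complex.ofReal_zero, zero_mul, sub_zero] at this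
  rw [heq]
  calc _ = ‖h (ψ t z) - t * lieDeriv V h z - h z‖ := by congr 1; ring
    _ ≤ _ := this
    _ = _ := by ring

theorem isLittleO_matrix {ι : Type*} [Fintype ι] [DecidableEq ι] {l : Filter ℝ}
    {F : ℝ → Matrix ι ι ℂ} {g : ℝ → ℝ} (h : ∀ i j, (fun t => F t i j) =o[l] g) : F =o[l] g := by
  have h1 : F = fun t => ∑ i, ∑ j, F t i j • Matrix.single i j (1 : ℂ) := by
    funext t
    conv_lhs => rw [Matrix.matrix_eq_sum_single (F t)]
    simp [Matrix.smul_single]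
  rw [h1]
  have h2 : ∀ i j, (fun t => F t i j • (Matrix.single i j (1 : ℂ) : Matrix ι ι ℂ)) =o[l] g := by
    intro i j
    refine Asymptotics.IsBigO.trans_isLittleO (Asymptotics.IsBigO.of_bound
      ‖(Matrix.single i j (1 : ℂ) : Matrix ι ι ℂ)‖ (Eventually.of_forall fun t => ?_)) (h i j)
    rw [norm_smul, mul_comm]
  exact Asymptotics.IsLittleO.fun_sum fun i _ => Asymptotics.IsLittleO.fun_sum fun j _ => h2 i j

/-- The semigroup law holds because $\phi^s$ maps points near $p$ into $K$. The generator is found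
from the uniform bound $u\circ\phi^t-u-t\,du(V)=O(t^2)$ near $p$, to which the continuity of
coordinates applies. -/
theorem IsFlowOn.compMatrix_eq_exp (hU : IsOpen U) (hV : DifferentiableOn ℂ V U)
    (hφ : IsFlowOn V U K T φ) (hK : K ∈ 𝓝 p) (hpU : p ∈ U) (hVp : V p = 0) (hT : 0 < T) (m : ℕ) :
    compMatrix p (φ T) m = NormedSpace.exp (T • lieMatrix p V m) := by
  have : Nonempty (MultiIdx d m) := ⟨⟨0, by simp⟩⟩
  have hVA : AnalyticAt ℂ V p := analyticOnNhd_of_differentiableOn hU hV p hpU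
  have hA : ∀ t ∈ Set.Icc 0 T, AnalyticAt ℂ (φ t) p := fun t ht => hφ.analyticAt hU hV ht hK
  have hfix : ∀ t ∈ Set.Icc 0 T, φ t p = p := fun t ht =>
    hφ.eq_self hU hV (mem_of_mem_nhds hK) hpU hVp ht
  refine semigroup_eq_exp (M := fun t => compMatrix p (φ t) m) hT ?_ ?_ ?_
  · have h1 : φ 0 =ᶠ[𝓝 p] fun z => z := by
      filter_upwards [hK] with z hz using (hφ z hz).1
    rw [compMatrix_congr (hA 0 ⟨le_rfl, hT.le⟩) h1]
    ext α β
    simp [compMatrix, coef_u, Matrix.one_apply]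
  · intro s t hs ht hst
    have hs' : s ∈ Set.Icc 0 T := ⟨hs, by linarith⟩
    have ht' : t ∈ Set.Icc 0 T := ⟨ht, by linarith⟩
    rw [← compMatrix_comp (hA s hs') (hfix s hs') (hA t ht')]
    refine compMatrix_congr (hA _ ⟨by linarith, hst⟩) ?_ m
    have hc : ∀ᶠ z in 𝓝 p, φ s z ∈ K :=
      (hA s hs').continuousAt.eventually (by rw [hfix s hs']; exact hK)
    filter_upwards [hK, hc] with z hz hz'
    exact hφ.add hU hV hz hs ht hst hz'
  · refine isLittleO_matrix fun α β => ?_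
    have hu := differentiable_u p β.1
    obtain ⟨r, hr, ε, hε, C, hrK, hC⟩ := hφ.exists_norm_sub_sub_le hU hV hK hpU hu
    obtain ⟨C', hC', hb⟩ := exists_bound_coef p α.1 hr
    have hO : (fun t => (compMatrix p (φ t) m - 1 - t • lieMatrix p V m) α β) =O[𝓝[>] 0]
        fun t => t ^ 2 := by
      refine Asymptotics.IsBigO.of_bound (C' * C) ?_
      filter_upwards [Ioo_mem_nhdsGT (lt_min hε hT)] with t ht
      have htT : t ≤ T := ht.2.le.trans (min_le_right _ _)
      have ht' : t ∈ Set.Icc 0 T := ⟨ht.1.le, htT⟩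
      have hl : AnalyticAt ℂ (lieDeriv V (u p β.1)) p := analyticAt_lieDeriv hVA (analyticAt_u p β.1 p)
      have h1 : AnalyticAt ℂ (fun z => u p β.1 (φ t z)) p := analyticAt_u_comp (hA t ht') β.1
      have h2 : AnalyticAt ℂ (fun z => u p β.1 (φ t z) - u p β.1 z) p :=
        h1.sub (analyticAt_u p β.1 p)
      have h3 : AnalyticAt ℂ (fun z => (t : ℂ) * lieDeriv V (u p β.1) z) p :=
        analyticAt_const.mul hl
      have e : (compMatrix p (φ t) m - 1 - t • lieMatrix p V m) α β =
          coef p α.1 fun z => u p β.1 (φ t z) - u p β.1 z - t * lieDeriv V (u p β.1) z := by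
        rw [coef_sub h2 h3, coef_sub h1 (analyticAt_u p β.1 p), coef_const_mul hl, coef_u]
        simp [compMatrix, lieMatrix, Matrix.one_apply]
      rw [e, Real.norm_of_nonneg (by positivity), mul_assoc]
      refine hb _ _ (fun z hz => ?_) fun z hz =>
        hC t ⟨ht.1.le, ht.2.le.trans (min_le_left _ _)⟩ htT z hz
      have hzK : K ∈ 𝓝 z := mem_of_superset (Metric.isOpen_ball.mem_nhds hz)
        fun y hy => (hrK hy).1
      have d1 : DifferentiableAt ℂ (fun z => u p β.1 (φ t z)) z :=
        (hu _).comp z (hφ.differentiableAt hU hV ht' hzK)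
      have d2 : DifferentiableAt ℂ (lieDeriv V (u p β.1)) z :=
        (analyticAt_lieDeriv (analyticOnNhd_of_differentiableOn hU hV z (hrK hz).2)
          (analyticAt_u p β.1 z)).differentiableAt
      exact ((d1.sub (hu z)).sub (d2.const_mul _)).differentiableWithinAt
    refine hO.trans_isLittleO ?_
    have := Asymptotics.isLittleO_pow_id (𝕜 := ℝ) one_lt_two
    exact this.mono nhdsWithin_le_nhds

/-- The matrix logarithm of the push-forward matrix of the time-`T` map. -/
theorem IsFlowOn.matLog_pushforwardMatrix (hU : IsOpen U) (hV : DifferentiableOn ℂ V U)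
    (hφ : IsFlowOn V U K T φ) (hK : K ∈ 𝓝 p) (hpU : p ∈ U) (hVp : V p = 0) (hT : 0 < T)
    (hreal : ∀ c : ℂ, Module.End.HasEigenvalue
      ((fderiv ℂ V p : CSpace d →L[ℂ] CSpace d) : CSpace d →ₗ[ℂ] CSpace d) c → c.im = 0)
    (m : ℕ) : SegmentUnit (pushforwardMatrix p (φ T) m) ∧
      matLog (pushforwardMatrix p (φ T) m) = (T : ℂ) • (lieMatrix p V m)ᴴ := by
  have : Nonempty (MultiIdx d m) := ⟨⟨0, by simp⟩⟩
  have hVA : AnalyticAt ℂ V p := analyticOnNhd_of_differentiableOn hU hV p hpU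
  have hTT : T ∈ Set.Icc 0 T := ⟨hT.le, le_rfl⟩
  have h1 : pushforwardMatrix p (φ T) m = NormedSpace.exp (T • (lieMatrix p V m)ᴴ) := by
    rw [← Matrix.conjTranspose_conjTranspose (pushforwardMatrix p (φ T) m),
      conjTranspose_pushforwardMatrix (hφ.analyticAt hU hV hTT hK)
        (hφ.eq_self hU hV (mem_of_mem_nhds hK) hpU hVp hTT),
      hφ.compMatrix_eq_exp hU hV hK hpU hVp hT, ← Matrix.exp_conjTranspose,
      Matrix.conjTranspose_smul, star_trivial]
  -- Eigenvalues of the adjoint are the conjugates of those of the Lie matrix, so they are real too.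
  have hG : ∀ (c : ℂ) (v : MultiIdx d m → ℂ), v ≠ 0 → (lieMatrix p V m)ᴴ *ᵥ v = c • v →
      c.im = 0 := by
    intro c v hv hc
    have h2 : c ∈ spectrum ℂ (lieMatrix p V m)ᴴ := by
      rw [← Matrix.spectrum_toLin', ← Module.End.hasEigenvalue_iff_mem_spectrum]
      exact Module.End.hasEigenvalue_of_hasEigenvector
        ⟨Module.End.mem_eigenspace_iff.2 (by simpa using hc), hv⟩
    have h3 : star c ∈ spectrum ℂ (lieMatrix p V m) := by
      have h4 : star c ∈ star (spectrum ℂ (lieMatrix p V m)ᴴ) := by simpa using h2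
      rw [← spectrum.map_star] at h4
      simpa [Matrix.star_eq_conjTranspose] using h4
    rw [← Matrix.spectrum_toLin', ← Module.End.hasEigenvalue_iff_mem_spectrum] at h3
    obtain ⟨w, hw⟩ := h3.exists_hasEigenvector
    have h4 := im_eq_zero_of_lieMatrix_mulVec hVA hVp hreal hw.2
      (by simpa using hw.apply_eq_smul)
    simpa using h4
  have hTG : ∀ (c : ℂ) (v : MultiIdx d m → ℂ), v ≠ 0 → (T • (lieMatrix p V m)ᴴ) *ᵥ v = c • v →
      c.im = 0 := by
    intro c v hv hc
    have h2 := hG ((T : ℂ)⁻¹ * c) v hv (by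
      rw [mul_smul, ← hc, Matrix.smul_mulVec]
      have hT0 : (T : ℂ) ≠ 0 := by exact_mod_cast hT.ne'
      exact (inv_smul_smul₀ hT0 _).symm)
    have h3 : ((T : ℂ)⁻¹ * c).im = T⁻¹ * c.im := by
      rw [← Complex.ofReal_inv, Complex.im_ofReal_mul]
    rw [h3] at h2
    exact (mul_eq_zero.1 h2).resolve_left (inv_ne_zero hT.ne')
  rw [h1]
  refine ⟨(segmentUnit_iff _).2 ?_, matLog_exp hTG⟩
  simpa using noNonposEigenvalue_exp hG T

end Generator

/-! ### Operator norms, quadratic forms and smallest eigenvalues -/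

section QuadraticForms

open scoped Matrix.Norms.L2Operator

variable {ι κ : Type*} [Fintype ι] [Fintype κ]

theorem sum_norm_mulVec_sq_le_frobenius (A : Matrix κ ι ℂ) (v : ι → ℂ) :
    ∑ i, ‖(A *ᵥ v) i‖ ^ 2 ≤ (∑ i, ∑ j, ‖A i j‖ ^ 2) * ∑ j, ‖v j‖ ^ 2 := by
  rw [Finset.sum_mul]
  refine Finset.sum_le_sum fun i _ => ?_
  calc ‖(A *ᵥ v) i‖ ^ 2 ≤ (∑ j, ‖A i j‖ * ‖v j‖) ^ 2 := by
        refine pow_le_pow_left₀ (norm_nonneg _) ?_ 2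
        simpa only [Matrix.mulVec, dotProduct, norm_mul] using
          norm_sum_le Finset.univ fun j => A i j * v j
    _ ≤ _ := Finset.sum_mul_sq_le_sq_mul_sq _ _ _

theorem star_dotProduct_self (v : ι → ℂ) : star v ⬝ᵥ v = ((∑ i, ‖v i‖ ^ 2 : ℝ) : ℂ) := by
  simp [dotProduct, Complex.conj_mul']

theorem quadForm_mul_self {A : Matrix ι ι ℂ} (hA : A.IsHermitian) (v : ι → ℂ) :
    star v ⬝ᵥ ((A * A) *ᵥ v) = ((∑ i, ‖(A *ᵥ v) i‖ ^ 2 : ℝ) : ℂ) := by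
  rw [← star_dotProduct_self, Matrix.star_mulVec, hA.eq, ← Matrix.mulVec_mulVec,
    Matrix.dotProduct_mulVec]

variable [DecidableEq ι]

theorem sum_norm_mulVec_sq_le (A : Matrix κ ι ℂ) (v : ι → ℂ) :
    ∑ i, ‖(A *ᵥ v) i‖ ^ 2 ≤ ‖A‖ ^ 2 * ∑ j, ‖v j‖ ^ 2 := by
  have h := Matrix.l2_opNorm_mulVec A (WithLp.toLp 2 v)
  have h2 := pow_le_pow_left₀ (norm_nonneg _) h 2
  rw [mul_pow, EuclideanSpace.norm_sq_eq, EuclideanSpace.norm_sq_eq] at h2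
  simpa using h2

theorem norm_le_of_sum_norm_mulVec_sq_le {A : Matrix ι ι ℂ} {c : ℝ} (hc : 0 ≤ c)
    (h : ∀ v : ι → ℂ, ∑ i, ‖(A *ᵥ v) i‖ ^ 2 ≤ c ^ 2 * ∑ j, ‖v j‖ ^ 2) : ‖A‖ ≤ c := by
  rw [Matrix.cstar_norm_def]
  refine ContinuousLinearMap.opNorm_le_bound _ hc fun x => ?_
  refine le_of_sq_le_sq ?_ (by positivity)
  rw [mul_pow, EuclideanSpace.norm_sq_eq, EuclideanSpace.norm_sq_eq]
  simpa [Matrix.ofLp_toEuclideanCLM] using h x.ofLp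

theorem norm_quadForm_le (A : Matrix ι ι ℂ) (v : ι → ℂ) :
    ‖star v ⬝ᵥ (A *ᵥ v)‖ ≤ ‖A‖ * ∑ i, ‖v i‖ ^ 2 := by
  have h1 : star v ⬝ᵥ (A *ᵥ v) =
      inner ℂ (WithLp.toLp 2 v) (Matrix.toEuclideanCLM (𝕜 := ℂ) A (WithLp.toLp 2 v)) := by
    rw [Matrix.toEuclideanCLM_toLp, EuclideanSpace.inner_toLp_toLp, dotProduct_comm]
  have h2 : ∑ i, ‖v i‖ ^ 2 = ‖WithLp.toLp 2 v‖ ^ 2 := by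
    rw [EuclideanSpace.norm_sq_eq]
  rw [h1, h2]
  calc _ ≤ ‖WithLp.toLp 2 v‖ * (‖A‖ * ‖WithLp.toLp 2 v‖) :=
        (norm_inner_le_norm _ _).trans (mul_le_mul_of_nonneg_left
          (ContinuousLinearMap.le_opNorm _ _) (norm_nonneg _))
    _ = _ := by ring

theorem norm_le_one_of_isHermitian_of_mul_self {Q : Matrix ι ι ℂ} (hQ : Q.IsHermitian)
    (hQQ : Q * Q = Q) : ‖Q‖ ≤ 1 := by
  have h := Matrix.l2_opNorm_conjTranspose_mul_self Q
  rw [hQ.eq, hQQ] at h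
  nlinarith [norm_nonneg Q]

theorem spectrum_real_finite (A : Matrix ι ι ℂ) : (spectrum ℝ A).Finite :=
  Matrix.finite_real_spectrum

theorem continuousOn_spectrum_real (A : Matrix ι ι ℂ) (g : ℝ → ℝ) :
    ContinuousOn g (spectrum ℝ A) :=
  (spectrum_real_finite A).continuousOn g

theorem minEigenvalue_le {A : Matrix ι ι ℂ} {x : ℝ} (hx : x ∈ spectrum ℝ A) :
    minEigenvalue A ≤ x :=
  csInf_le (spectrum_real_finite A).bddBelow hx

theorem minEigenvalue_mem [Nonempty ι] {A : Matrix ι ι ℂ} (hA : A.IsHermitian) :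
    minEigenvalue A ∈ spectrum ℝ A := by
  refine Set.Nonempty.csInf_mem ?_ (spectrum_real_finite A)
  rw [hA.spectrum_real_eq_range_eigenvalues]
  exact Set.range_nonempty _

/-- The functional calculus writes $A-\lambda_{\min}I$ as the square of a Hermitian matrix, so its
quadratic form is nonnegative. -/
theorem minEigenvalue_mul_le {A : Matrix ι ι ℂ} (hA : A.IsHermitian) (v : ι → ℂ) :
    minEigenvalue A * ∑ i, ‖v i‖ ^ 2 ≤ (star v ⬝ᵥ (A *ᵥ v)).re := by
  have hA' : IsSelfAdjoint A := hA
  set q := cfc (fun x : ℝ => √(x - minEigenvalue A)) A with hq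
  have hqs : q.IsHermitian := (cfc_predicate (fun x : ℝ => √(x - minEigenvalue A)) A : IsSelfAdjoint _)
  have hqq : q * q = A - (minEigenvalue A : ℂ) • 1 := by
    rw [hq, ← cfc_mul _ _ A (continuousOn_spectrum_real A _) (continuousOn_spectrum_real A _)]
    have h1 : cfc (fun x : ℝ => √(x - minEigenvalue A) * √(x - minEigenvalue A)) A =
        cfc (fun x : ℝ => x - minEigenvalue A) A := cfc_congr fun x hx =>
      Real.mul_self_sqrt (sub_nonneg.2 (minEigenvalue_le hx))
    rw [h1, cfc_sub _ _ A (continuousOn_spectrum_real A _) (continuousOn_spectrum_real A _),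
      cfc_id' ℝ A, cfc_const _ A, Algebra.algebraMap_eq_smul_one, Complex.coe_smul]
  have h2 := congrArg Complex.re (quadForm_mul_self hqs v)
  rw [hqq, Matrix.sub_mulVec, Matrix.smul_mulVec, Matrix.one_mulVec, dotProduct_sub, dotProduct_smul,
    star_dotProduct_self, Complex.sub_re, smul_eq_mul, ← Complex.ofReal_mul, Complex.ofReal_re,
    Complex.ofReal_re] at h2
  have h3 : 0 ≤ ∑ i, ‖(q *ᵥ v) i‖ ^ 2 := by positivity
  linarith

theorem exists_mulVec_eq_of_mem_spectrum {A : Matrix ι ι ℂ} {x : ℝ} (hx : x ∈ spectrum ℝ A) :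
    ∃ v : ι → ℂ, v ≠ 0 ∧ A *ᵥ v = (x : ℂ) • v := by
  rw [spectrum.mem_iff, Matrix.isUnit_iff_isUnit_det, isUnit_iff_ne_zero, not_not] at hx
  obtain ⟨v, hv, h⟩ := Matrix.exists_mulVec_eq_zero_iff.2 hx
  refine ⟨v, hv, ?_⟩
  rw [Algebra.algebraMap_eq_smul_one, ← Complex.coe_smul, Matrix.sub_mulVec, Matrix.smul_mulVec, Matrix.one_mulVec,
    sub_eq_zero] at h
  exact h.symm

theorem minEigenvalue_nonneg [Nonempty ι] {A : Matrix ι ι ℂ} (hA : A.IsHermitian)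
    (hpos : ∀ v : ι → ℂ, 0 ≤ (star v ⬝ᵥ (A *ᵥ v)).re) : 0 ≤ minEigenvalue A := by
  obtain ⟨v, hv, h⟩ := exists_mulVec_eq_of_mem_spectrum (minEigenvalue_mem hA)
  have h1 := hpos v
  rw [h, dotProduct_smul, star_dotProduct_self, smul_eq_mul, ← Complex.ofReal_mul,
    Complex.ofReal_re] at h1
  have h2 : 0 < ∑ i, ‖v i‖ ^ 2 := by
    obtain ⟨i, hi⟩ := Function.ne_iff.1 hv
    exact Finset.sum_pos' (fun _ _ => by positivity)
      ⟨i, Finset.mem_univ i, by have := norm_pos_iff.2 hi; positivity⟩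
  exact nonneg_of_mul_nonneg_left h1 h2

theorem minEigenvalue_pos [Nonempty ι] {A : Matrix ι ι ℂ} (hA : A.IsHermitian)
    (hpos : ∀ v : ι → ℂ, 0 ≤ (star v ⬝ᵥ (A *ᵥ v)).re) (hu : IsUnit A) : 0 < minEigenvalue A := by
  refine lt_of_le_of_ne (minEigenvalue_nonneg hA hpos) fun h0 => ?_
  have hmem := minEigenvalue_mem hA
  rw [← h0] at hmem
  exact spectrum.zero_notMem ℝ hu hmem

/-- A matrix close to `A` relative to `A` itself is bounded below by the smallest eigenvalue
of `A`. -/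
theorem mul_minEigenvalue_le_of_opNorm_le {A B : Matrix ι ι ℂ} (hA : A.IsHermitian)
    (hpos : 0 < minEigenvalue A) {γ : ℝ} (hγ : 0 ≤ γ)
    (h : opNorm (1 - invSqrt A * B * invSqrt A) ≤ 1 - γ) (v : ι → ℂ) :
    γ * minEigenvalue A * ∑ i, ‖v i‖ ^ 2 ≤ (star v ⬝ᵥ (B *ᵥ v)).re := by
  have hA' : IsSelfAdjoint A := hA
  have hc := continuousOn_spectrum_real A
  set q := cfc (fun x : ℝ => √x) A with hq
  have hqs : q.IsHermitian := (cfc_predicate (fun x : ℝ => √x) A : IsSelfAdjoint _)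
  have hss : (invSqrt A).IsHermitian := (cfc_predicate (fun x : ℝ => (√x)⁻¹) A : IsSelfAdjoint _)
  have hqq : q * q = A := by
    rw [hq, ← cfc_mul _ _ A (hc _) (hc _)]
    have h1 : cfc (fun x : ℝ => √x * √x) A = cfc (fun x : ℝ => x) A := cfc_congr fun x hx =>
      Real.mul_self_sqrt (hpos.le.trans (minEigenvalue_le hx))
    rw [h1, cfc_id' ℝ A]
  have hsq : invSqrt A * q = 1 := by
    rw [hq, invSqrt, ← cfc_mul _ _ A (hc _) (hc _)]
    have h1 : cfc (fun x : ℝ => (√x)⁻¹ * √x) A = cfc (fun _ : ℝ => (1 : ℝ)) A :=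
      cfc_congr fun x hx => inv_mul_cancel₀
        (Real.sqrt_pos.2 (hpos.trans_le (minEigenvalue_le hx))).ne'
    rw [h1, cfc_const_one ℝ A]
  set S := invSqrt A
  -- With $w=A^{1/2}v$ the hypothesis reads $\|w\|^2-v^*Bv\le(1-\gamma)\|w\|^2$, while
  -- $\|w\|^2=v^*Av$ is at least the smallest eigenvalue times $\|v\|^2$.
  set w := q *ᵥ v with hw
  have hSw : S *ᵥ w = v := by rw [hw, Matrix.mulVec_mulVec, hsq, Matrix.one_mulVec]
  clear_value w
  have h1 := (Complex.re_le_norm _).trans ((norm_quadForm_le (1 - S * B * S) w).trans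
    (mul_le_mul_of_nonneg_right h (by positivity)))
  have h2 : star w ⬝ᵥ ((S * B * S) *ᵥ w) = star v ⬝ᵥ (B *ᵥ v) := by
    rw [← Matrix.mulVec_mulVec, hSw, ← Matrix.mulVec_mulVec, Matrix.dotProduct_mulVec]
    congr 1
    rw [← hSw, Matrix.star_mulVec, hss.eq]
  rw [Matrix.sub_mulVec, Matrix.one_mulVec, dotProduct_sub, h2, star_dotProduct_self, Complex.sub_re,
    Complex.ofReal_re] at h1
  have h3 := minEigenvalue_mul_le hA v
  rw [← hqq, quadForm_mul_self hqs, Complex.ofReal_re, hqq, ← hw] at h3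
  have h4 := mul_le_mul_of_nonneg_left h3 hγ
  nlinarith

theorem mul_minEigenvalue_le_of_norm_sub_le {A B : Matrix ι ι ℂ} (hA : A.IsHermitian)
    (h : ‖A - B‖ ≤ minEigenvalue A / 2) (v : ι → ℂ) :
    minEigenvalue A / 2 * ∑ i, ‖v i‖ ^ 2 ≤ (star v ⬝ᵥ (B *ᵥ v)).re := by
  have h1 := (Complex.re_le_norm _).trans ((norm_quadForm_le (A - B) v).trans
    (mul_le_mul_of_nonneg_right h (by positivity)))
  rw [Matrix.sub_mulVec, dotProduct_sub, Complex.sub_re] at h1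
  have h2 := minEigenvalue_mul_le hA v
  linarith

end QuadraticForms

/-! ### Least squares approximation of the push-forward matrix -/

section LeastSquares

open scoped Matrix.Norms.L2Operator

theorem multiFactorial_pos {d : ℕ} (α : Fin d → ℕ) : 0 < multiFactorial α :=
  Finset.prod_pos fun _ _ => Nat.factorial_pos _

theorem multiFactorial_le {d m : ℕ} {α : Fin d → ℕ} (hα : ∑ i, α i ≤ m) :
    multiFactorial α ≤ m.factorial :=
  (Nat.le_of_dvd (Nat.factorial_pos _) (Nat.prod_factorial_dvd_factorial_sum _ _)).trans
    (Nat.factorial_le hα)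

variable {d m n N : ℕ} {p : CSpace d} {f : CSpace d → CSpace d}

/-- The remainder of the `n`-jet at `p` of `u_{p,β} ∘ f`. -/
noncomputable def jetRemainder (p : CSpace d) (f : CSpace d → CSpace d) (n : ℕ) (β : Fin d → ℕ)
    (z : CSpace d) : ℂ :=
  u p β (f z) - ∑ α : MultiIdx d n, coef p α.1 (fun z => u p β (f z)) * u p α.1 z

theorem norm_exp_inner_ge {L : ℝ} {z : CSpace d} (h : ‖p‖ * ‖z‖ ≤ L) :
    Real.exp (-L) ≤ ‖Complex.exp (inner ℂ p z)‖ := by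
  rw [Complex.norm_exp]
  refine Real.exp_le_exp.2 ?_
  have := (Complex.abs_re_le_norm _).trans ((norm_inner_le_norm p z).trans h)
  exact (abs_le.1 this).1

theorem norm_exp_inner_le {L : ℝ} {z : CSpace d} (h : ‖p‖ * ‖z‖ ≤ L) :
    ‖Complex.exp (inner ℂ p z)‖ ≤ Real.exp L := by
  rw [Complex.norm_exp]
  refine Real.exp_le_exp.2 ?_
  have := (Complex.abs_re_le_norm _).trans ((norm_inner_le_norm p z).trans h)
  exact (abs_le.1 this).2

/-- Passing from monomials to $u_{p,\alpha}$ divides coefficients by $\sqrt{\alpha!}$. Only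
components with $|\alpha|\le m$ are kept on the left, and there $\alpha!\le m!$; this is why $m!$,
and not $n!$, enters the error bound. -/
theorem sum_sq_sampleMatrix_ge {L lam : ℝ} (hlam : 0 ≤ lam) (hmn : m ≤ n) {z₀ : Fin N → CSpace d}
    (hL : ∀ k, ‖p‖ * ‖p + z₀ k‖ ≤ L)
    (hlow : ∀ a : MultiIdx d n → ℂ, lam * ∑ α, ‖a α‖ ^ 2 ≤
      ∑ k, ‖∑ α, a α * mono (z₀ k) α.1‖ ^ 2) (w : MultiIdx d n → ℂ) :
    Real.exp (-(L + ‖p‖ ^ 2 / 2)) ^ 2 * (lam / m.factorial) *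
      ∑ α : MultiIdx d m, ‖w (MultiIdx.incl hmn α)‖ ^ 2 ≤
      ∑ k, ‖(sampleMatrix p n (fun k => p + z₀ k) *ᵥ w) k‖ ^ 2 := by
  set a : MultiIdx d n → ℂ := fun α => w α * (((√(multiFactorial α.1 : ℝ))⁻¹ : ℝ) : ℂ) with ha
  have h1 : ∀ k, Real.exp (-(L + ‖p‖ ^ 2 / 2)) ^ 2 * ‖∑ α, a α * mono (z₀ k) α.1‖ ^ 2 ≤
      ‖(sampleMatrix p n (fun k => p + z₀ k) *ᵥ w) k‖ ^ 2 := by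
    intro k
    have e : (sampleMatrix p n (fun k => p + z₀ k) *ᵥ w) k =
        (Real.exp (-‖p‖ ^ 2 / 2) : ℂ) * Complex.exp (inner ℂ p (p + z₀ k)) *
          ∑ α, a α * mono (z₀ k) α.1 := by
      simp only [sampleMatrix, Matrix.mulVec, dotProduct, Matrix.of_apply, u, add_sub_cancel_left,
        Finset.mul_sum, ha]
      refine Finset.sum_congr rfl fun α _ => ?_
      push_cast
      ring
    rw [e, ← mul_pow, norm_mul, norm_mul, Complex.norm_real, Real.norm_of_nonneg (Real.exp_pos _).le]
    have h2 : Real.exp (-(L + ‖p‖ ^ 2 / 2)) = Real.exp (-‖p‖ ^ 2 / 2) * Real.exp (-L) := by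
      rw [← Real.exp_add]; congr 1; ring
    rw [h2]
    gcongr
    exact norm_exp_inner_ge (hL k)
  have h3 : (lam / m.factorial) * ∑ α : MultiIdx d m, ‖w (MultiIdx.incl hmn α)‖ ^ 2 ≤
      lam * ∑ α, ‖a α‖ ^ 2 := by
    rw [div_mul_eq_mul_div, mul_div_assoc]
    refine mul_le_mul_of_nonneg_left ?_ hlam
    have hinj : Function.Injective (MultiIdx.incl (d := d) hmn) := fun α β h =>
      Subtype.ext (congrArg (fun a : MultiIdx d n => a.1) h)
    calc (∑ α : MultiIdx d m, ‖w (MultiIdx.incl hmn α)‖ ^ 2) / m.factorial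
        ≤ ∑ α : MultiIdx d m, ‖a (MultiIdx.incl hmn α)‖ ^ 2 := by
          rw [Finset.sum_div]
          refine Finset.sum_le_sum fun α _ => ?_
          have h4 : (0 : ℝ) < multiFactorial α.1 := by exact_mod_cast multiFactorial_pos α.1
          have h5 : (multiFactorial α.1 : ℝ) ≤ m.factorial := by
            exact_mod_cast multiFactorial_le α.2
          have h6 : ‖a (MultiIdx.incl hmn α)‖ ^ 2 =
              ‖w (MultiIdx.incl hmn α)‖ ^ 2 / multiFactorial α.1 := by
            rw [ha]
            simp only [norm_mul, Complex.norm_real, norm_inv, mul_pow, inv_pow, Real.norm_eq_abs,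
              sq_abs, MultiIdx.incl]
            rw [Real.sq_sqrt h4.le]
            rfl
          rw [h6]
          gcongr
      _ = ∑ α ∈ Finset.univ.map ⟨_, hinj⟩, ‖a α‖ ^ 2 := by simp
      _ ≤ ∑ α, ‖a α‖ ^ 2 := Finset.sum_le_sum_of_subset_of_nonneg (Finset.subset_univ _)
          fun _ _ _ => by positivity
  calc _ ≤ Real.exp (-(L + ‖p‖ ^ 2 / 2)) ^ 2 * ∑ k, ‖∑ α, a α * mono (z₀ k) α.1‖ ^ 2 := by
        rw [mul_assoc]
        exact mul_le_mul_of_nonneg_left (h3.trans (hlow a)) (by positivity)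
    _ ≤ _ := by
        rw [Finset.mul_sum]
        exact Finset.sum_le_sum fun k _ => h1 k

/-- Error bound for the least squares approximation of the push-forward matrix. -/
theorem opNorm_pushforwardMatrix_sub_approxMatrix_le (hf : AnalyticAt ℂ f p) (hfp : f p = p)
    (hmn : m ≤ n) {L lam : ℝ} (hlam : 0 < lam) {z₀ : Fin N → CSpace d}
    (hL : ∀ k, ‖p‖ * ‖p + z₀ k‖ ≤ L)
    (hlow : ∀ a : MultiIdx d n → ℂ, lam * ∑ α, ‖a α‖ ^ 2 ≤
      ∑ k, ‖∑ α, a α * mono (z₀ k) α.1‖ ^ 2) :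
    opNorm (pushforwardMatrix p f m - approxMatrix p f hmn fun k => p + z₀ k) ≤
      Real.exp (L + ‖p‖ ^ 2 / 2) * √(m.factorial / lam) *
        √(∑ k, ∑ β : MultiIdx d m, ‖jetRemainder p f n β.1 (p + z₀ k)‖ ^ 2) := by
  set Z : Fin N → CSpace d := fun k => p + z₀ k with hZ
  set A := sampleMatrix p n Z with hA
  set P := pinv Aᴴ with hP
  set J : Matrix (MultiIdx d n) (MultiIdx d m) ℂ :=
    Matrix.of fun α β => coef p α.1 fun z => u p β.1 (f z) with hJ
  set R : Matrix (Fin N) (MultiIdx d m) ℂ :=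
    Matrix.of fun k β => jetRemainder p f n β.1 (p + z₀ k) with hR
  set S := ∑ k, ∑ β : MultiIdx d m, ‖jetRemainder p f n β.1 (p + z₀ k)‖ ^ 2 with hS
  have hS0 : 0 ≤ S := by positivity
  have hlowA := sum_sq_sampleMatrix_ge hlam.le hmn hL hlow
  obtain ⟨h1, h2, h3, h4⟩ := pinv_penrose Aᴴ
  -- The same lower bound with all indices up to $n$ kept shows that the samples determine the
  -- coefficients.
  have hinj : ∀ w, A *ᵥ w = 0 → w = 0 := by
    intro w hw
    have h5 := sum_sq_sampleMatrix_ge hlam.le le_rfl hL hlow w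
    rw [← hZ, ← hA, hw] at h5
    have h6 : 0 < Real.exp (-(L + ‖p‖ ^ 2 / 2)) ^ 2 * (lam / n.factorial) := by positivity
    have h7 : ∑ α : MultiIdx d n, ‖w α‖ ^ 2 ≤ 0 := by
      have : ∑ α : MultiIdx d n, ‖w (MultiIdx.incl le_rfl α)‖ ^ 2 = ∑ α, ‖w α‖ ^ 2 := rfl
      rw [this] at h5
      simp only [Pi.zero_apply, norm_zero, ne_eq, OfNat.ofNat_ne_zero, not_false_eq_true, zero_pow,
        Finset.sum_const_zero] at h5
      by_contra! hcon
      exact absurd (mul_pos h6 hcon) (not_lt.2 h5)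
    have h8 := (Finset.sum_eq_zero_iff_of_nonneg fun α _ => by positivity).1
      (le_antisymm h7 (by positivity))
    funext α
    simpa using h8 α (Finset.mem_univ α)
  -- The Penrose equation gives $A(P^*A-I)=0$, and $A$ is injective.
  have hPA : Pᴴ * A = 1 := by
    have h5 : A * (Pᴴ * A - 1) = 0 := by
      have := congrArg Matrix.conjTranspose h1
      simp only [Matrix.conjTranspose_mul, Matrix.conjTranspose_conjTranspose] at this
      rw [Matrix.mul_sub, Matrix.mul_one, this, sub_self]
    ext α β
    have h6 := hinj (fun α => (Pᴴ * A - 1 : Matrix (MultiIdx d n) (MultiIdx d n) ℂ) α β) (by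
      funext k
      exact congrFun (congrFun h5 k) β)
    exact sub_eq_zero.1 (congrFun h6 α)
  -- $AP^*$ is an orthogonal projection. Fitted values are thus no larger than the data, and no
  -- separate bound on the pseudo-inverse is needed.
  have hAP : ∀ y : Fin N → ℂ, ∑ k, ‖(A *ᵥ (Pᴴ *ᵥ y)) k‖ ^ 2 ≤ ∑ k, ‖y k‖ ^ 2 := by
    intro y
    have e1 : A * Pᴴ = P * Aᴴ := by
      have := h4.eq
      simpa only [Matrix.conjTranspose_mul, Matrix.conjTranspose_conjTranspose] using this
    have e2 : ‖P * Aᴴ‖ ≤ 1 := by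
      refine norm_le_one_of_isHermitian_of_mul_self h4 ?_
      rw [← Matrix.mul_assoc, h2]
    rw [Matrix.mulVec_mulVec, e1]
    refine (sum_norm_mulVec_sq_le _ y).trans ?_
    exact mul_le_of_le_one_left (by positivity) (pow_le_one₀ (norm_nonneg _) e2)
  -- Samples of $u_{p,\beta}\circ f$ are samples of its $n$-jet plus the remainder. Since $P^*A=I$,
  -- the jet coefficients come back exactly, and the error is $P^*R$ restricted to rows with
  -- $|\alpha|\le m$.
  have hV : sampleMatrix (f p) m (f ∘ Z) = A * J + R := by
    ext k β
    simp only [sampleMatrix, hA, hJ, hR, jetRemainder, Matrix.add_apply, Matrix.mul_apply,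
      Matrix.of_apply, hfp, Function.comp, hZ]
    simp only [mul_comm (u p _ _)]
    ring
  have hdiff : (pushforwardMatrix p f m - approxMatrix p f hmn Z)ᴴ =
      -(Pᴴ * R).submatrix (MultiIdx.incl hmn) id := by
    rw [Matrix.conjTranspose_sub, conjTranspose_pushforwardMatrix hf hfp, approxMatrix,
      Matrix.conjTranspose_submatrix, Matrix.conjTranspose_mul, Matrix.conjTranspose_conjTranspose,
      hV, Matrix.mul_add, ← Matrix.mul_assoc, hPA, Matrix.one_mul]
    ext α β
    simp only [compMatrix, hJ, MultiIdx.incl, Matrix.sub_apply, Matrix.submatrix_apply,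
      Matrix.add_apply, Matrix.of_apply, Matrix.neg_apply, id, sub_add_cancel_left]
    rfl
  have hfact : (0 : ℝ) < m.factorial := by positivity
  rw [opNorm_eq_norm, ← Matrix.l2_opNorm_conjTranspose, hdiff, norm_neg]
  refine norm_le_of_sum_norm_mulVec_sq_le (by positivity) fun v => ?_
  have h5 := hlowA (Pᴴ *ᵥ (R *ᵥ v))
  have h6 := hAP (R *ᵥ v)
  have h7 := sum_norm_mulVec_sq_le_frobenius R v
  have h8 : Real.exp (-(L + ‖p‖ ^ 2 / 2)) ^ 2 * (lam / m.factorial) *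
      ∑ α : MultiIdx d m, ‖(Pᴴ *ᵥ (R *ᵥ v)) (MultiIdx.incl hmn α)‖ ^ 2 ≤ S * ∑ j, ‖v j‖ ^ 2 :=
    h5.trans (h6.trans h7)
  have h9 : ∀ α : MultiIdx d m, ((Pᴴ * R).submatrix (MultiIdx.incl hmn) id *ᵥ v) α =
      (Pᴴ *ᵥ (R *ᵥ v)) (MultiIdx.incl hmn α) := by
    intro α
    rw [Matrix.mulVec_mulVec]
    rfl
  simp only [h9]
  rw [mul_pow, mul_pow, Real.sq_sqrt hS0, Real.sq_sqrt (by positivity)]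
  have h10 : Real.exp (-(L + ‖p‖ ^ 2 / 2)) * Real.exp (L + ‖p‖ ^ 2 / 2) = 1 := by
    rw [← Real.exp_add, neg_add_cancel, Real.exp_zero]
  set E := Real.exp (L + ‖p‖ ^ 2 / 2)
  set E' := Real.exp (-(L + ‖p‖ ^ 2 / 2))
  set X := ∑ α : MultiIdx d m, ‖(Pᴴ *ᵥ (R *ᵥ v)) (MultiIdx.incl hmn α)‖ ^ 2
  calc X = (E' * E) ^ 2 * ((lam / m.factorial) * (m.factorial / lam)) * X := by
        rw [h10]; field_simp
    _ = E ^ 2 * (m.factorial / lam) * (E' ^ 2 * (lam / m.factorial) * X) := by ring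
    _ ≤ E ^ 2 * (m.factorial / lam) * (S * ∑ j, ‖v j‖ ^ 2) := by gcongr
    _ = _ := by ring

end LeastSquares

/-! ### Bounds for the basis functions, uniform in the order -/

section Bounds

variable {d : ℕ} {p : CSpace d}

/-- A bound for `|u_{p,β}|` on the ball of radius `F` around `p`. -/
noncomputable def uBound (p : CSpace d) (F : ℝ) (β : Fin d → ℕ) : ℝ :=
  Real.exp (‖p‖ * (F + ‖p‖)) * (F ^ (∑ i, β i) / √(multiFactorial β : ℝ))

/-- A bound for the sum of the squares of `uBound`. -/
noncomputable def uTotal (p : CSpace d) (F : ℝ) : ℝ :=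
  Real.exp (‖p‖ * (F + ‖p‖)) ^ 2 * Real.exp (d * F ^ 2)

theorem uTotal_pos (p : CSpace d) (F : ℝ) : 0 < uTotal p F := by
  unfold uTotal; positivity

theorem norm_mono_le {w : CSpace d} {F : ℝ} (hw : ‖w‖ ≤ F) (β : Fin d → ℕ) :
    ‖mono w β‖ ≤ F ^ (∑ i, β i) := by
  rw [mono, norm_prod, ← Finset.prod_pow_eq_pow_sum]
  refine Finset.prod_le_prod (fun _ _ => norm_nonneg _) fun i _ => ?_
  rw [norm_pow]
  exact pow_le_pow_left₀ (norm_nonneg _) ((PiLp.norm_apply_le w i).trans hw) _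

theorem norm_u_le {z : CSpace d} {F : ℝ} (hz : ‖z - p‖ ≤ F) (β : Fin d → ℕ) :
    ‖u p β z‖ ≤ uBound p F β := by
  have h1 : (0 : ℝ) < √(multiFactorial β : ℝ) :=
    Real.sqrt_pos.2 (by exact_mod_cast multiFactorial_pos β)
  have h2 : ‖p‖ * ‖z‖ ≤ ‖p‖ * (F + ‖p‖) := by
    refine mul_le_mul_of_nonneg_left ?_ (norm_nonneg _)
    calc ‖z‖ = ‖(z - p) + p‖ := by rw [sub_add_cancel]
      _ ≤ F + ‖p‖ := (norm_add_le _ _).trans (by gcongr)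
  have h3 : Real.exp (-‖p‖ ^ 2 / 2) ≤ 1 := Real.exp_le_one_iff.2 (by nlinarith [sq_nonneg ‖p‖])
  rw [u, norm_mul, norm_mul, Complex.norm_real, Real.norm_of_nonneg (by positivity), uBound]
  have hF : 0 ≤ F := (norm_nonneg _).trans hz
  calc _ ≤ 1 / √(multiFactorial β : ℝ) * F ^ (∑ i, β i) * Real.exp (‖p‖ * (F + ‖p‖)) := by
        gcongr
        · exact norm_mono_le hz β
        · exact norm_exp_inner_le h2
    _ = _ := by ring

/-- The multinomial identity at the constant vector $(F,\dots,F)$ gives $\sum_\beta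
F^{2|\beta|}/\beta!$ as a partial sum of $e^{dF^2}$. The weights $1/\sqrt{\beta!}$ are what makes
the bound independent of $m$. -/
theorem sum_uBound_sq_le (p : CSpace d) (F : ℝ) (m : ℕ) :
    ∑ β : MultiIdx d m, uBound p F β.1 ^ 2 ≤ uTotal p F := by
  let a : CSpace d := WithLp.toLp 2 fun _ => (F : ℂ)
  have h1 := sum_mono_mul_mono m a a
  have h2 : ∀ β : Fin d → ℕ, mono a β = ((F ^ (∑ i, β i) : ℝ) : ℂ) := fun β => by
    simp [mono, a, Finset.prod_pow_eq_pow_sum]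
  have h3 : ∑ i : Fin d, a i * a i = ((d * F ^ 2 : ℝ) : ℂ) := by
    simp [a, sq]
  simp only [h2, h3] at h1
  have h4 : ∑ β : MultiIdx d m, (multiFactorial β.1 : ℝ)⁻¹ *
      (F ^ (∑ i, β.1 i) * F ^ (∑ i, β.1 i)) =
      ∑ k ∈ Finset.range (m + 1), (d * F ^ 2) ^ k / (k.factorial : ℝ) := by exact_mod_cast h1
  have h5 : ∑ β : MultiIdx d m, uBound p F β.1 ^ 2 = Real.exp (‖p‖ * (F + ‖p‖)) ^ 2 *
      ∑ β : MultiIdx d m, (multiFactorial β.1 : ℝ)⁻¹ *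
        (F ^ (∑ i, β.1 i) * F ^ (∑ i, β.1 i)) := by
    rw [Finset.mul_sum]
    refine Finset.sum_congr rfl fun β _ => ?_
    rw [uBound, mul_pow, div_pow, Real.sq_sqrt (by positivity)]
    ring
  rw [h5, h4, uTotal]
  exact mul_le_mul_of_nonneg_left (Real.sum_le_exp_of_nonneg (by positivity) _) (by positivity)

theorem uBound_nonneg {F : ℝ} (hF : 0 ≤ F) (β : Fin d → ℕ) : 0 ≤ uBound p F β := by
  unfold uBound; positivity

theorem sum_norm_u_sq_le {z : CSpace d} {F : ℝ} (hz : ‖z - p‖ ≤ F) (m : ℕ) :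
    ∑ β : MultiIdx d m, ‖u p β.1 z‖ ^ 2 ≤ uTotal p F :=
  (Finset.sum_le_sum fun β _ => pow_le_pow_left₀ (norm_nonneg _) (norm_u_le hz β.1) 2).trans
    (sum_uBound_sq_le p F m)

/-- Cauchy's estimate on discs of radius $1$ about $0$, which lie within distance $\|p\|+1$ of $p$.
-/
theorem sum_norm_pderiv_u_sq_le (p : CSpace d) (i : Fin d) (m : ℕ) :
    ∑ β : MultiIdx d m, ‖conj (pderiv i (u p β.1) 0)‖ ^ 2 ≤ uTotal p (‖p‖ + 1) := by
  refine (Finset.sum_le_sum fun β _ => pow_le_pow_left₀ (norm_nonneg _) ?_ 2).trans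
    (sum_uBound_sq_le p _ m)
  rw [RCLike.norm_conj, pderiv]
  have := norm_fderiv_apply_le (f := u p β.1) (x := 0) (v := EuclideanSpace.single i (1 : ℂ))
    one_pos (fun s _ => differentiable_u p β.1 _) (M := uBound p (‖p‖ + 1) β.1) fun s hs => by
      refine norm_u_le ?_ β.1
      rw [zero_add]
      refine (norm_sub_le _ _).trans ?_
      rw [norm_smul, PiLp.norm_single, norm_one, mul_one]
      linarith
  simpa using this

theorem gauge_eq_zero_of_isCompact {K : Set (CSpace d)} (hKc : IsCompact K) (hK0 : K ∈ 𝓝 0)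
    {x : CSpace d} (hx : gauge K x ≤ 0) : x = 0 :=
  (gauge_eq_zero (absorbent_nhds_zero hK0)
    (NormedSpace.isVonNBounded_of_isBounded ℝ hKc.isBounded)).1
    (le_antisymm hx (gauge_nonneg _))

/-- Remainder estimate for the jets of the functions `u_{p,β} ∘ f`. -/
theorem sum_norm_jetRemainder_sq_le {K : Set (CSpace d)} (hK : IsAbsConvex K) (hKc : IsCompact K)
    (hK0 : K ∈ 𝓝 0) {f : CSpace d → CSpace d} (hf : AnalyticAt ℂ f p)
    (hd : ∀ x ∈ interior K, DifferentiableAt ℂ f (p + x)) {F L : ℝ}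
    (hF : ∀ x ∈ interior K, ‖f (p + x) - p‖ ≤ F) (hL : ∀ x ∈ interior K, ‖p‖ * ‖p + x‖ ≤ L)
    (m n : ℕ) {R : ℝ} (hR0 : 0 ≤ R) (hR1 : R < 1) {x : CSpace d} (hx : gauge K x ≤ R) :
    ∑ β : MultiIdx d m, ‖jetRemainder p f n β.1 (p + x)‖ ^ 2 ≤
      (Real.exp (2 * L) * √(uTotal p F) * R ^ n / (1 - R)) ^ 2 := by
  have hR' : 0 < 1 - R := by linarith
  have h1 : ∀ β : Fin d → ℕ, ‖jetRemainder p f n β (p + x)‖ ≤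
      Real.exp (2 * L) * uBound p F β * R ^ (n + 1) / (1 - R) := fun β =>
    norm_sub_sum_coef_le hK hK0 (h := fun z => u p β (f z))
      (fun y hy => (differentiable_u p β _).comp _ (hd y hy)) (analyticAt_u_comp hf β)
      (fun y hy => norm_u_le (hF y hy) β) hL n hR0 hR1 hx
      (fun hR => gauge_eq_zero_of_isCompact hKc hK0 (hx.trans hR.le))
  have hF0 : 0 ≤ F := (norm_nonneg _).trans (hF 0 (mem_interior_iff_mem_nhds.2 hK0))
  calc _ ≤ ∑ β : MultiIdx d m, (Real.exp (2 * L) * R ^ n / (1 - R)) ^ 2 * uBound p F β.1 ^ 2 := by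
        refine Finset.sum_le_sum fun β _ => ?_
        rw [← mul_pow]
        refine pow_le_pow_left₀ (norm_nonneg _) ((h1 β.1).trans ?_) 2
        have h2 := uBound_nonneg (p := p) hF0 β.1
        calc _ ≤ Real.exp (2 * L) * uBound p F β.1 * R ^ n / (1 - R) := by
              gcongr ?_ * ?_ / ?_
              exact pow_le_pow_of_le_one hR0 hR1.le (Nat.le_succ n)
          _ = _ := by ring
    _ ≤ (Real.exp (2 * L) * R ^ n / (1 - R)) ^ 2 * uTotal p F := by
        rw [← Finset.mul_sum]
        exact mul_le_mul_of_nonneg_left (sum_uBound_sq_le p F m) (by positivity)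
    _ = _ := by
        rw [← Real.sq_sqrt (uTotal_pos p F).le, ← mul_pow]
        rw [Real.sqrt_sq (Real.sqrt_nonneg _)]
        ring

end Bounds

/-! ### From the matrix logarithm to the vector field -/

section Field

open scoped Matrix.Norms.L2Operator

variable {d : ℕ} {p : CSpace d} {V : CSpace d → CSpace d}

/-- The vector holds the coordinates of $z_i$ by `coef_coord`, and the derivative of $z_i$ along $V$
is $V_i$. -/
theorem lieMatrix_mulVec_conj_pderiv (hV : AnalyticAt ℂ V p) (hVp : V p = 0) {m : ℕ} (i : Fin d)
    (α : MultiIdx d m) :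
    (lieMatrix p V m *ᵥ fun β : MultiIdx d m => conj (pderiv i (u p β.1) 0)) α =
      coef p α.1 fun z => V z i := by
  have h1 : AnalyticAt ℂ (fun z : CSpace d => z i) p :=
    (EuclideanSpace.proj i : CSpace d →L[ℂ] ℂ).analyticAt p
  have h2 := coef_lieDeriv hV hVp h1 α
  simp only [coef_coord] at h2
  have h3 : lieDeriv V (fun z : CSpace d => z i) = fun z => V z i := by
    funext z
    have : fderiv ℂ (fun z : CSpace d => z i) z = EuclideanSpace.proj i :=
      (EuclideanSpace.proj i : CSpace d →L[ℂ] ℂ).fderiv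
    rw [lieDeriv, this]
    rfl
  rw [h3] at h2
  exact h2.symm

/-- With the exact logarithm the reconstruction equals the $m$-jet of $V_i$. The reconstruction is
real-linear in the logarithm, so the difference is a pairing of two vectors bounded independently of
$m$ through the logarithm error, estimated by Cauchy–Schwarz. -/
theorem norm_reconstructedField_sub_le (hV : AnalyticAt ℂ V p) (hVp : V p = 0) {m : ℕ} {T : ℝ}
    (hT : 0 < T) {C D : Matrix (MultiIdx d m) (MultiIdx d m) ℂ}
    (hC : matLog C = (T : ℂ) • (lieMatrix p V m)ᴴ) {z : CSpace d} {F : ℝ} (hz : ‖z - p‖ ≤ F)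
    (i : Fin d) :
    ‖reconstructedField p T D z i - ∑ α : MultiIdx d m, coef p α.1 (fun z => V z i) * u p α.1 z‖ ≤
      √(uTotal p F) * √(uTotal p (‖p‖ + 1)) * (T⁻¹ * ‖matLog D - matLog C‖) := by
  have hT0 : (T : ℂ) ≠ 0 := by exact_mod_cast hT.ne'
  set b : MultiIdx d m → ℂ := fun β => conj (pderiv i (u p β.1) 0) with hb
  set E : Matrix (MultiIdx d m) (MultiIdx d m) ℂ := (T : ℂ)⁻¹ • (matLog D - matLog C) with hE
  have hEn : ‖Eᴴ‖ = T⁻¹ * ‖matLog D - matLog C‖ := by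
    rw [Matrix.l2_opNorm_conjTranspose, hE, norm_smul, norm_inv, Complex.norm_real,
      Real.norm_of_nonneg hT.le]
  have h1 : reconstructedField p T D z i -
      ∑ α : MultiIdx d m, coef p α.1 (fun z => V z i) * u p α.1 z =
      ∑ α : MultiIdx d m, u p α.1 z * (Eᴴ *ᵥ b) α := by
    have h2 : ((T : ℂ)⁻¹ • matLog D)ᴴ = Eᴴ + lieMatrix p V m := by
      rw [hE, hC, smul_sub, inv_smul_smul₀ hT0, Matrix.conjTranspose_sub,
        Matrix.conjTranspose_conjTranspose, sub_add_cancel]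
    have h3 : reconstructedField p T D z i =
        ∑ α : MultiIdx d m, u p α.1 z * ((((T : ℂ)⁻¹ • matLog D)ᴴ *ᵥ b) α) := rfl
    rw [h3, h2, ← Finset.sum_sub_distrib]
    refine Finset.sum_congr rfl fun α _ => ?_
    rw [Matrix.add_mulVec, Pi.add_apply, lieMatrix_mulVec_conj_pderiv hV hVp i α]
    ring
  rw [h1]
  refine abs_le_of_sq_le_sq' ?_ (by positivity) |>.2
  have h4 := sum_norm_mulVec_sq_le Eᴴ b
  have h5 := sum_norm_pderiv_u_sq_le p i m
  have h6 := sum_norm_u_sq_le hz m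
  calc ‖∑ α : MultiIdx d m, u p α.1 z * (Eᴴ *ᵥ b) α‖ ^ 2
      ≤ (∑ α : MultiIdx d m, ‖u p α.1 z‖ * ‖(Eᴴ *ᵥ b) α‖) ^ 2 := by
        refine pow_le_pow_left₀ (norm_nonneg _) ?_ 2
        simpa only [norm_mul] using
          norm_sum_le Finset.univ fun α : MultiIdx d m => u p α.1 z * (Eᴴ *ᵥ b) α
    _ ≤ (∑ α : MultiIdx d m, ‖u p α.1 z‖ ^ 2) * ∑ α, ‖(Eᴴ *ᵥ b) α‖ ^ 2 :=
        Finset.sum_mul_sq_le_sq_mul_sq _ _ _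
    _ ≤ uTotal p F * (‖Eᴴ‖ ^ 2 * uTotal p (‖p‖ + 1)) := by
        refine mul_le_mul h6 (h4.trans ?_) (by positivity) (uTotal_pos p F).le
        exact mul_le_mul_of_nonneg_left h5 (by positivity)
    _ = _ := by
        rw [hEn, mul_pow (√(uTotal p F) * _), mul_pow √(uTotal p F),
          Real.sq_sqrt (uTotal_pos p F).le, Real.sq_sqrt (uTotal_pos p _).le]
        ring

variable {U K : Set (CSpace d)} {T : ℝ} {φ : ℝ → CSpace d → CSpace d}

theorem image_add_mem_nhds {x : CSpace d} (hx : x ∈ interior K) :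
    (fun z => p + z) '' K ∈ 𝓝 (p + x) := by
  have h := (Homeomorph.addLeft p).isOpenMap.image_mem_nhds (mem_interior_iff_mem_nhds.1 hx)
  exact h

theorem image_add_mem_nhds_self (hK0 : K ∈ 𝓝 0) : (fun z => p + z) '' K ∈ 𝓝 p := by
  have h := image_add_mem_nhds (p := p) (mem_interior_iff_mem_nhds.2 hK0)
  rwa [add_zero] at h

/-- Error of the reconstructed field in terms of the error of the matrix logarithm. -/
theorem IsFlowOn.exists_norm_reconstructedField_sub_le (hK : IsAbsConvex K) (hKc : IsCompact K)
    (hK0 : K ∈ 𝓝 0) (hU : IsOpen U) (hKU : (fun z => p + z) '' K ⊆ U)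
    (hV : DifferentiableOn ℂ V U) (hVp : V p = 0)
    (hreal : ∀ c : ℂ, Module.End.HasEigenvalue
      ((fderiv ℂ V p : CSpace d →L[ℂ] CSpace d) : CSpace d →ₗ[ℂ] CSpace d) c → c.im = 0)
    (hT : 0 < T) (hφ : IsFlowOn V U ((fun z => p + z) '' K) T φ) :
    ∃ C₁ : ℝ, 0 < C₁ ∧ ∀ (m : ℕ) (D : Matrix (MultiIdx d m) (MultiIdx d m) ℂ) (R : ℝ), 0 ≤ R →
      R < 1 → ∀ x : CSpace d, gauge K x ≤ R →
      ‖reconstructedField p T D (p + x) - V (p + x)‖ ≤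
        C₁ * (‖matLog D - matLog (pushforwardMatrix p (φ T) m)‖ + R ^ m / (1 - R)) := by
  have hpK : (fun z => p + z) '' K ∈ 𝓝 p := image_add_mem_nhds_self hK0
  have hpU : p ∈ U := hKU (mem_of_mem_nhds hpK)
  have hVA : AnalyticAt ℂ V p := analyticOnNhd_of_differentiableOn hU hV p hpU
  obtain ⟨ρ, hρ⟩ := hKc.isBounded.exists_norm_le
  have hKp : IsCompact ((fun z => p + z) '' K) := hKc.image (by fun_prop)
  obtain ⟨M, hM⟩ := hKp.exists_bound_of_continuousOn (hV.continuousOn.mono hKU)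
  have hM0 : 0 ≤ M := (norm_nonneg _).trans (hM p (mem_of_mem_nhds hpK))
  set L := ‖p‖ * (‖p‖ + ρ) with hLdef
  set A := √(uTotal p ρ) * √(uTotal p (‖p‖ + 1)) * T⁻¹ with hA
  set B := Real.exp (2 * L) * M with hB
  have hA0 : 0 ≤ A := by positivity
  have hB0 : 0 ≤ B := by positivity
  -- The factor $d$ comes from summing over coordinates; the extra $1$ keeps the constant positive,
  -- including when $d=0$.
  refine ⟨d * (A + B) + 1, by positivity, fun m D R hR0 hR1 x hx => ?_⟩
  have hR' : 0 < 1 - R := by linarith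
  have hxK : x ∈ interior K :=
    (gauge_lt_one_iff_mem_interior hK.convex hK0).1 (hx.trans_lt hR1)
  obtain ⟨-, hlog⟩ := hφ.matLog_pushforwardMatrix hU hV hpK hpU hVp hT hreal m
  set Q := ‖matLog D - matLog (pushforwardMatrix p (φ T) m)‖ + R ^ m / (1 - R) with hQ
  have hQ1 : ‖matLog D - matLog (pushforwardMatrix p (φ T) m)‖ ≤ Q :=
    le_add_of_nonneg_right (by positivity)
  have hQ2 : R ^ m / (1 - R) ≤ Q := le_add_of_nonneg_left (norm_nonneg _)
  have hi : ∀ i : Fin d, ‖(reconstructedField p T D (p + x) - V (p + x)) i‖ ≤ (A + B) * Q := by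
    intro i
    have hcoord : ∀ z ∈ U, AnalyticAt ℂ (fun z => V z i) z := fun z hz =>
      ((EuclideanSpace.proj i : CSpace d →L[ℂ] ℂ).analyticAt _).comp
        (analyticOnNhd_of_differentiableOn hU hV z hz)
    have h1 := norm_reconstructedField_sub_le hVA hVp hT (D := D) hlog (z := p + x) (F := ρ)
      (by rw [add_sub_cancel_left]; exact hρ x (interior_subset hxK)) i
    have h2 := norm_sub_sum_coef_le hK hK0 (p := p) (h := fun z => V z i) (M := M) (L := L)
      (fun y hy => (hcoord _ (hKU ⟨y, interior_subset hy, rfl⟩)).differentiableAt) (hcoord p hpU)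
      (fun y hy => (PiLp.norm_apply_le _ i).trans (hM _ ⟨y, interior_subset hy, rfl⟩))
      (fun y hy => mul_le_mul_of_nonneg_left ((norm_add_le _ _).trans
        (by gcongr; exact hρ y (interior_subset hy))) (norm_nonneg _)) m hR0 hR1 hx
      (fun hR => gauge_eq_zero_of_isCompact hKc hK0 (hx.trans hR.le))
    set S := ∑ α : MultiIdx d m, coef p α.1 (fun z => V z i) * u p α.1 (p + x)
    have h3 : Real.exp (2 * L) * M * R ^ (m + 1) / (1 - R) ≤ B * (R ^ m / (1 - R)) := by
      rw [← hB, mul_div_assoc]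
      gcongr ?_ * (?_ / ?_)
      exact pow_le_pow_of_le_one hR0 hR1.le (Nat.le_succ m)
    calc _ = ‖(reconstructedField p T D (p + x) i - S) - (V (p + x) i - S)‖ := by
          rw [sub_sub_sub_cancel_right]; rfl
      _ ≤ A * ‖matLog D - matLog (pushforwardMatrix p (φ T) m)‖ + B * (R ^ m / (1 - R)) := by
          refine (norm_sub_le _ _).trans (add_le_add (h1.trans_eq ?_) (h2.trans h3))
          rw [hA]; ring
      _ ≤ A * Q + B * Q := by gcongr
      _ = _ := by ring
  have hQ0 : 0 ≤ Q := (norm_nonneg _).trans hQ1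
  calc ‖reconstructedField p T D (p + x) - V (p + x)‖
      ≤ ∑ i, ‖(reconstructedField p T D (p + x) - V (p + x)) i‖ := by
        set v := reconstructedField p T D (p + x) - V (p + x)
        have hv : v = ∑ i, v i • EuclideanSpace.single i (1 : ℂ) := by
          ext i
          simp [Pi.single_apply]
        conv_lhs => rw [hv]
        refine (norm_sum_le _ _).trans (Finset.sum_le_sum fun i _ => ?_)
        rw [norm_smul, PiLp.norm_single, norm_one, mul_one]
    _ ≤ ∑ _i : Fin d, (A + B) * Q := Finset.sum_le_sum fun i _ => hi i
    _ = d * (A + B) * Q := by simp; ring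
    _ ≤ _ := by nlinarith

end Field

/-! ### The Minkowski functional on compact subsets -/

section Gauge

variable {d : ℕ} {K S : Set (CSpace d)}

theorem supGauge_nonneg (K S : Set (CSpace d)) : 0 ≤ supGauge K S :=
  Real.sSup_nonneg (by rintro _ ⟨x, _, rfl⟩; exact gauge_nonneg _)

theorem gauge_le_supGauge (hS : S ⊆ K) {x : CSpace d} (hx : x ∈ S) :
    gauge K x ≤ supGauge K S :=
  le_csSup ⟨1, by rintro _ ⟨y, hy, rfl⟩; exact gauge_le_one_of_mem (hS hy)⟩ ⟨x, hx, rfl⟩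

theorem supGauge_lt_one (hK : IsAbsConvex K) (hK0 : K ∈ 𝓝 0) (hSc : IsCompact S)
    (hS : S ⊆ interior K) : supGauge K S < 1 := by
  rcases S.eq_empty_or_nonempty with rfl | hne
  · simp [supGauge]
  · obtain ⟨x, hx, h⟩ := hSc.exists_sSup_image_eq hne (continuous_gauge hK.convex hK0).continuousOn
    rw [supGauge, h]
    exact (gauge_lt_one_iff_mem_interior hK.convex hK0).2 (hS hx)

end Gauge

/-! ### Moment matrices and empirical measures -/

section Moments

variable {d : ℕ}

theorem integral_empirical {E : Type*} [NormedAddCommGroup E] [NormedSpace ℝ E] [CompleteSpace E]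
    {N : ℕ} (z : Fin N → CSpace d) (g : CSpace d → E) :
    ∫ x, g x ∂(empirical z) = (N : ℝ)⁻¹ • ∑ k, g (z k) := by
  rw [empirical, integral_smul_measure, integral_finsetSum_measure fun k _ => integrable_dirac
    (by simp)]
  simp

theorem integrable_empirical {E : Type*} [NormedAddCommGroup E] {N : ℕ} (hN : 0 < N)
    (z : Fin N → CSpace d) (g : CSpace d → E) : Integrable g (empirical z) := by
  refine Integrable.smul_measure ?_ (by simp [hN.ne'])
  exact integrable_finsetSum_measure.2 fun k _ => integrable_dirac (by simp)

theorem integrable_of_continuousOn {E : Type*} [NormedAddCommGroup E] {μ : Measure (CSpace d)}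
    [IsFiniteMeasure μ] {K : Set (CSpace d)} (hK : IsCompact K) (hμ : μ Kᶜ = 0)
    {g : CSpace d → E} (hg : ContinuousOn g K) : Integrable g μ := by
  have h := hg.integrableOn_compact (μ := μ) hK
  rwa [IntegrableOn, Measure.restrict_eq_self_of_ae_mem (mem_ae_iff.2 hμ)] at h

theorem continuous_mono (α : Fin d → ℕ) : Continuous fun x : CSpace d => mono x α := by
  unfold mono; fun_prop

theorem isHermitian_momentMatrix (n : ℕ) (μ : Measure (CSpace d)) :
    (momentMatrix n μ).IsHermitian := by
  ext α β
  simp only [momentMatrix, Matrix.conjTranspose_apply, Matrix.of_apply]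
  rw [← starRingEnd_apply, ← integral_conj]
  simp [mul_comm]

theorem quadForm_momentMatrix {n : ℕ} {μ : Measure (CSpace d)}
    (hμ : ∀ α β : MultiIdx d n, Integrable (fun x => conj (mono x α.1) * mono x β.1) μ)
    (a : MultiIdx d n → ℂ) :
    (star a ⬝ᵥ (momentMatrix n μ *ᵥ a)).re = ∫ x, ‖∑ α, a α * mono x α.1‖ ^ 2 ∂μ := by
  have h1 : star a ⬝ᵥ (momentMatrix n μ *ᵥ a) =
      ∫ x, ((‖∑ α, a α * mono x α.1‖ ^ 2 : ℝ) : ℂ) ∂μ := by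
    have h2 : ∀ x : CSpace d, ((‖∑ α, a α * mono x α.1‖ ^ 2 : ℝ) : ℂ) =
        ∑ α : MultiIdx d n, ∑ β : MultiIdx d n,
          conj (a α) * a β * (conj (mono x α.1) * mono x β.1) := by
      intro x
      rw [Complex.ofReal_pow, ← Complex.conj_mul', map_sum, Finset.sum_mul_sum]
      refine Finset.sum_congr rfl fun α _ => Finset.sum_congr rfl fun β _ => ?_
      rw [map_mul]
      ring
    simp only [h2]
    rw [integral_finsetSum _ fun α _ => integrable_finsetSum _ fun β _ => (hμ α β).const_mul _]
    simp only [dotProduct, Matrix.mulVec, Pi.star_apply, momentMatrix, Matrix.of_apply]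
    refine Finset.sum_congr rfl fun α _ => ?_
    rw [integral_finsetSum _ fun β _ => (hμ α β).const_mul _, Finset.mul_sum]
    refine Finset.sum_congr rfl fun β _ => ?_
    rw [integral_const_mul, starRingEnd_apply]
    ring
  rw [h1, integral_complex_ofReal, Complex.ofReal_re]

theorem re_quadForm_momentMatrix_nonneg {n : ℕ} {μ : Measure (CSpace d)}
    (hμ : ∀ α β : MultiIdx d n, Integrable (fun x => conj (mono x α.1) * mono x β.1) μ)
    (a : MultiIdx d n → ℂ) : 0 ≤ (star a ⬝ᵥ (momentMatrix n μ *ᵥ a)).re := by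
  rw [quadForm_momentMatrix hμ]
  exact integral_nonneg fun x => by positivity

/-- The moment form of the empirical measure is the mean of the squared polynomial values at the
samples; the factor $N$ undoes the averaging. -/
theorem le_sum_norm_sq_of_empirical {n N : ℕ} (hN : 0 < N) {z : Fin N → CSpace d} {c : ℝ}
    (hc : ∀ a : MultiIdx d n → ℂ, c * ∑ α, ‖a α‖ ^ 2 ≤
      (star a ⬝ᵥ (momentMatrix n (empirical z) *ᵥ a)).re) (a : MultiIdx d n → ℂ) :
    N * c * ∑ α, ‖a α‖ ^ 2 ≤ ∑ k, ‖∑ α, a α * mono (z k) α.1‖ ^ 2 := by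
  have h := hc a
  rw [quadForm_momentMatrix fun α β => integrable_empirical hN _ _, integral_empirical,
    smul_eq_mul] at h
  have hN' : (0 : ℝ) < N := by exact_mod_cast hN
  rw [mul_assoc]
  rwa [le_inv_mul_iff₀ hN'] at h

end Moments

/-! ### The error bound for given samples -/

section Flow

variable {d : ℕ} {p : CSpace d} {V : CSpace d → CSpace d} {U K : Set (CSpace d)} {T : ℝ}
  {φ : ℝ → CSpace d → CSpace d}

/-- Error of the least squares approximation of the push-forward matrix of a flow. -/
theorem IsFlowOn.exists_opNorm_sub_approxMatrix_le (hKc : IsCompact K) (hK0 : K ∈ 𝓝 0)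
    (hU : IsOpen U) (hKU : (fun z => p + z) '' K ⊆ U) (hV : DifferentiableOn ℂ V U)
    (hVp : V p = 0) (hT : 0 < T) (hφ : IsFlowOn V U ((fun z => p + z) '' K) T φ) :
    ∃ C₂ : ℝ, 0 < C₂ ∧ ∀ (m n : ℕ) (hmn : m ≤ n) (N : ℕ), 0 < N → ∀ z₀ : Fin N → CSpace d,
      (∀ k, z₀ k ∈ K) → ∀ c S : ℝ, 0 < c → 0 ≤ S →
      (∀ a : MultiIdx d n → ℂ, c * ∑ α, ‖a α‖ ^ 2 ≤
        (star a ⬝ᵥ (momentMatrix n (empirical z₀) *ᵥ a)).re) →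
      (N : ℝ)⁻¹ * ∑ k, ∑ β : MultiIdx d m, ‖jetRemainder p (φ T) n β.1 (p + z₀ k)‖ ^ 2 ≤ S ^ 2 →
      opNorm (pushforwardMatrix p (φ T) m - approxMatrix p (φ T) hmn fun k => p + z₀ k) ≤
        C₂ * (√(m.factorial / c) * S) := by
  have hpK : (fun z => p + z) '' K ∈ 𝓝 p := image_add_mem_nhds_self hK0
  have hpU : p ∈ U := hKU (mem_of_mem_nhds hpK)
  obtain ⟨ρ, hρ⟩ := hKc.isBounded.exists_norm_le
  refine ⟨Real.exp (‖p‖ * (‖p‖ + ρ) + ‖p‖ ^ 2 / 2), Real.exp_pos _,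
    fun m n hmn N hN z₀ hz c S hc hS hq hS2 => ?_⟩
  have hN' : (0 : ℝ) < N := by exact_mod_cast hN
  have hTT : T ∈ Set.Icc 0 T := ⟨hT.le, le_rfl⟩
  have h := opNorm_pushforwardMatrix_sub_approxMatrix_le (hφ.analyticAt hU hV hTT hpK)
    (hφ.eq_self hU hV (mem_of_mem_nhds hpK) hpU hVp hTT) hmn (L := ‖p‖ * (‖p‖ + ρ))
    (mul_pos hN' hc) (fun k => mul_le_mul_of_nonneg_left ((norm_add_le _ _).trans
      (by gcongr; exact hρ _ (hz k))) (norm_nonneg _)) (le_sum_norm_sq_of_empirical hN hq)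
  refine h.trans ?_
  rw [mul_assoc]
  refine mul_le_mul_of_nonneg_left ?_ (Real.exp_pos _).le
  rw [← Real.sqrt_mul (by positivity), ← Real.sqrt_sq hS, ← Real.sqrt_mul (by positivity)]
  refine Real.sqrt_le_sqrt ?_
  calc _ = m.factorial / c * ((N : ℝ)⁻¹ *
        ∑ k, ∑ β : MultiIdx d m, ‖jetRemainder p (φ T) n β.1 (p + z₀ k)‖ ^ 2) := by
        field_simp
    _ ≤ _ := by gcongr

/-- Compactness of $p+K$ bounds $\phi^T$ there, so the remainder estimate holds with a constant that
depends on neither $m$, $n$ nor the point. -/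
theorem IsFlowOn.exists_sum_norm_jetRemainder_sq_le (hK : IsAbsConvex K) (hKc : IsCompact K)
    (hK0 : K ∈ 𝓝 0) (hU : IsOpen U) (hV : DifferentiableOn ℂ V U)
    (hT : 0 < T) (hφ : IsFlowOn V U ((fun z => p + z) '' K) T φ) :
    ∃ C₃ : ℝ, 0 < C₃ ∧ ∀ (m n : ℕ) (R : ℝ), 0 ≤ R → R < 1 → ∀ x : CSpace d, gauge K x ≤ R →
      ∑ β : MultiIdx d m, ‖jetRemainder p (φ T) n β.1 (p + x)‖ ^ 2 ≤
        (C₃ * R ^ n / (1 - R)) ^ 2 := by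
  have hpK : (fun z => p + z) '' K ∈ 𝓝 p := image_add_mem_nhds_self hK0
  obtain ⟨ρ, hρ⟩ := hKc.isBounded.exists_norm_le
  have hTT : T ∈ Set.Icc 0 T := ⟨hT.le, le_rfl⟩
  have hKp : IsCompact ((fun z => p + z) '' K) := hKc.image (by fun_prop)
  obtain ⟨F, hF⟩ := hKp.exists_bound_of_continuousOn
    ((hφ.continuousOn hU hV hTT).sub (continuousOn_const (c := p)))
  have hu := uTotal_pos p F
  refine ⟨Real.exp (2 * (‖p‖ * (‖p‖ + ρ))) * √(uTotal p F), by positivity,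
    fun m n R hR0 hR1 x hx => ?_⟩
  exact sum_norm_jetRemainder_sq_le hK hKc hK0 (hφ.analyticAt hU hV hTT hpK)
    (fun y hy => hφ.differentiableAt hU hV hTT (image_add_mem_nhds hy))
    (fun y hy => hF _ ⟨y, interior_subset hy, rfl⟩)
    (fun y hy => mul_le_mul_of_nonneg_left ((norm_add_le _ _).trans
      (by gcongr; exact hρ _ (interior_subset hy))) (norm_nonneg _)) m n hR0 hR1 hx

open scoped Matrix.Norms.L2Operator in
-- The hypothesis on the moment matrices gives the lower bound $\gamma_1\Lambda_n(\mu)$ for the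
-- empirical form, hence the least squares error. The logarithm turns this into $B_m^2/\gamma_2$
-- times as much, and the truncation error of $V$ is added.
theorem IsFlowOn.error_bound (hK : IsAbsConvex K) (hKc : IsCompact K)
    (hK0 : K ∈ 𝓝 0) (hU : IsOpen U) (hKU : (fun z => p + z) '' K ⊆ U)
    (hV : DifferentiableOn ℂ V U) (hVp : V p = 0)
    (hreal : ∀ c : ℂ, Module.End.HasEigenvalue
      ((fderiv ℂ V p : CSpace d →L[ℂ] CSpace d) : CSpace d →ₗ[ℂ] CSpace d) c → c.im = 0)
    (hT : 0 < T) (hφ : IsFlowOn V U ((fun z => p + z) '' K) T φ) (μ : Measure (CSpace d))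
    (hμ : IsFiniteMeasure μ) (hμK : μ.support ⊆ interior K) (K₁ : Set (CSpace d))
    (hK₁ : IsCompact K₁) (hK₁K : K₁ ⊆ interior K) :
    ∃ C' : ℝ, 0 < C' ∧
      ∀ (m n : ℕ) (hmn : m ≤ n) (N : ℕ), 0 < N →
      ∀ z₀ : Fin N → CSpace d, (∀ k, z₀ k ∈ μ.support) →
      ∀ γ₁ ∈ Set.Ioo (0 : ℝ) 1, ∀ γ₂ ∈ Set.Ioo (0 : ℝ) 1,
        IsUnit (momentMatrix n μ) →
        opNorm (1 - invSqrt (momentMatrix n μ) * momentMatrix n (empirical z₀) *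
          invSqrt (momentMatrix n μ)) ≤ 1 - γ₁ →
        opNorm (pushforwardMatrix p (φ T) m - approxMatrix p (φ T) hmn (fun k => p + z₀ k)) <
          (1 - γ₂) * (resolventBound (pushforwardMatrix p (φ T) m))⁻¹ →
        NoNonposEigenvalue (approxMatrix p (φ T) hmn (fun k => p + z₀ k)) ∧
        ∀ z ∈ K₁,
          ‖reconstructedField p T (approxMatrix p (φ T) hmn (fun k => p + z₀ k)) (p + z) -
              V (p + z)‖ ≤
            C' * (‖p‖ ^ m / √((m - 1).factorial : ℝ) +
              resolventBound (pushforwardMatrix p (φ T) m) ^ 2 / γ₂ *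
                √((m.factorial : ℝ) / γ₁) *
                (supGauge K μ.support ^ n / √(minEigenvalue (momentMatrix n μ))) +
              supGauge K K₁ ^ m) := by
  have hpK : (fun z => p + z) '' K ∈ 𝓝 p := image_add_mem_nhds_self hK0
  have hpU : p ∈ U := hKU (mem_of_mem_nhds hpK)
  obtain ⟨C₁, hC₁, hfield⟩ :=
    hφ.exists_norm_reconstructedField_sub_le hK hKc hK0 hU hKU hV hVp hreal hT
  obtain ⟨C₂, hC₂, happrox⟩ := hφ.exists_opNorm_sub_approxMatrix_le hKc hK0 hU hKU hV hVp hT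
  obtain ⟨C₃, hC₃, hrem⟩ := hφ.exists_sum_norm_jetRemainder_sq_le hK hKc hK0 hU hV hT
  have hμc : IsCompact μ.support :=
    hKc.of_isClosed_subset Measure.isClosed_support (hμK.trans interior_subset)
  have hR0 := supGauge_nonneg K μ.support
  have hR1 := supGauge_lt_one hK hK0 hμc hμK
  have hR0' := supGauge_nonneg K K₁
  have hR1' := supGauge_lt_one hK hK0 hK₁ hK₁K
  set R := supGauge K μ.support with hR
  set R₁ := supGauge K K₁ with hR₁
  have hRp : 0 < 1 - R := by linarith
  have hRp' : 0 < 1 - R₁ := by linarith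
  -- The geometric factors of the two Taylor remainders, on the support and on $K_1$, are absorbed
  -- here; both are finite because these compact sets lie in the interior.
  refine ⟨C₁ * (C₂ * C₃ / (1 - R) + 1 / (1 - R₁)), by positivity, ?_⟩
  intro m n hmn N hN z₀ hz γ₁ hγ₁ γ₂ hγ₂ hunit h1 h2
  have : Nonempty (MultiIdx d m) := ⟨⟨0, by simp⟩⟩
  have : Nonempty (MultiIdx d n) := ⟨⟨0, by simp⟩⟩
  obtain ⟨hseg, hlog⟩ := hφ.matLog_pushforwardMatrix hU hV hpK hpU hVp hT hreal m
  have hγ₁0 := hγ₁.1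
  have hγ₂0 := hγ₂.1
  have hB := hseg.one_le_resolventBound
  set Cm := pushforwardMatrix p (φ T) m with hCm
  set Ch := approxMatrix p (φ T) hmn fun k => p + z₀ k with hCh
  have hint : ∀ α β : MultiIdx d n, Integrable (fun x => conj (mono x α.1) * mono x β.1) μ :=
    fun α β => integrable_of_continuousOn hμc Measure.measure_compl_support
      ((continuous_mono α.1).star.mul (continuous_mono β.1)).continuousOn
  have hΛ : 0 < minEigenvalue (momentMatrix n μ) :=
    minEigenvalue_pos (isHermitian_momentMatrix n μ) (re_quadForm_momentMatrix_nonneg hint) hunit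
  set Λ := minEigenvalue (momentMatrix n μ) with hΛd
  have h3 : opNorm (Cm - Ch) ≤ C₂ * (√(m.factorial / (γ₁ * Λ)) * (C₃ * R ^ n / (1 - R))) := by
    refine happrox m n hmn N hN z₀ (fun k => interior_subset (hμK (hz k))) _ _ (by positivity)
      (by positivity) (mul_minEigenvalue_le_of_opNorm_le (isHermitian_momentMatrix n μ) hΛ hγ₁0.le
        h1) ?_
    have hN' : (0 : ℝ) < N := by exact_mod_cast hN
    rw [inv_mul_le_iff₀ hN']
    refine (Finset.sum_le_sum fun k _ => hrem m n R hR0 hR1 (z₀ k)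
      (gauge_le_supGauge (hμK.trans interior_subset) (hz k))).trans ?_
    simp
  have h4 : ‖Cm - Ch‖ ≤ (1 - γ₂) * (resolventBound Cm)⁻¹ := h2.le
  obtain ⟨hsegD, -⟩ := hseg.perturb hγ₂0 h4
  refine ⟨(segmentUnit_iff _).1 hsegD, fun z hzK => ?_⟩
  have h5 := norm_matLog_sub_le hseg hγ₂0 h4
  refine (hfield m Ch R₁ hR0' hR1' z
    (gauge_le_supGauge (hK₁K.trans interior_subset) hzK)).trans ?_
  have hmsqrt : 0 < √(m.factorial / γ₁ : ℝ) := by positivity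
  set X := ‖p‖ ^ m / √((m - 1).factorial : ℝ) with hX
  set Y := resolventBound Cm ^ 2 / γ₂ * √((m.factorial : ℝ) / γ₁) * (R ^ n / √Λ) with hY
  have hX0 : 0 ≤ X := by positivity
  have hY0 : 0 ≤ Y := by positivity
  have h6 : ‖matLog Ch - matLog Cm‖ ≤ C₂ * C₃ / (1 - R) * Y := by
    rw [norm_sub_rev]
    refine h5.trans ((mul_le_mul_of_nonneg_left h3 (by positivity)).trans_eq ?_)
    rw [hY, ← div_div, Real.sqrt_div (by positivity)]
    field_simp
  rw [mul_assoc]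
  refine mul_le_mul_of_nonneg_left ?_ hC₁.le
  have h7 : 0 ≤ R₁ ^ m := by positivity
  have h8 : 0 ≤ C₂ * C₃ / (1 - R) := by positivity
  have h9 : 0 ≤ 1 / (1 - R₁) := by positivity
  -- The summand `X` enters only through its sign: coordinates of $z_i$ up to order $m$ determine
  -- the $m$-jet of $V_i$ exactly, so no error of this kind arises.
  calc _ ≤ C₂ * C₃ / (1 - R) * Y + 1 / (1 - R₁) * R₁ ^ m := by
        rw [div_eq_mul_one_div (R₁ ^ m), mul_comm (R₁ ^ m)]
        gcongr
    _ ≤ C₂ * C₃ / (1 - R) * (X + Y + R₁ ^ m) + 1 / (1 - R₁) * (X + Y + R₁ ^ m) := by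
        gcongr <;> linarith
    _ = _ := by ring

end Flow

/-! ### The limit of infinitely many samples -/

section Limit

variable {d : ℕ} {K : Set (CSpace d)} {μ : Measure (CSpace d)} {z₀ : ℕ → CSpace d}

/-- All measures involved live on the compact set $K$, so Tietze's extension of $g|_K$ to a bounded
continuous function has the same integrals. -/
theorem tendsto_integral_empirical [IsFiniteMeasure μ] (hK : IsCompact K) (hμ : μ Kᶜ = 0)
    (hz : ∀ k, z₀ k ∈ K)
    (hw : ∀ g : CSpace d →ᵇ ℝ, Tendsto
      (fun N : ℕ => ∫ x, g x ∂(empirical fun k : Fin N => z₀ k)) atTop (𝓝 (∫ x, g x ∂μ)))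
    {g : CSpace d → ℝ} (hg : ContinuousOn g K) :
    Tendsto (fun N : ℕ => ∫ x, g x ∂(empirical fun k : Fin N => z₀ k)) atTop
      (𝓝 (∫ x, g x ∂μ)) := by
  have : CompactSpace K := isCompact_iff_compactSpace.1 hK
  obtain ⟨G, -, hG⟩ := BoundedContinuousFunction.exists_norm_eq_domRestrict_eq_of_closed
    (BoundedContinuousFunction.mkOfCompact ⟨K.domRestrict g, hg.domRestrict⟩) hK.isClosed
  have hGg : ∀ x ∈ K, G x = g x := fun x hx =>
    congrArg (fun F : K →ᵇ ℝ => F ⟨x, hx⟩) hG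
  have h1 : ∫ x, G x ∂μ = ∫ x, g x ∂μ := by
    refine integral_congr_ae ?_
    filter_upwards [mem_ae_iff.2 hμ] with x hx using hGg x hx
  have h2 := hw G
  rw [h1] at h2
  refine h2.congr fun N => ?_
  rw [integral_empirical, integral_empirical]
  simp only [hGg _ (hz _)]

theorem tendsto_momentMatrix_empirical [IsFiniteMeasure μ] (hK : IsCompact K) (hμ : μ Kᶜ = 0)
    (hz : ∀ k, z₀ k ∈ K)
    (hw : ∀ g : CSpace d →ᵇ ℝ, Tendsto
      (fun N : ℕ => ∫ x, g x ∂(empirical fun k : Fin N => z₀ k)) atTop (𝓝 (∫ x, g x ∂μ)))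
    (n : ℕ) :
    Tendsto (fun N : ℕ => momentMatrix n (empirical fun k : Fin N => z₀ k)) atTop
      (𝓝 (momentMatrix n μ)) := by
  refine tendsto_pi_nhds.2 fun α => tendsto_pi_nhds.2 fun β => ?_
  have hc : Continuous fun x : CSpace d => conj (mono x α.1) * mono x β.1 :=
    (continuous_mono α.1).star.mul (continuous_mono β.1)
  have h1 := tendsto_integral_empirical hK hμ hz hw (Complex.continuous_re.comp hc).continuousOn
  have h2 := tendsto_integral_empirical hK hμ hz hw (Complex.continuous_im.comp hc).continuousOn
  have h3 := ((Complex.continuous_ofReal.tendsto _).comp h1).add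
    (((Complex.continuous_ofReal.tendsto _).comp h2).mul_const Complex.I)
  have e : ∀ ν : Measure (CSpace d), Integrable (fun x => conj (mono x α.1) * mono x β.1) ν →
      momentMatrix n ν α β =
        ((∫ x, (conj (mono x α.1) * mono x β.1).re ∂ν : ℝ) : ℂ) +
        ((∫ x, (conj (mono x α.1) * mono x β.1).im ∂ν : ℝ) : ℂ) * Complex.I := fun ν hν =>
    (integral_re_add_im hν).symm
  rw [e μ (integrable_of_continuousOn hK hμ hc.continuousOn)]
  refine h3.congr' ?_
  filter_upwards [eventually_gt_atTop 0] with N hN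
  exact (e _ (integrable_empirical hN _ _)).symm

theorem integrable_conj_mono_mul_mono [IsFiniteMeasure μ] (hK : IsCompact K) (hμ : μ Kᶜ = 0)
    (n : ℕ) (α β : MultiIdx d n) : Integrable (fun x => conj (mono x α.1) * mono x β.1) μ :=
  integrable_of_continuousOn hK hμ
    ((continuous_mono α.1).star.mul (continuous_mono β.1)).continuousOn

theorem minEigenvalue_momentMatrix_nonneg [IsFiniteMeasure μ] (hK : IsCompact K) (hμ : μ Kᶜ = 0)
    (n : ℕ) : 0 ≤ minEigenvalue (momentMatrix n μ) := by
  have : Nonempty (MultiIdx d n) := ⟨⟨0, by simp⟩⟩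
  exact minEigenvalue_nonneg (isHermitian_momentMatrix n μ)
    (re_quadForm_momentMatrix_nonneg (integrable_conj_mono_mul_mono hK hμ n))

/-- The constant polynomial $1$ is a unit test vector of integral $1$. -/
theorem minEigenvalue_momentMatrix_le_one [IsProbabilityMeasure μ] (hK : IsCompact K)
    (hμ : μ Kᶜ = 0) (n : ℕ) : minEigenvalue (momentMatrix n μ) ≤ 1 := by
  have h := minEigenvalue_mul_le (isHermitian_momentMatrix n μ)
    (Pi.single (⟨0, by simp⟩ : MultiIdx d n) 1)
  rw [quadForm_momentMatrix (integrable_conj_mono_mul_mono hK hμ n)] at h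
  simpa [Pi.single_apply, apply_ite, ite_pow, mono] using h

/-- Growth of the smallest eigenvalues of the moment matrices, from the lower limit of their
roots. -/
theorem eventually_pow_le_sqrt_minEigenvalue [IsProbabilityMeasure μ] (hK : IsCompact K)
    (hμ : μ Kᶜ = 0) {R ρ : ℝ} (hR : 0 ≤ R) (hρ : 0 < ρ)
    (h : R < ρ * liminf (fun n : ℕ => minEigenvalue (momentMatrix n μ) ^ (1 / (2 * n : ℝ))) atTop) :
    R < ρ ∧ ∀ᶠ n : ℕ in atTop, 0 < minEigenvalue (momentMatrix n μ) ∧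
      R ^ n ≤ ρ ^ n * √(minEigenvalue (momentMatrix n μ)) := by
  have h0 := minEigenvalue_momentMatrix_nonneg hK hμ
  have h1 := minEigenvalue_momentMatrix_le_one hK hμ
  have h2 : R / ρ < liminf (fun n : ℕ => minEigenvalue (momentMatrix n μ) ^ (1 / (2 * n : ℝ)))
      atTop := by rwa [div_lt_iff₀' hρ]
  have h3 := eventually_lt_of_lt_liminf h2
    (isBoundedUnder_of_eventually_ge (Eventually.of_forall fun n => Real.rpow_nonneg (h0 n) _))
  constructor
  -- As the eigenvalues are at most $1$, so are their roots, which forces $R/\rho<1$.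
  · obtain ⟨n, hn⟩ := h3.exists
    have := hn.trans_le (Real.rpow_le_one (h0 n) (h1 n) (by positivity))
    rwa [div_lt_one hρ] at this
  · filter_upwards [h3, eventually_gt_atTop 0] with n hn hn0
    have hn0' : (0 : ℝ) < n := by exact_mod_cast hn0
    have hRρ : 0 ≤ R / ρ := by positivity
    set Λ := minEigenvalue (momentMatrix n μ)
    have hΛ : 0 < Λ := by
      refine (h0 n).lt_of_ne fun h4 => ?_
      change 0 = Λ at h4
      -- A zero eigenvalue would have root $0$, below $R/\rho\ge0$; the exponent is nonzero only
      -- because $n>0$.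
      rw [← h4, Real.zero_rpow (by positivity)] at hn
      linarith
    refine ⟨hΛ, ?_⟩
    have h5 : (R / ρ) ^ n ≤ √Λ := by
      refine Real.le_sqrt_of_sq_le ?_
      rw [← pow_mul, mul_comm n 2]
      calc (R / ρ) ^ (2 * n) ≤ (Λ ^ (1 / (2 * n : ℝ))) ^ (2 * n) := by gcongr
        _ = Λ := by
          rw [← Real.rpow_natCast, ← Real.rpow_mul hΛ.le]
          push_cast
          rw [one_div_mul_cancel (by positivity), Real.rpow_one]
    rw [div_pow, div_le_iff₀ (by positivity)] at h5
    linarith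

variable {p : CSpace d} {V : CSpace d → CSpace d} {U : Set (CSpace d)} {T : ℝ}
  {φ : ℝ → CSpace d → CSpace d}

open scoped Matrix.Norms.L2Operator in
-- Both assertions are limits in $N$: the empirical moment matrix converges in norm, and the mean
-- squared remainder converges to its integral against $\mu$, which is at most $Q$ since $\mu$ is
-- carried by its support. A strictly larger $Q'$ is needed to have the bound at finite $N$.
theorem IsFlowOn.eventually_empirical_bounds (hKc : IsCompact K)
    (hU : IsOpen U) (hV : DifferentiableOn ℂ V U)
    (hT : 0 < T) (hφ : IsFlowOn V U ((fun z => p + z) '' K) T φ) [IsProbabilityMeasure μ]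
    (hμ : μ Kᶜ = 0) (hz : ∀ k, z₀ k ∈ K)
    (hw : ∀ g : CSpace d →ᵇ ℝ, Tendsto
      (fun N : ℕ => ∫ x, g x ∂(empirical fun k : Fin N => z₀ k)) atTop (𝓝 (∫ x, g x ∂μ)))
    {m n : ℕ} {Q Q' : ℝ} (hQ : Q < Q')
    (hrem : ∀ x ∈ μ.support,
      ∑ β : MultiIdx d m, ‖jetRemainder p (φ T) n β.1 (p + x)‖ ^ 2 ≤ Q)
    (hΛ : 0 < minEigenvalue (momentMatrix n μ)) :
    ∀ᶠ N : ℕ in atTop,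
      (∀ a : MultiIdx d n → ℂ, minEigenvalue (momentMatrix n μ) / 2 * ∑ α, ‖a α‖ ^ 2 ≤
        (star a ⬝ᵥ (momentMatrix n (empirical fun k : Fin N => z₀ k) *ᵥ a)).re) ∧
      (N : ℝ)⁻¹ * ∑ k : Fin N, ∑ β : MultiIdx d m,
        ‖jetRemainder p (φ T) n β.1 (p + z₀ k)‖ ^ 2 ≤ Q' := by
  have hTT : T ∈ Set.Icc 0 T := ⟨hT.le, le_rfl⟩
  have hcont : ContinuousOn (fun x => ∑ β : MultiIdx d m,
      ‖jetRemainder p (φ T) n β.1 (p + x)‖ ^ 2) K := by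
    refine continuousOn_finsetSum _ fun β _ => (ContinuousOn.norm ?_).pow 2
    have h1 : ContinuousOn (fun x => φ T (p + x)) K :=
      (hφ.continuousOn hU hV hTT).comp (by fun_prop) fun x hx => ⟨x, hx, rfl⟩
    have hu : ∀ α : Fin d → ℕ, Continuous (u p α) := fun α => (differentiable_u p α).continuous
    unfold jetRemainder
    refine ((hu _).comp_continuousOn h1).sub (Continuous.continuousOn ?_)
    exact continuous_finsetSum _ fun α _ =>
      continuous_const.mul ((hu _).comp (continuous_const.add continuous_id))
  have h2 := tendsto_integral_empirical hKc hμ hz hw hcont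
  have h3 : ∫ x, ∑ β : MultiIdx d m, ‖jetRemainder p (φ T) n β.1 (p + x)‖ ^ 2 ∂μ ≤ Q := by
    calc _ ≤ ∫ _x, Q ∂μ := by
          refine integral_mono_ae (integrable_of_continuousOn hKc hμ hcont)
            (integrable_const Q) ?_
          filter_upwards [Measure.support_mem_ae (μ := μ)] with x hx using hrem x hx
      _ = Q := by simp
  have h4 := (tendsto_momentMatrix_empirical hKc hμ hz hw n).const_sub (momentMatrix n μ)
  rw [sub_self] at h4
  have h5 := h4.norm
  rw [norm_zero] at h5
  filter_upwards [h2.eventually_le_const (h3.trans_lt hQ),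
    h5.eventually_le_const (half_pos hΛ)] with N hN1 hN2
  refine ⟨mul_minEigenvalue_le_of_norm_sub_le (isHermitian_momentMatrix n μ) hN2, ?_⟩
  rw [integral_empirical] at hN1
  exact hN1

open scoped Matrix.Norms.L2Operator in
-- For fixed $m$ the error of $\widehat{\mathbf C}$ is $O(\rho^n)$ once $N$ is large, so for large
-- $n$ it falls below half of $B_m^{-1}$ and the logarithm estimate applies.
theorem IsFlowOn.limit_error_bound (hK : IsAbsConvex K) (hKc : IsCompact K)
    (hK0 : K ∈ 𝓝 0) (hU : IsOpen U) (hKU : (fun z => p + z) '' K ⊆ U)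
    (hV : DifferentiableOn ℂ V U) (hVp : V p = 0)
    (hreal : ∀ c : ℂ, Module.End.HasEigenvalue
      ((fderiv ℂ V p : CSpace d →L[ℂ] CSpace d) : CSpace d →ₗ[ℂ] CSpace d) c → c.im = 0)
    (hT : 0 < T) (hφ : IsFlowOn V U ((fun z => p + z) '' K) T φ)
    (hμ : IsProbabilityMeasure μ) (hμK : μ Kᶜ = 0) :
    ∃ c : ℕ → ℝ, (∀ m, 0 < c m) ∧
      ∀ K₁ : Set (CSpace d), IsCompact K₁ → K₁ ⊆ interior K →
      ∃ C' : ℝ, 0 < C' ∧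
        ∀ ρ ∈ Set.Ioo (0 : ℝ) 1,
          supGauge K μ.support <
            ρ * liminf (fun n : ℕ => minEigenvalue (momentMatrix n μ) ^ (1 / (2 * n : ℝ)))
              atTop →
        ∀ z₀ : ℕ → CSpace d, (∀ k, z₀ k ∈ K) →
          (∀ g : CSpace d →ᵇ ℝ, Tendsto
            (fun N : ℕ => ∫ x, g x ∂(empirical fun k : Fin N => z₀ k)) atTop
            (𝓝 (∫ x, g x ∂μ))) →
        ∀ m : ℕ, ∀ᶠ n in atTop, ∀ (hmn : m ≤ n) (ε : ℝ), 0 < ε → ∀ᶠ N : ℕ in atTop,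
          NoNonposEigenvalue (approxMatrix p (φ T) hmn fun k : Fin N => p + z₀ k) ∧
          ∀ z ∈ K₁,
            ‖reconstructedField p T (approxMatrix p (φ T) hmn fun k : Fin N => p + z₀ k)
                (p + z) - V (p + z)‖ ≤
              C' * (‖p‖ ^ m / √((m - 1).factorial : ℝ) + c m * ρ ^ n +
                supGauge K K₁ ^ m / (1 - supGauge K K₁)) + ε := by
  have hpK : (fun z => p + z) '' K ∈ 𝓝 p := image_add_mem_nhds_self hK0
  have hpU : p ∈ U := hKU (mem_of_mem_nhds hpK)
  obtain ⟨C₁, hC₁, hfield⟩ :=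
    hφ.exists_norm_reconstructedField_sub_le hK hKc hK0 hU hKU hV hVp hreal hT
  obtain ⟨C₂, hC₂, happrox⟩ := hφ.exists_opNorm_sub_approxMatrix_le hKc hK0 hU hKU hV hVp hT
  obtain ⟨C₃, hC₃, hrem⟩ := hφ.exists_sum_norm_jetRemainder_sq_le hK hKc hK0 hU hV hT
  have hsub : μ.support ⊆ K := Measure.support_subset_of_isClosed hKc.isClosed (mem_ae_iff.2 hμK)
  have hR0 := supGauge_nonneg K μ.support
  set R := supGauge K μ.support with hR
  -- The constant has to be fixed before $\rho$, while $R<1$ only follows from the condition on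
  -- $\rho$; the absolute value keeps it nonnegative in every case. The extra $1$ pays for the slack
  -- $\sqrt\Lambda\,\rho^n$ added to the remainder below.
  set κ := C₃ / |1 - R| + 1 with hκ
  have hκ0 : 0 < κ := by positivity
  let B : ℕ → ℝ := fun m => resolventBound (pushforwardMatrix p (φ T) m)
  have hlog := hφ.matLog_pushforwardMatrix hU hV hpK hpU hVp hT hreal
  have hB : ∀ m, 1 ≤ B m := fun m => by
    have : Nonempty (MultiIdx d m) := ⟨⟨0, by simp⟩⟩
    exact (hlog m).1.one_le_resolventBound
  have hB0 : ∀ m, 0 < B m := fun m => one_pos.trans_le (hB m)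
  -- The factor $2$ reflects that the empirical form is only bounded below by $\Lambda/2$.
  let E : ℕ → ℝ := fun m => C₂ * (√(2 * m.factorial) * κ)
  have hE0 : ∀ m, 0 < E m := fun m => by positivity
  -- The logarithm estimate is used with $\gamma=1/2$.
  refine ⟨fun m => B m ^ 2 / (1 / 2) * E m, fun m => by have := hB0 m; have := hE0 m; positivity,
    fun K₁ hK₁ hK₁K => ⟨C₁, hC₁, ?_⟩⟩
  intro ρ hρ hliminf z₀ hz hw m
  have hρ0 := hρ.1
  have hR0' := supGauge_nonneg K K₁
  have hR1' := supGauge_lt_one hK hK0 hK₁ hK₁K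
  set R₁ := supGauge K K₁ with hR₁
  obtain ⟨hRρ, hΛev⟩ := eventually_pow_le_sqrt_minEigenvalue hKc hμK hR0 hρ0 hliminf
  have hR1 : R < 1 := hRρ.trans hρ.2
  have hRp : 0 < 1 - R := by linarith
  have hsmall : ∀ᶠ n : ℕ in atTop, E m * ρ ^ n ≤ (1 - 1 / 2) * (B m)⁻¹ := by
    have h1 := (tendsto_pow_atTop_nhds_zero_of_lt_one hρ0.le hρ.2).const_mul (E m)
    rw [mul_zero] at h1
    exact h1.eventually_le_const (by have := hB0 m; positivity)
  filter_upwards [hΛev, hsmall] with n hn1 hn2 hmn ε hε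
  obtain ⟨hΛ, hRn⟩ := hn1
  have : Nonempty (MultiIdx d m) := ⟨⟨0, by simp⟩⟩
  set Λ := minEigenvalue (momentMatrix n μ) with hΛd
  -- A strict margin for passing to the limit in $N$, chosen of the same order as the available
  -- bound on the remainder so that it does not spoil the rate.
  have hS0 : 0 < √Λ * ρ ^ n := by positivity
  set Q := C₃ * R ^ n / (1 - R) with hQ
  have hQ0 : 0 ≤ Q := by positivity
  have hev := hφ.eventually_empirical_bounds (μ := μ) (m := m) (n := n)
    (Q := Q ^ 2) (Q' := (Q + √Λ * ρ ^ n) ^ 2) hKc hU hV hT hμK hz hw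
    (pow_lt_pow_left₀ (by linarith) hQ0 two_ne_zero)
    (fun x hx => hrem m n R hR0 hR1 x (gauge_le_supGauge hsub hx)) hΛ
  filter_upwards [hev, eventually_gt_atTop 0] with N hN hNpos
  obtain ⟨hN1, hN2⟩ := hN
  have h1 := happrox m n hmn N hNpos (fun k => z₀ k) (fun k => hz k) (Λ / 2) (Q + √Λ * ρ ^ n)
    (by positivity) (by positivity) hN1 hN2
  set Cm := pushforwardMatrix p (φ T) m with hCm
  set Ch := approxMatrix p (φ T) hmn fun k : Fin N => p + z₀ k with hCh
  have h2 : ‖Cm - Ch‖ ≤ E m * ρ ^ n := by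
    refine h1.trans ?_
    have h3 : Q + √Λ * ρ ^ n ≤ κ * (√Λ * ρ ^ n) := by
      rw [hκ, abs_of_pos hRp, add_mul, one_mul]
      gcongr
      calc Q = C₃ / (1 - R) * R ^ n := by rw [hQ]; ring
        _ ≤ C₃ / (1 - R) * (ρ ^ n * √Λ) := by gcongr
        _ = _ := by ring
    have h4 : √(m.factorial / (Λ / 2)) * √Λ = √(2 * m.factorial) := by
      rw [← Real.sqrt_mul (by positivity)]
      congr 1
      field_simp
    calc _ ≤ C₂ * (√(m.factorial / (Λ / 2)) * (κ * (√Λ * ρ ^ n))) := by gcongr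
      _ = C₂ * ((√(m.factorial / (Λ / 2)) * √Λ) * κ) * ρ ^ n := by ring
      _ = _ := by rw [h4]
  have h5 : ‖Cm - Ch‖ ≤ (1 - 1 / 2) * (resolventBound Cm)⁻¹ := h2.trans hn2
  obtain ⟨hsegD, -⟩ := (hlog m).1.perturb (by norm_num) h5
  refine ⟨(segmentUnit_iff _).1 hsegD, fun z hzK => ?_⟩
  have h6 := norm_matLog_sub_le (hlog m).1 (by norm_num) h5
  refine (hfield m Ch R₁ hR0' hR1' z
    (gauge_le_supGauge (hK₁K.trans interior_subset) hzK)).trans ?_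
  -- The margin has already been absorbed in the constant, so the bound holds for large $N$ even
  -- without $\varepsilon$.
  refine le_add_of_le_of_nonneg (mul_le_mul_of_nonneg_left ?_ hC₁.le) hε.le
  rw [norm_sub_rev]
  have h7 : 0 ≤ ‖p‖ ^ m / √((m - 1).factorial : ℝ) := by positivity
  have h8 : ‖matLog Cm - matLog Ch‖ ≤ B m ^ 2 / (1 / 2) * E m * ρ ^ n := by
    refine h6.trans ?_
    rw [mul_assoc]
    exact mul_le_mul_of_nonneg_left h2 (by have := hB0 m; positivity)
  linarith

end Limit

end FockPushforward

/-! ### Error bounds for the reconstructed vector field -/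

open FockPushforward in
theorem theorem6p3 {d : ℕ} (p : CSpace d) (hp : ∀ i, (p i).im = 0)
    (K₀ : Set (CSpace d)) (hK₀c : IsCompact K₀) (hK₀a : IsAbsConvex K₀) (hK₀n : K₀ ∈ 𝓝 0)
    (U : Set (CSpace d)) (hU : IsOpen U) (hKU : (fun z => p + z) '' K₀ ⊆ U)
    (V : CSpace d → CSpace d) (hV : DifferentiableOn ℂ V U) (hVp : V p = 0)
    (hreal : ∀ c : ℂ, Module.End.HasEigenvalue
      ((fderiv ℂ V p : CSpace d →L[ℂ] CSpace d) : CSpace d →ₗ[ℂ] CSpace d) c → c.im = 0)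
    (T : ℝ) (hT : 0 < T) (φ : ℝ → CSpace d → CSpace d)
    (hφ : IsFlowOn V U ((fun z => p + z) '' K₀) T φ) :
    -- the error bound for given samples
    (∀ μ : Measure (CSpace d), IsFiniteMeasure μ → μ.support ⊆ interior K₀ →
      ∀ K₁ : Set (CSpace d), IsCompact K₁ → K₁ ⊆ interior K₀ →
      ∃ C' : ℝ, 0 < C' ∧
        ∀ (m n : ℕ) (hmn : m ≤ n) (N : ℕ), 0 < N →
        ∀ z₀ : Fin N → CSpace d, (∀ k, z₀ k ∈ μ.support) →
        ∀ γ₁ ∈ Set.Ioo (0 : ℝ) 1, ∀ γ₂ ∈ Set.Ioo (0 : ℝ) 1,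
          IsUnit (momentMatrix n μ) →
          opNorm (1 - invSqrt (momentMatrix n μ) * momentMatrix n (empirical z₀) *
            invSqrt (momentMatrix n μ)) ≤ 1 - γ₁ →
          opNorm (pushforwardMatrix p (φ T) m - approxMatrix p (φ T) hmn (fun k => p + z₀ k)) <
            (1 - γ₂) * (resolventBound (pushforwardMatrix p (φ T) m))⁻¹ →
          NoNonposEigenvalue (approxMatrix p (φ T) hmn (fun k => p + z₀ k)) ∧
          ∀ z ∈ K₁,
            ‖reconstructedField p T (approxMatrix p (φ T) hmn (fun k => p + z₀ k)) (p + z) -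
                V (p + z)‖ ≤
              C' * (‖p‖ ^ m / √((m - 1).factorial : ℝ) +
                resolventBound (pushforwardMatrix p (φ T) m) ^ 2 / γ₂ *
                  √((m.factorial : ℝ) / γ₁) *
                  (supGauge K₀ μ.support ^ n / √(minEigenvalue (momentMatrix n μ))) +
                supGauge K₀ K₁ ^ m)) ∧
    -- the limit of infinitely many samples
    (∀ μ : Measure (CSpace d), IsProbabilityMeasure μ → μ K₀ᶜ = 0 →
      μ ≪ (volume : Measure (EuclideanSpace ℝ (Fin d))).map realIncl →
      ∃ c : ℕ → ℝ, (∀ m, 0 < c m) ∧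
        ∀ K₁ : Set (CSpace d), IsCompact K₁ → K₁ ⊆ interior K₀ →
        ∃ C' : ℝ, 0 < C' ∧
          ∀ ρ ∈ Set.Ioo (0 : ℝ) 1,
            supGauge K₀ μ.support <
              ρ * liminf (fun n : ℕ => minEigenvalue (momentMatrix n μ) ^ (1 / (2 * n : ℝ)))
                atTop →
          ∀ z₀ : ℕ → CSpace d, (∀ k, z₀ k ∈ K₀) →
            (∀ g : CSpace d →ᵇ ℝ, Tendsto
              (fun N : ℕ => ∫ x, g x ∂(empirical fun k : Fin N => z₀ k)) atTop
              (𝓝 (∫ x, g x ∂μ))) →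
          ∀ m : ℕ, ∀ᶠ n in atTop, ∀ (hmn : m ≤ n) (ε : ℝ), 0 < ε → ∀ᶠ N : ℕ in atTop,
            NoNonposEigenvalue (approxMatrix p (φ T) hmn fun k : Fin N => p + z₀ k) ∧
            ∀ z ∈ K₁,
              ‖reconstructedField p T (approxMatrix p (φ T) hmn fun k : Fin N => p + z₀ k)
                  (p + z) - V (p + z)‖ ≤
                C' * (‖p‖ ^ m / √((m - 1).factorial : ℝ) + c m * ρ ^ n +
                  supGauge K₀ K₁ ^ m / (1 - supGauge K₀ K₁)) + ε) := by
  refine ⟨fun μ hμ hμK K₁ hK₁ hK₁K => ?_, fun μ hμ hμK _ => ?_⟩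
  · exact hφ.error_bound hK₀a hK₀c hK₀n hU hKU hV hVp hreal hT μ hμ hμK K₁ hK₁ hK₁K
  · exact hφ.limit_error_bound hK₀a hK₀c hK₀n hU hKU hV hVp hreal hT hμ hμK
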